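/- **Data.** Let $\mathfrak h$ be a finite-dimensional complex vector space with a non-degenerate symmetric bilinear form $(\cdot,\cdot)$ (also transported to $\mathfrak h^*$), let $\alpha_1,\dots,\alpha_R\in\mathfrak h^*$ be linearly independent, let $H_i\in\mathfrak h$ be given by $(H_i,X)=\langle\alpha_i,X\rangle$, and put $b_{ij}=(\alpha_i,\alpha_j)=\langle\alpha_j,H_i\rangle$. Let $\mathfrak g$ be the Lie algebra generated by $E_i,F_i$ $(1\le i\le R)$ and the vector space $\mathfrak h$ with relations $[E_i,F_j]=\delta_{ij}H_i$, $[X,E_i]=\langle\alpha_i,X\rangle E_i$, $[X,F_i]=-\langle\alpha_i,X\rangle F_i$, $[X,X']=0$ $(X,X'\in\mathfrak h)$; no Serre relations are imposed. Let $\mathfrak n$ (resp. $\mathfrak n_+$) be the subalgebra generated by the $F_i$ (resp. the $E_i$), so that $\mathfrak g=\mathfrak n\oplus\mathfrak h\oplus\mathfrak n_+$. Let $K$ be the unique invariant bilinear form on $\mathfrak g$ (that is, $K([x,y],z)=K(x,[y,z])$) that extends $(\cdot,\cdot)$, satisfies $K(F_i,E_j)=K(E_i,F_j)=\delta_{ij}$,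 and vanishes on $\mathfrak n\times\mathfrak n$, $\mathfrak n_+\times\mathfrak n_+$ and (in either order) on $\mathfrak h\times(\mathfrak n\oplus\mathfrak n_+)$. Its kernel $\ker S_{\mathfrak g}$ is an ideal (it is also the kernel of the Shapovalov form $S_{\mathfrak g}(x,y)=-K(\varphi(x),y)$, where $\varphi$ is the anti-involution with $\varphi(E_i)=F_i$, $\varphi(F_i)=E_i$, $\varphi|_{\mathfrak h}=\mathrm{id}$). Put $\widetilde{\mathfrak g}=\mathfrak g/\ker S_{\mathfrak g}$. Let $\sigma$ be a diagram automorphism of $\mathfrak g$: an automorphism of finite order $T$ with $\sigma E_i=E_{\sigma(i)}$, $\sigma F_i=F_{\sigma(i)}$, $\sigma H_i=H_{\sigma(i)}$ for a permutation $\sigma$ of $\{1,\dots,R\}$. Let $\omega$ be a primitive $T$-th root of unity. Let $r$ be the number of cycles of the permutation $\sigma$, let $\iota(1),\dots,\iota(r)$ be representatives of the cycles, one for each, and let $T_i$ be the length of the cycle of $\iota(i)$. Write $\bar x=\sum_{k=0}^{T-1}\sigma^kx$ for the projection of $\mathfrak g$ onto the fixed-point subalgebra $\mathfrak g^\sigma$,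 and let $\widetilde{\mathfrak g}^\sigma$ be the fixed-point subalgebra of $\widetilde{\mathfrak g}$. **Flags.** Fix $\lambda\in\mathbb Z_{\ge0}^r$ with $m=\lambda_1+\dots+\lambda_r\geq 1$ and write $[i,n]=\lambda_1+\dots+\lambda_{i-1}+n\in\{1,\dots,m\}$ for $1\le n\le\lambda_i$; the index $[i,n]$ is said to have colour $i$. Let $\mathcal C$ be the arrangement in $\mathbb C^m$ of the hyperplanes $H_{pq}^k=\{t_p=\omega^kt_q\}$, $1\le p<q\le m$, $k\in\mathbb Z/T$, with weight $a(H_{pq}^k)=(\alpha_{\iota(i)},\alpha_{\sigma^k\iota(j)})$ if $p,q$ have colours $i,j$. For a flag $L=(L^0\supset L^1\supset\dots\supset L^m)$ with $\operatorname{codim}L^n=n$ let $\langle L,H_1\wedge\dots\wedge H_m\rangle=\operatorname{sgn}(s)$ if there is a permutation $s$ with $L^n=H_{s(1)}\cap\dots\cap H_{s(n)}$ for all $n$, and $0$ otherwise, and let $$G_0(L,L')=\sum_{\{H_1,\dots,H_m\}\subset\mathcal C}\langle L,H_1\wedge\dots\wedge H_m\rangle\,\langle L',H_1\wedge\dots\wedge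 H_m\rangle\,a(H_1)\cdots a(H_m).$$ Let $f^k_p$ $(k\in\mathbb Z/T,\ 1\le p\le m)$ be free Lie generators, permuted by $f^k_p\mapsto f^{k+1}_p$; a bar again denotes summation over $\mathbb Z/T$, and $\bar f_p$ is the bar of $f^0_p$. Let $g$ be an iterated commutator containing, for each $p$, exactly one generator $f^{k_p}_p$. To $\bar g$ we attach the signed flag $\psi(\bar g v_0)$ as follows. The flag starts with $L^0=\mathbb C^m$. The commutator is built from its leaves; whenever two already formed subcommutators $x,y$ are joined to $[x,y]$ one intersects with the subspace on which $\omega^{k_p}t_p$ takes one common value for all $p$ occurring in $[x,y]$; in the last step one sets all $t_p=0$. The sign is the one obtained by starting from the wedge product $\bar f_1\wedge\dots\wedge\bar f_m$, with the rule that $\bar f_{p}$ stands for the one-leaf commutators with index $p$ and that each joining replaces $\cdots\wedge\bar y\wedge\bar x$ by $\cdots\wedge\overline{[x,y]}$. For definiteness, to form $[x,y]$ one first forms $x$ completely, then $y$, and then joins them. If $g$ does not contain each index exactly once, $\psi(\bar gv_0)$ is defined as $0$. Let $G_0(\bar g,\bar g')=G_0(\psi(\bar gv_0),\psi(\bar g'v_0))$,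 extended bilinearly to sums of such $\bar g$. **The form $\Omega$.** A commutator in the $F_a$, or in the $E_a$, has weight $\lambda\in\mathbb Z_{\ge 0}^r$, where $\lambda_i$ is the number of its factors with index in the $i$-th cycle. For a commutator $u$ in the $F_a$ of weight $\lambda$ let $\mathsf s(\bar u)=\sum_g\bar g$, where the substitution $F_a\mapsto\sum f^k_p$ (sum over all $(k,p)$ with $p$ of some colour $i$ and $\sigma^k\iota(i)=a$) turns $u$ into $\sum_gg$. Define $\varphi(\mathsf s(\bar v))$, for a commutator $v$ in the $E_a$, likewise with $E_a\mapsto\sum f^k_p$, but with $[x,y]$ replaced throughout by $[y,x]$. Let $|\Sigma\mathbb Z_\lambda|=\prod_i(T/T_i)^{\lambda_i}\lambda_i!$. Consider the skew-symmetric bilinear form $\Omega:\mathfrak g^\sigma\times\mathfrak g^\sigma\to\mathbb C$ with $$\Omega(\bar v,\bar u)=\frac1{|\Sigma\mathbb Z_\lambda|}\,G_0\bigl(\varphi(\mathsf s(\bar v)),\mathsf s(\bar u)\bigr)$$ for all commutators $v$ in the $E_a$ and $u$ in the $F_a$ of the same weight $\lambda$, which vanishes if the weights of $u$ and $v$ are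 different, and on $\mathfrak n^\sigma\times\mathfrak n^\sigma$, $\mathfrak n_+^\sigma\times\mathfrak n_+^\sigma$ and $\mathfrak h^\sigma\times\mathfrak g^\sigma$. **Corollary.** If $\widetilde{\mathfrak g}^\sigma$ is finite-dimensional and semisimple, then $\Omega$ is well defined (there is exactly one such form) and $\Omega=0$. -/

import Mathlib

/-!
# The cocycle attached to a diagram automorphism by a cyclotomic discriminantal arrangement

The first part builds the Lie algebra `𝔤` ("Kac-Moody algebra without Serre relations") of a
Cartan datum, its invariant form, the quotient by the kernel of the form, diagram automorphisms
and fixed-point subalgebras. The second part builds the arrangement of diagonal hyperplanes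
`t_p = ω^k t_q`, flags, the pairing of flags with tuples of hyperplanes and the geometric form.
The third part attaches flags to commutators and defines the cocycle `Ω`.
-/

noncomputable section

namespace Cyclo

open Finset

/-! ## Cartan data, the Lie algebra `𝔤`, diagram automorphisms -/

/-- A vector space `𝔥` with a non-degenerate symmetric bilinear form and linearly independent
simple roots `α_1, …, α_R ∈ 𝔥*`. -/
structure CartanData (R : ℕ) (𝔥 : Type*) [AddCommGroup 𝔥] [Module ℂ 𝔥] where
  form : LinearMap.BilinForm ℂ 𝔥
  form_symm : form.IsSymm
  form_nondegenerate : form.Nondegenerate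
  root : Fin R → Module.Dual ℂ 𝔥
  root_linearIndependent : LinearIndependent ℂ root

/-- The generators `E_i`, `F_i` (`1 ≤ i ≤ R`) and `H ∈ 𝔥`. -/
inductive Gen (R : ℕ) (𝔥 : Type*)
  | E : Fin R → Gen R 𝔥
  | F : Fin R → Gen R 𝔥
  | H : 𝔥 → Gen R 𝔥

section LieAlgebra

variable {R : ℕ} {𝔥 : Type*} [AddCommGroup 𝔥] [Module ℂ 𝔥] [FiniteDimensional ℂ 𝔥]

namespace CartanData

/-- `H_i ∈ 𝔥`, the element with `(H_i, X) = ⟨X, α_i⟩` for all `X ∈ 𝔥`. -/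
def coroot (D : CartanData R 𝔥) (i : Fin R) : 𝔥 :=
  (D.form.toDual D.form_nondegenerate).symm (D.root i)

/-- `b_ij = (α_i, α_j) = ⟨H_i, α_j⟩`. -/
def cartan (D : CartanData R 𝔥) (i j : Fin R) : ℂ := D.root j (D.coroot i)

/-- The generators, in the free Lie algebra. -/
abbrev free (_D : CartanData R 𝔥) (x : Gen R 𝔥) : FreeLieAlgebra ℂ (Gen R 𝔥) := FreeLieAlgebra.of ℂ x

open Gen in
/-- The defining relations of `𝔤`: each of the listed elements is to become `0`. The last two say
that `𝔥 → 𝔤` is linear. -/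
inductive Rel (D : CartanData R 𝔥) : FreeLieAlgebra ℂ (Gen R 𝔥) → Prop
  | EF_same (i : Fin R) : Rel D (⁅D.free (E i), D.free (F i)⁆ - D.free (H (D.coroot i)))
  | EF_ne (i j : Fin R) (hij : i ≠ j) : Rel D ⁅D.free (E i), D.free (F j)⁆
  | HE (X : 𝔥) (i : Fin R) : Rel D (⁅D.free (H X), D.free (E i)⁆ - D.root i X • D.free (E i))
  | HF (X : 𝔥) (i : Fin R) : Rel D (⁅D.free (H X), D.free (F i)⁆ + D.root i X • D.free (F i))
  | HH (X Y : 𝔥) : Rel D ⁅D.free (H X), D.free (H Y)⁆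
  | H_add (X Y : 𝔥) : Rel D (D.free (H (X + Y)) - (D.free (H X) + D.free (H Y)))
  | H_smul (c : ℂ) (X : 𝔥) : Rel D (D.free (H (c • X)) - c • D.free (H X))

/-- The ideal generated by the defining relations. -/
def relIdeal (D : CartanData R 𝔥) : LieIdeal ℂ (FreeLieAlgebra ℂ (Gen R 𝔥)) :=
  LieSubmodule.lieSpan ℂ _ {x | D.Rel x}

/-- The Lie algebra `𝔤 = 𝔤(B)`, by generators and relations. -/
abbrev LieAlg (D : CartanData R 𝔥) : Type _ := FreeLieAlgebra ℂ (Gen R 𝔥) ⧸ D.relIdeal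

/-- The class in `𝔤` of a generator. -/
def gen (D : CartanData R 𝔥) (x : Gen R 𝔥) : D.LieAlg :=
  LieSubmodule.Quotient.mk (FreeLieAlgebra.of ℂ x)

/-- `E_i ∈ 𝔤`. -/
def genE (D : CartanData R 𝔥) (i : Fin R) : D.LieAlg := D.gen (Gen.E i)

/-- `F_i ∈ 𝔤`. -/
def genF (D : CartanData R 𝔥) (i : Fin R) : D.LieAlg := D.gen (Gen.F i)

/-- The image in `𝔤` of `X ∈ 𝔥`. -/
def genH (D : CartanData R 𝔥) (X : 𝔥) : D.LieAlg := D.gen (Gen.H X)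

/-- `𝔫 ⊆ 𝔤`, the subalgebra generated by the `F_i`. -/
def nMinus (D : CartanData R 𝔥) : LieSubalgebra ℂ D.LieAlg :=
  LieSubalgebra.lieSpan ℂ D.LieAlg (Set.range D.genF)

/-- `𝔫_+ ⊆ 𝔤`, the subalgebra generated by the `E_i`. -/
def nPlus (D : CartanData R 𝔥) : LieSubalgebra ℂ D.LieAlg :=
  LieSubalgebra.lieSpan ℂ D.LieAlg (Set.range D.genE)

/-- `K` is the standard invariant bilinear form on `𝔤`. There is exactly one such form. -/
structure IsStandardForm (D : CartanData R 𝔥) (K : LinearMap.BilinForm ℂ D.LieAlg) : Prop where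
  cartan_cartan : ∀ X Y : 𝔥, K (D.genH X) (D.genH Y) = D.form X Y
  minus_minus : ∀ x ∈ D.nMinus, ∀ y ∈ D.nMinus, K x y = 0
  plus_plus : ∀ x ∈ D.nPlus, ∀ y ∈ D.nPlus, K x y = 0
  cartan_minus : ∀ X : 𝔥, ∀ y ∈ D.nMinus, K (D.genH X) y = 0 ∧ K y (D.genH X) = 0
  cartan_plus : ∀ X : 𝔥, ∀ y ∈ D.nPlus, K (D.genH X) y = 0 ∧ K y (D.genH X) = 0
  gen_gen : ∀ i j : Fin R, K (D.genF i) (D.genE j) = (if i = j then 1 else 0) ∧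
    K (D.genE i) (D.genF j) = (if i = j then 1 else 0)
  invariant : ∀ x y z : D.LieAlg, K ⁅x, y⁆ z = K x ⁅y, z⁆

/-- The kernel of the standard form `K`, as an ideal of `𝔤`. It is also the kernel of the
Shapovalov form `S(x, y) = -K(φ(x), y)`, where the Cartan anti-involution `φ` is bijective. -/
def formKer (D : CartanData R 𝔥) : LieIdeal ℂ D.LieAlg where
  carrier := {x | ∀ K, D.IsStandardForm K → ∀ y, K x y = 0}
  zero_mem' := by intro K _ y; simp
  add_mem' := by
    intro a b ha hb K hK y
    rw [map_add, LinearMap.add_apply, ha K hK y, hb K hK y, add_zero]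
  smul_mem' := by
    intro c x hx K hK y
    rw [map_smul, LinearMap.smul_apply, hx K hK y, smul_zero]
  lie_mem := by
    intro x m hm K hK y
    have h : K ⁅m, x⁆ y = 0 := by rw [hK.invariant]; exact hm K hK _
    rw [← lie_skew, map_neg, LinearMap.neg_apply, h, neg_zero]

/-- `𝔤̃ = 𝔤 / ker S`. -/
abbrev LieAlgQuot (D : CartanData R 𝔥) : Type _ := D.LieAlg ⧸ D.formKer

/-- A diagram automorphism of `𝔤`, of finite order: an automorphism that permutes the `E_i`, the
`F_i` and the `H_i` by one permutation of `{1, …, R}`. -/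
structure DiagramAut (D : CartanData R 𝔥) where
  aut : D.LieAlg ≃ₗ⁅ℂ⁆ D.LieAlg
  perm : Equiv.Perm (Fin R)
  map_E : ∀ i, aut (D.genE i) = D.genE (perm i)
  map_F : ∀ i, aut (D.genF i) = D.genF (perm i)
  map_H : ∀ i, aut (D.genH (D.coroot i)) = D.genH (D.coroot (perm i))
  finite_order : IsOfFinOrder aut.toLinearEquiv

namespace DiagramAut

variable {D : CartanData R 𝔥} (σ : D.DiagramAut)

/-- The order `T` of `σ`. -/
def order : ℕ := orderOf σ.aut.toLinearEquiv

instance : NeZero σ.order := ⟨(orderOf_pos_iff.mpr σ.finite_order).ne'⟩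

/-- The fixed-point subalgebra `𝔤^σ`. -/
def fixed : LieSubalgebra ℂ D.LieAlg where
  carrier := {x | σ.aut x = x}
  zero_mem' := by simp
  add_mem' := by
    intro a b ha hb
    simp only [Set.mem_ofPred_eq] at *
    rw [map_add, ha, hb]
  smul_mem' := by
    intro c x hx
    simp only [Set.mem_ofPred_eq] at *
    rw [map_smul, hx]
  lie_mem' := by
    intro x y hx hy
    change σ.aut ⁅x, y⁆ = ⁅x, y⁆
    rw [LieEquiv.map_lie]
    exact congrArg₂ _ hx hy

/-- The fixed-point subalgebra `𝔤̃^σ` of `𝔤̃ = 𝔤 / ker S`: the cosets `x + ker S` that `σ` maps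
to themselves, that is, with `σ x - x ∈ ker S`. -/
def fixedQuot : LieSubalgebra ℂ D.LieAlgQuot where
  carrier := {q | ∃ x : D.LieAlg, LieSubmodule.Quotient.mk x = q ∧ σ.aut x - x ∈ D.formKer}
  zero_mem' := ⟨0, rfl, by simp⟩
  add_mem' := by
    rintro _ _ ⟨x, rfl, hx⟩ ⟨y, rfl, hy⟩
    refine ⟨x + y, rfl, ?_⟩
    have : σ.aut (x + y) - (x + y) = (σ.aut x - x) + (σ.aut y - y) := by rw [map_add]; abel
    rw [this]
    exact add_mem hx hy
  smul_mem' := by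
    rintro c _ ⟨x, rfl, hx⟩
    refine ⟨c • x, rfl, ?_⟩
    rw [map_smul, ← smul_sub]
    exact D.formKer.smul_mem c hx
  lie_mem' := by
    rintro _ _ ⟨x, rfl, hx⟩ ⟨y, rfl, hy⟩
    refine ⟨⁅x, y⁆, rfl, ?_⟩
    have : σ.aut ⁅x, y⁆ - ⁅x, y⁆ = ⁅σ.aut x - x, σ.aut y⁆ + ⁅x, σ.aut y - y⁆ := by
      rw [LieEquiv.map_lie, sub_lie, lie_sub]; abel
    rw [this]
    refine add_mem ?_ (D.formKer.lie_mem hy)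
    rw [← lie_skew]
    exact neg_mem (D.formKer.lie_mem hx)

/-- The projection `x ↦ x̄ = ∑_{j ∈ ℤ/T} σ^j x` of `𝔤` onto `𝔤^σ`. -/
def bar (x : D.LieAlg) : σ.fixed :=
  ⟨∑ j ∈ range σ.order, (σ.aut.toLinearEquiv ^ j) x, by
    change σ.aut.toLinearEquiv _ = _
    have hT : (σ.aut.toLinearEquiv ^ σ.order) x = x := by
      rw [order, pow_orderOf_eq_one]; rfl
    have h1 := sum_range_succ (fun j => (σ.aut.toLinearEquiv ^ j) x) σ.order
    have h2 := sum_range_succ' (fun j => (σ.aut.toLinearEquiv ^ j) x) σ.order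
    rw [h1, hT] at h2
    have h3 : (σ.aut.toLinearEquiv ^ 0) x = x := rfl
    rw [h3] at h2
    rw [map_sum]
    refine Eq.trans (sum_congr rfl fun j _ => ?_) (add_right_cancel h2).symm
    rw [pow_succ']; rfl⟩

end DiagramAut

end CartanData

/-- The commutator in a Lie algebra that belongs to a bracketing (a binary tree whose leaves are
labelled by generators): `of a ↦ f a` and `x * y ↦ [x, y]`. -/
def commutator {α L : Type*} [LieRing L] (f : α → L) : FreeMagma α → L
  | .of a => f a
  | .mul x y => ⁅commutator f x, commutator f y⁆

end LieAlgebra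

/-! ## Central arrangements, flags and the geometric form -/

section Arrangement

variable {V : Type*} [AddCommGroup V] [Module ℂ V]

open Classical in
/-- The pairing `⟨F, H_1 ∧ … ∧ H_k⟩` of a flag `F = (L^0 ⊃ … ⊃ L^k)` with a tuple of hyperplanes:
the sign of the permutation `s` with `L^i = H_{s(1)} ∩ … ∩ H_{s(i)}` for all `i`, and `0` if there
is none. (For a flag with `codim L^i = i` there is at most one such `s`.) -/
def pairing {k : ℕ} (L : Fin (k + 1) → Submodule ℂ V) (H : Fin k → Submodule ℂ V) : ℂ :=
  ∑ s : Equiv.Perm (Fin k),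
    if ∀ i : Fin (k + 1), L i = ⨅ j : {j : Fin k // (j : ℕ) < (i : ℕ)}, H (s j)
    then ((Equiv.Perm.sign s : ℤ) : ℂ) else 0

/-- The geometric form of the arrangement `(hyp h)_{h ∈ I}` with weights `a`, on two flags: the sum
of `⟨F, H_1 ∧ … ∧ H_k⟩ ⟨F', H_1 ∧ … ∧ H_k⟩ a(H_1) ⋯ a(H_k)` over unordered `k`-tuples. Here it is
written as `1 / k!` times the sum over ordered tuples: each unordered tuple of distinct hyperplanes
is counted `k!` times, and a tuple with a repetition pairs to `0` with every flag. -/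
def geomForm {I : Type*} [Fintype I] (hyp : I → Submodule ℂ V) (a : I → ℂ) {k : ℕ}
    (L L' : Fin (k + 1) → Submodule ℂ V) : ℂ :=
  (k.factorial : ℂ)⁻¹ *
    ∑ H : Fin k → I, pairing L (hyp ∘ H) * pairing L' (hyp ∘ H) * ∏ j, a (H j)

end Arrangement

section Diagonal

variable {T m : ℕ}

/-- Labels of the hyperplanes `H_pq^k`, `p < q`, `k ∈ ℤ/T`. -/
abbrev DiagIndex (T m : ℕ) : Type := {p : Fin m × Fin m // p.1 < p.2} × ZMod T

/-- The hyperplane `H_pq^k : t_p = ω^k t_q` in `ℂ^m`. -/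
def diagHyp (ω : ℂ) (h : DiagIndex T m) : Submodule ℂ (Fin m → ℂ) where
  carrier := {t | t h.1.1.1 = ω ^ h.2.val * t h.1.1.2}
  zero_mem' := by simp
  add_mem' := by
    intro a b ha hb
    simp only [Set.mem_ofPred_eq, Pi.add_apply] at *
    rw [ha, hb]; ring
  smul_mem' := by
    intro c x hx
    simp only [Set.mem_ofPred_eq, Pi.smul_apply, smul_eq_mul] at *
    rw [hx]; ring

/-- The leaves of a bracketing, from left to right. -/
def leaves {α : Type*} : FreeMagma α → List α
  | .of a => [a]
  | .mul x y => leaves x ++ leaves y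

/-- The bracketing read from right to left. If `g` is a commutator in generators `e`, then
`φ(g)` is the commutator of the mirrored bracketing in the generators `f`, because `φ` is an
anti-automorphism: `φ([x, y]) = [φ(y), φ(x)]`. -/
def mirror {α : Type*} : FreeMagma α → FreeMagma α
  | .of a => .of a
  | .mul x y => .mul (mirror y) (mirror x)

/-! A commutator `g` in the free Lie algebra on generators `f^k_p` (`k ∈ ℤ/T`, `1 ≤ p ≤ m`) is
given by a bracketing with leaves labelled `(k, p)`. -/

/-- The edge `L_g : ω^{k_1} t_{p_1} = … = ω^{k_l} t_{p_l}`, for `g` with leaves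
`(k_1, p_1), …, (k_l, p_l)`. -/
def islandEdge (ω : ℂ) (g : FreeMagma (ZMod T × Fin m)) : Submodule ℂ (Fin m → ℂ) where
  carrier := {t | ∀ x ∈ leaves g, ∀ y ∈ leaves g,
    ω ^ x.1.val * t x.2 = ω ^ y.1.val * t y.2}
  zero_mem' := by simp
  add_mem' := by
    intro a b ha hb x hx y hy
    have h1 := ha x hx y hy
    have h2 := hb x hx y hy
    simp only [Pi.add_apply, mul_add, h1, h2]
  smul_mem' := by
    intro c t ht x hx y hy
    have h1 := ht x hx y hy
    simp only [Pi.smul_apply, smul_eq_mul]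
    rw [mul_left_comm, h1, mul_left_comm]

/-- The edge `L^0_g : t_{p_1} = … = t_{p_l} = 0`. -/
def zeroEdge (g : FreeMagma (ZMod T × Fin m)) : Submodule ℂ (Fin m → ℂ) where
  carrier := {t | ∀ x ∈ leaves g, t x.2 = 0}
  zero_mem' := by simp
  add_mem' := by
    intro a b ha hb x hx
    simp only [Pi.add_apply, ha x hx, hb x hx, add_zero]
  smul_mem' := by
    intro c t ht x hx
    simp only [Pi.smul_apply, smul_eq_mul, ht x hx, mul_zero]

/-- The edges with which one successively intersects to form the flag of `ḡ`: to join the islands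
of `x` and `y` into that of `[x, y]`, first form the island of `x`, then that of `y`. -/
def islands (ω : ℂ) : FreeMagma (ZMod T × Fin m) → List (Submodule ℂ (Fin m → ℂ))
  | .of _ => []
  | .mul x y => islands ω x ++ islands ω y ++ [islandEdge ω (.mul x y)]

/-- The flag `L^0 ⊃ L^1 ⊃ … ⊃ L^m` which is `ψ(ḡ v₀)` up to sign: the islands of `g` are joined,
and in the last step the resulting island is fixed to zero. -/
def commFlag (ω : ℂ) (g : FreeMagma (ZMod T × Fin m)) :
    Fin (m + 1) → Submodule ℂ (Fin m → ℂ) :=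
  fun i => ((islands ω g ++ [zeroEdge g]).take i).foldr (· ⊓ ·) ⊤

/-- The coefficient of `f̄_1 ∧ … ∧ f̄_m` in `f̄_{l_1} ∧ … ∧ f̄_{l_n}`: the sign of `l` if `l` is a
permutation of `1, …, m`, and `0` otherwise. -/
def wedgeSign (l : List (Fin m)) : ℂ :=
  ∑ s : Equiv.Perm (Fin m), if List.ofFn s = l then ((Equiv.Perm.sign s : ℤ) : ℂ) else 0

/-- The sign from joining the islands of `g` in the order of `islands`, by the rule
`⋯ ∧ ḡ₂ ∧ ḡ₁ ↦ ⋯ ∧ [g₁, g₂]‾`: starting from the wedge product of the leaves of `g = [x, y]` in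
reversed order, after `x` is formed it is moved past the leaves of `y`, and after `y` is formed the
two are interchanged. -/
def joinSign : FreeMagma (ZMod T × Fin m) → ℂ
  | .of _ => 1
  | .mul x y => joinSign x * joinSign y * (-1) ^ ((leaves y).length + 1)

/-- The sign in `ψ(ḡ v₀) = ± (L^0 ⊃ … ⊃ L^m)`; it is `0` unless `g` has weight `[1^m]`, that is,
unless each `1, …, m` labels exactly one leaf. -/
def flagSign (g : FreeMagma (ZMod T × Fin m)) : ℂ :=
  wedgeSign ((leaves g).reverse.map Prod.snd) * joinSign g

/-- The form `G₀(ḡ, ḡ')` on projected commutators of weight `[1^m]`: the geometric form of the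
arrangement of all diagonal hyperplanes `H_pq^k`, with weights `a`, on `ψ(ḡ v₀)` and `ψ(ḡ' v₀)`. -/
def geomZero [NeZero T] (ω : ℂ) (a : DiagIndex T m → ℂ) (g g' : FreeMagma (ZMod T × Fin m)) : ℂ :=
  flagSign g * flagSign g' * geomForm (diagHyp ω) a (commFlag ω g) (commFlag ω g')

end Diagonal

/-! ## Symmetrization and the cocycle -/

section Symmetrization

variable {R r : ℕ} (perm : Equiv.Perm (Fin R)) (ι : Fin r → Fin R)

/-- The orbit `i` of the index `[i, n] ∈ {1, …, m}`, `m = λ_1 + … + λ_r`, `1 ≤ n ≤ λ_i`, where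
`[i, n] = λ_1 + … + λ_{i-1} + n`. -/
def color (lam : Fin r → ℕ) (p : Fin (∑ i, lam i)) : Fin r := (finSigmaFinEquiv.symm p).1

/-- The weight `λ` of a commutator in the `F_a` (or `E_a`): `λ_i` counts the leaves in the `i`-th
orbit of the permutation. -/
def weight (u : FreeMagma (Fin R)) (i : Fin r) : ℕ :=
  open Classical in (leaves u).countP fun a => decide (perm.SameCycle (ι i) a)

/-- The order `∏ᵢ (T / T_i)^{λ_i} λ_i!` of the group `∏ᵢ (Σ_{λ_i} ⋉ (ℤ/(T/T_i))^{λ_i})`, where `T_i`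
is the length of the `i`-th cycle. -/
def groupOrder (T : ℕ) (lam : Fin r → ℕ) : ℕ :=
  ∏ i, (T / Function.minimalPeriod perm (ι i)) ^ lam i * (lam i).factorial

/-- Expansion of the homomorphism `σ^k F_{ι(i)} ↦ ∑_{l, n} f^{k + T_i l}_{[i,n]}` on a commutator
`u` in the `F_a`. On generators it is `F_a ↦ ∑ f^k_p` over all `(k, p)` with
`σ^k ι(color p) = a`; the image of `u` is the sum of the commutators in the set `expand u`. -/
def expand (T : ℕ) [NeZero T] (lam : Fin r → ℕ) :
    FreeMagma (Fin R) → Finset (FreeMagma (ZMod T × Fin (∑ i, lam i)))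
  | .of a => (univ.filter fun x : ZMod T × Fin (∑ i, lam i) =>
      (perm ^ x.1.val) (ι (color lam x.2)) = a).image .of
  | .mul u v => image₂ .mul (expand T lam u) (expand T lam v)

end Symmetrization

section Cocycle

variable {R r : ℕ} {𝔥 : Type*} [AddCommGroup 𝔥] [Module ℂ 𝔥] [FiniteDimensional ℂ 𝔥]
  {D : CartanData R 𝔥} (σ : D.DiagramAut) (ω : ℂ) (ι : Fin r → Fin R)

/-- The weight `a(H_pq^k) = (α_{ι(i)}, α_{σ^k ι(j)})` of a diagonal hyperplane, `i` and `j` being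
the orbits to which `p` and `q` belong. -/
def hypWeight (lam : Fin r → ℕ) (h : DiagIndex σ.order (∑ i, lam i)) : ℂ :=
  D.cartan (ι (color lam h.1.1.1)) ((σ.perm ^ h.2.val) (ι (color lam h.1.1.2)))

/-- The value `Ω(v̄_+, ū_-)` on the projected commutators `v̄_+ ∈ 𝔫_+^σ` in the `E_a` and
`ū_- ∈ 𝔫^σ` in the `F_a`: it is `|ΣZ_λ|⁻¹ G₀(φ(s(v̄_+)), s(ū_-))` if both have the same weight `λ`,
and `0` otherwise. Here `s(ū_-)` is the sum of the projected commutators `ḡ`, `g ∈ expand u`, of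
weight `[1^m]`, and likewise for `v`. -/
def omegaValue (v u : FreeMagma (Fin R)) : ℂ :=
  open Classical in
  let lam := weight σ.perm ι u
  if weight σ.perm ι v = lam then
    (groupOrder σ.perm ι σ.order lam : ℂ)⁻¹ *
      ∑ h ∈ expand σ.perm ι σ.order lam v, ∑ g ∈ expand σ.perm ι σ.order lam u,
        geomZero ω (hypWeight σ ι lam) (mirror h) g
  else 0

/-- `Ω` is the skew-symmetric bilinear form on `𝔤^σ` which pairs the components of equal weight of
`𝔫_+^σ` and `𝔫^σ` by `omegaValue` and vanishes on all other pairs of components. As `𝔤^σ` is spanned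
by `𝔥^σ` and the projected commutators in the `E_a` and in the `F_a`, these values determine `Ω`. -/
structure IsOmega (Ω : LinearMap.BilinForm ℂ σ.fixed) : Prop where
  skew : ∀ x y, Ω x y = - Ω y x
  cartan_zero : ∀ x y : σ.fixed, (∃ X : 𝔥, (x : D.LieAlg) = D.genH X) → Ω x y = 0
  minus_minus : ∀ x y : σ.fixed, (x : D.LieAlg) ∈ D.nMinus → (y : D.LieAlg) ∈ D.nMinus → Ω x y = 0
  plus_plus : ∀ x y : σ.fixed, (x : D.LieAlg) ∈ D.nPlus → (y : D.LieAlg) ∈ D.nPlus → Ω x y = 0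
  plus_minus : ∀ v u : FreeMagma (Fin R),
    Ω (σ.bar (commutator D.genE v)) (σ.bar (commutator D.genF u)) = omegaValue σ ω ι v u

end Cocycle

end Cyclo

end

/-! All prescribed values `omegaValue` are zero. Then the zero form has the required properties, and
it is the only such form because 𝔤^σ is spanned by 𝔥^σ and the projected commutators in the E_a and
in the F_a.

Exterior algebra. Take the vector space with basis the hyperplanes H_pq^k and the indices p, with
the diagonal form of weights a(H_pq^k) and 1. To a commutator attach ev(f_p^k) = e_p and ev([x,y]) =
c(x,y) ∧ ev(x) ∧ ev(y), where c(x,y) is the sum of the hyperplanes joining a leaf of x to a leaf of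
y. These are exactly the hyperplanes that the flag acquires when x and y are joined. The last step
of the flag acquires all remaining hyperplanes. Since ev(g) is killed by the sum of the earlier
ones, this step is the product with the sum A of all hyperplanes. By Cauchy-Binet, G₀(g, g') = (A ∧
ev g, A ∧ ev g') = (∑ a) (ev g, ev g') - (i_A ev g, i_A ev g'), with i_A the contraction
(`geomZero_eq_extForm`, `extForm_allVec_mul`).

Cobracket. Contracting ev(g) by a combination of hyperplanes gives half of a cobracket of g
(`ctr_ev`), so (ev [x,y], ev g) is found recursively from the cobracket of g (`extForm_ev_bracket`).
The invariant form obeys the same recursion: K([x,y], u) = (K ⊗ K)(x ⊗ y, δu)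
(`IsForm.form_lie_commF`). Hence summing (ev h, ev g) over the expansion of u gives K(v, ū)
(`sum_expand_extForm`), and the contracted term becomes half of the pairing of δv with δu under K(·,
bar ·) ⊗ K(·, bar ·) (`sum_expand_extForm_ctr`).

Casimir element. It remains to see that this pairing of cobrackets is 2 (∑ a) K(v, ū)
(`cobSum_cobSum`). As 𝔤̃^σ is finite-dimensional, the fixed parts of 𝔫_+ and 𝔫 have finite dual
families e_b, f_b for K. Inserting them turns the double cobracket into -∑_b K([V, f_b], [e_b,
U]_-), where V = v̄, U = ū and the subscript marks the part of negative height. Invariance reduces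
this to two Cartan contributions. The Cartan parts of the [e_b, U] give a sum over pairs of leaves
of ∑_k (α_i, σ^k α_j). The Cartan part of ∑ [e_b, f_b] gives a linear function of the weight, which
is found by taking a single generator, where the cobracket is zero. This is the analogue of 2(ρ,
α_i) = (α_i, α_i). Together they leave the sum over pairs of different indices, which is twice the
sum of the weights of all hyperplanes.

The existence of K, and the fact that σ maps 𝔥 to itself although only the images of the H_i are
prescribed, rest on the height grading and on Verma modules. -/

set_option linter.unusedSectionVars false

noncomputable section

namespace Cyclo

open Finset

/-! ### Verma modules and the presentation of 𝔤 -/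

section Verma

variable {R : ℕ} {𝔥 : Type*} [AddCommGroup 𝔥] [Module ℂ 𝔥] [FiniteDimensional ℂ 𝔥]

namespace CartanData

variable (D : CartanData R 𝔥)

attribute [local instance 100] LieRing.ofAssociativeRing LieAlgebra.ofAssociativeAlgebra

/-- The space with basis the words in `1, …, R`: the Verma module of `𝔤` as a vector space. -/
abbrev Words (R : ℕ) : Type := List (Fin R) →₀ ℂ

/-- The weight `Λ - ∑ α_i` of a word, evaluated at `X`. -/
def wordWeight (Λ : Module.Dual ℂ 𝔥) (w : List (Fin R)) : Module.Dual ℂ 𝔥 :=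
  Λ - (w.map D.root).sum

/-- `F_i` on the Verma module. -/
def vermaF (i : Fin R) : Module.End ℂ (Words R) := Finsupp.lmapDomain ℂ ℂ (List.cons i)

/-- `X ∈ 𝔥` on the Verma module of highest weight `Λ`. -/
def vermaH (Λ : Module.Dual ℂ 𝔥) (X : 𝔥) : Module.End ℂ (Words R) :=
  Finsupp.lsum ℂ fun w => D.wordWeight Λ w X • Finsupp.lsingle w

/-- `E_i` on a word of the Verma module of highest weight `Λ`. -/
def vermaEWord (Λ : Module.Dual ℂ 𝔥) (i : Fin R) : List (Fin R) → Words R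
  | [] => 0
  | j :: w => (if i = j then D.wordWeight Λ w (D.coroot i) • Finsupp.single w 1 else 0) +
      vermaF j (vermaEWord Λ i w)

/-- `E_i` on the Verma module of highest weight `Λ`. -/
def vermaE (Λ : Module.Dual ℂ 𝔥) (i : Fin R) : Module.End ℂ (Words R) :=
  Finsupp.lsum ℂ fun w => LinearMap.toSpanSingleton ℂ _ (D.vermaEWord Λ i w)

variable {D}

theorem end_lie_apply {M : Type*} [AddCommGroup M] [Module ℂ M] (f g : Module.End ℂ M) (x : M) :
    ⁅f, g⁆ x = f (g x) - g (f x) := rfl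

theorem vermaF_single (i : Fin R) (w : List (Fin R)) (c : ℂ) :
    vermaF i (Finsupp.single w c) = Finsupp.single (i :: w) c := by
  simp [vermaF, Finsupp.mapDomain_single]

theorem vermaH_single (Λ : Module.Dual ℂ 𝔥) (X : 𝔥) (w : List (Fin R)) (c : ℂ) :
    D.vermaH Λ X (Finsupp.single w c) = D.wordWeight Λ w X • Finsupp.single w c := by
  simp [vermaH]

theorem vermaE_single (Λ : Module.Dual ℂ 𝔥) (i : Fin R) (w : List (Fin R)) (c : ℂ) :
    D.vermaE Λ i (Finsupp.single w c) = c • D.vermaEWord Λ i w := by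
  simp [vermaE]

theorem wordWeight_cons (Λ : Module.Dual ℂ 𝔥) (j : Fin R) (w : List (Fin R)) :
    D.wordWeight Λ (j :: w) = D.wordWeight Λ w - D.root j := by
  simp [wordWeight]; abel

/-- The recursion that defines `vermaEWord` on `j :: w` is this commutation relation applied to `w`.
-/
theorem verma_EF (Λ : Module.Dual ℂ 𝔥) (i j : Fin R) :
    ⁅D.vermaE Λ i, vermaF j⁆ = if i = j then D.vermaH Λ (D.coroot i) else 0 := by
  refine Finsupp.lhom_ext fun w c => ?_
  rw [end_lie_apply]
  simp only [vermaF_single, vermaE_single, vermaEWord,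
    map_smul, smul_add, add_sub_cancel_right]
  split_ifs with h
  · subst h; simp [vermaH_single]; rw [mul_comm]
  · simp

theorem verma_HF (Λ : Module.Dual ℂ 𝔥) (X : 𝔥) (i : Fin R) :
    ⁅D.vermaH Λ X, vermaF i⁆ = -(D.root i X • vermaF i) := by
  refine Finsupp.lhom_ext fun w c => ?_
  rw [end_lie_apply]
  simp only [vermaF_single, vermaH_single, map_smul,
    wordWeight_cons, ← sub_smul, LinearMap.neg_apply, LinearMap.smul_apply, ← neg_smul]
  rw [LinearMap.sub_apply, sub_sub_cancel_left]

theorem verma_HH (Λ : Module.Dual ℂ 𝔥) (X Y : 𝔥) :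
    ⁅D.vermaH Λ X, D.vermaH Λ Y⁆ = 0 := by
  refine Finsupp.lhom_ext fun w c => ?_
  rw [end_lie_apply]
  simp only [vermaH_single, map_smul]
  rw [smul_comm, sub_self]; rfl

/-- Induction on the word: E_i raises the weight of a word by α_i, and passing a letter j shifts
both weights by the same root α_j. -/
theorem verma_HE (Λ : Module.Dual ℂ 𝔥) (X : 𝔥) (i : Fin R) :
    ⁅D.vermaH Λ X, D.vermaE Λ i⁆ = D.root i X • D.vermaE Λ i := by
  suffices h : ∀ w, D.vermaH Λ X (D.vermaEWord Λ i w) - D.wordWeight Λ w X • D.vermaEWord Λ i w =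
      D.root i X • D.vermaEWord Λ i w by
    refine Finsupp.lhom_ext fun w c => ?_
    rw [end_lie_apply]
    simp only [vermaH_single, vermaE_single, map_smul,
      LinearMap.smul_apply]
    rw [smul_comm, ← smul_sub, h, smul_comm]
  intro w
  induction w with
  | nil => simp [vermaEWord]
  | cons j w ih =>
    have hF : ∀ m, D.vermaH Λ X (vermaF j m) = vermaF j (D.vermaH Λ X m) -
        D.root j X • vermaF j m := by
      intro m
      have := LinearMap.congr_fun (verma_HF (D := D) Λ X j) m
      rw [end_lie_apply] at this
      simp only [LinearMap.neg_apply,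
        LinearMap.smul_apply, sub_eq_iff_eq_add] at this
      rw [this]; abel
    have ih' := sub_eq_iff_eq_add.1 ih
    simp only [vermaEWord, map_add, hF, ih', wordWeight_cons, map_smul, LinearMap.sub_apply,
      smul_add, sub_smul]
    split_ifs with h
    · subst h
      simp only [map_smul, vermaH_single, smul_comm (D.wordWeight Λ w X)]
      abel
    · simp only [map_zero, smul_zero]; abel

theorem vermaH_add (Λ : Module.Dual ℂ 𝔥) (X Y : 𝔥) :
    D.vermaH Λ (X + Y) = D.vermaH Λ X + D.vermaH Λ Y := by
  refine Finsupp.lhom_ext fun w c => ?_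
  simp [vermaH_single, add_mul]

theorem vermaH_smul (Λ : Module.Dual ℂ 𝔥) (c : ℂ) (X : 𝔥) :
    D.vermaH Λ (c • X) = c • D.vermaH Λ X := by
  refine Finsupp.lhom_ext fun w c => ?_
  simp only [vermaH_single, map_smul, LinearMap.smul_apply, smul_eq_mul, mul_smul]

/-- Elements of a Lie algebra that satisfy the relations of `𝔤`. -/
structure ChevalleyRel (D : CartanData R 𝔥) (L : Type*) [LieRing L] [LieAlgebra ℂ L] where
  E : Fin R → L
  F : Fin R → L
  H : 𝔥 →ₗ[ℂ] L
  EF : ∀ i j, ⁅E i, F j⁆ = if i = j then H (D.coroot i) else 0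
  HE : ∀ X i, ⁅H X, E i⁆ = D.root i X • E i
  HF : ∀ X i, ⁅H X, F i⁆ = -(D.root i X • F i)
  HH : ∀ X Y, ⁅H X, H Y⁆ = 0

/-- A Lie algebra with the generators and relations of `𝔤`. -/
structure Chevalley (D : CartanData R 𝔥) (L : Type*) [LieRing L] [LieAlgebra ℂ L] extends
    D.ChevalleyRel L where
  generate : ∀ S : LieSubalgebra ℂ L, (∀ i, E i ∈ S) → (∀ i, F i ∈ S) → (∀ X, H X ∈ S) → S = ⊤

/-- The relations with the roles of the `E_i` and the `F_i` interchanged. -/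
def ChevalleyRel.swap {L : Type*} [LieRing L] [LieAlgebra ℂ L] (C : D.ChevalleyRel L) :
    D.ChevalleyRel L where
  E := C.F
  F := C.E
  -- With the Cartan part negated, [F_i, E_i] = -H_i and the weight α_i of F_i under -X have the
  -- form of the original relations.
  H := -C.H
  EF i j := by
    rw [← lie_skew, C.EF]
    split_ifs with h h' h'
    · subst h; rfl
    · exact absurd h.symm h'
    · exact absurd h'.symm h
    · simp
  HE X i := by simp [C.HF]
  HF X i := by simp [C.HE]
  HH X Y := by simp [C.HH]

/-- The generators with the roles of the `E_i` and the `F_i` interchanged. -/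
def Chevalley.swap {L : Type*} [LieRing L] [LieAlgebra ℂ L] (C : D.Chevalley L) :
    D.Chevalley L where
  toChevalleyRel := C.toChevalleyRel.swap
  generate S hE hF hH := C.generate S hF hE fun X => by
    have h := hH X
    change -C.H X ∈ S at h
    exact neg_mem_iff.1 h

variable (D)

/-- The operators on the Verma module of highest weight `Λ`. -/
def vermaRel (Λ : Module.Dual ℂ 𝔥) : D.ChevalleyRel (Module.End ℂ (Words R)) where
  E := D.vermaE Λ
  F := vermaF
  H := ⟨⟨D.vermaH Λ, vermaH_add Λ⟩, vermaH_smul Λ⟩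
  EF := verma_EF Λ
  HE := verma_HE Λ
  HF := verma_HF Λ
  HH := verma_HH Λ

theorem mk_rel {x} (h : D.Rel x) : (LieSubmodule.Quotient.mk x : D.LieAlg) = 0 :=
  LieSubmodule.Quotient.mk_eq_zero'.2 (LieSubmodule.subset_lieSpan h)

/-- `𝔥 → 𝔤`. -/
def genHLin : 𝔥 →ₗ[ℂ] D.LieAlg where
  toFun := D.genH
  map_add' X Y := by
    have h := D.mk_rel (.H_add X Y)
    exact sub_eq_zero.1 h
  map_smul' c X := by
    have h := D.mk_rel (.H_smul c X)
    exact sub_eq_zero.1 h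

variable {D} in
/-- The images of the generators. -/
def ChevalleyRel.gen {M : Type*} [LieRing M] [LieAlgebra ℂ M] (C : D.ChevalleyRel M) : Gen R 𝔥 → M
  | .E i => C.E i
  | .F i => C.F i
  | .H X => C.H X

variable {D} in
theorem ChevalleyRel.lift_rel {M : Type*} [LieRing M] [LieAlgebra ℂ M] (C : D.ChevalleyRel M) {x}
    (hx : D.Rel x) : FreeLieAlgebra.lift ℂ C.gen x = 0 := by
  cases hx with
  | EF_same i =>
    simp only [map_sub, LieHom.map_lie, FreeLieAlgebra.lift_of_apply, free, gen, C.EF]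
    simp
  | EF_ne i j h =>
    simp only [LieHom.map_lie, FreeLieAlgebra.lift_of_apply, free, gen, C.EF, if_neg h]
  | HE X i =>
    simp only [map_sub, map_smul, LieHom.map_lie, FreeLieAlgebra.lift_of_apply, free,
      gen, C.HE, sub_self]
  | HF X i =>
    simp only [map_add, map_smul, LieHom.map_lie, FreeLieAlgebra.lift_of_apply, free,
      gen, C.HF, neg_add_cancel]
  | HH X Y =>
    simp only [LieHom.map_lie, FreeLieAlgebra.lift_of_apply, free, gen, C.HH]
  | H_add X Y =>
    simp only [map_sub, map_add, FreeLieAlgebra.lift_of_apply, free, gen, sub_self]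
  | H_smul c X =>
    simp only [map_sub, map_smul, FreeLieAlgebra.lift_of_apply, free, gen, sub_self]

variable {D} in
/-- The homomorphism from `𝔤` that belongs to elements with the relations of `𝔤`. -/
def ChevalleyRel.hom {M : Type*} [LieRing M] [LieAlgebra ℂ M] (C : D.ChevalleyRel M) :
    D.LieAlg →ₗ⁅ℂ⁆ M :=
  { D.relIdeal.toSubmodule.liftQ
      (FreeLieAlgebra.lift ℂ C.gen : FreeLieAlgebra ℂ (Gen R 𝔥) →ₗ[ℂ] _) (by
      have h : D.relIdeal ≤ (FreeLieAlgebra.lift ℂ C.gen).ker :=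
        LieSubmodule.lieSpan_le.2 fun x hx => LieHom.mem_ker.2 (C.lift_rel hx)
      exact fun x hx => LieHom.mem_ker.1 (h hx)) with
    map_lie' := by
      intro x y
      induction x using Submodule.Quotient.induction_on
      induction y using Submodule.Quotient.induction_on
      exact LieHom.map_lie (FreeLieAlgebra.lift ℂ C.gen) _ _ }

variable {D} in
theorem ChevalleyRel.hom_gen {M : Type*} [LieRing M] [LieAlgebra ℂ M] (C : D.ChevalleyRel M)
    (x : Gen R 𝔥) : C.hom (D.gen x) = C.gen x :=
  FreeLieAlgebra.lift_of_apply _ _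

/-- The generators lift to a homomorphism from the free Lie algebra to S whose composite with the
inclusion is the quotient map, so every class lies in S. -/
theorem generate_gen (S : LieSubalgebra ℂ D.LieAlg) (hS : ∀ x, D.gen x ∈ S) : S = ⊤ := by
  let φ : FreeLieAlgebra ℂ (Gen R 𝔥) →ₗ⁅ℂ⁆ S := FreeLieAlgebra.lift ℂ fun x => ⟨D.gen x, hS x⟩
  let π : FreeLieAlgebra ℂ (Gen R 𝔥) →ₗ⁅ℂ⁆ D.LieAlg :=
    { D.relIdeal.toSubmodule.mkQ with map_lie' := fun {_ _} => rfl }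
  have h : S.incl.comp φ = π := FreeLieAlgebra.hom_ext fun x => by
    simp only [LieHom.comp_apply, φ, FreeLieAlgebra.lift_of_apply]; rfl
  rw [eq_top_iff]
  intro x _
  induction x using Submodule.Quotient.induction_on with | _ x => ?_
  have : (φ x : D.LieAlg) = Submodule.Quotient.mk x := LieHom.congr_fun h x
  rw [← this]
  exact (φ x).2

/-- The generators of `𝔤` itself. -/
def chevalley : D.Chevalley D.LieAlg where
  E := D.genE
  F := D.genF
  H := D.genHLin
  EF i j := by
    split_ifs with h
    · subst h; exact sub_eq_zero.1 (D.mk_rel (.EF_same i))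
    · exact D.mk_rel (.EF_ne i j h)
  HE X i := sub_eq_zero.1 (D.mk_rel (.HE X i))
  HF X i := eq_neg_of_add_eq_zero_left (D.mk_rel (.HF X i))
  HH X Y := D.mk_rel (.HH X Y)
  generate S hE hF hH := D.generate_gen S fun x => by cases x; exacts [hE _, hF _, hH _]

variable {D} in
/-- The given Lie algebra acts on the Verma modules. -/
def Chevalley.HasVerma {L : Type*} [LieRing L] [LieAlgebra ℂ L] (C : D.Chevalley L) : Prop :=
  ∀ Λ, ∃ ρ : L →ₗ⁅ℂ⁆ Module.End ℂ (Words R), (∀ i, ρ (C.E i) = D.vermaE Λ i) ∧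
    (∀ i, ρ (C.F i) = vermaF i) ∧ ∀ X, ρ (C.H X) = D.vermaH Λ X

theorem chevalley_hasVerma : D.chevalley.HasVerma := fun Λ =>
  ⟨(D.vermaRel Λ).hom, fun i => (D.vermaRel Λ).hom_gen (.E i),
    fun i => (D.vermaRel Λ).hom_gen (.F i), fun X => (D.vermaRel Λ).hom_gen (.H X)⟩

/-- The Verma action composed with the interchange of the E_i and F_i; the two signs on 𝔥 cancel. It
makes every statement about 𝔫 available for 𝔫_+. -/
theorem chevalley_swap_hasVerma : D.chevalley.swap.HasVerma := fun Λ =>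
  ⟨(D.vermaRel Λ).swap.hom, fun i => (D.vermaRel Λ).swap.hom_gen (.F i),
    fun i => (D.vermaRel Λ).swap.hom_gen (.E i), fun X => by
      refine (map_neg (D.vermaRel Λ).swap.hom (D.genHLin X)).trans ?_
      refine (congrArg _ ((D.vermaRel Λ).swap.hom_gen (.H X))).trans ?_
      exact neg_neg (D.vermaH Λ X)⟩

end CartanData
end Verma

theorem leaves_length_pos {α : Type*} (u : FreeMagma α) : 0 < (leaves u).length := by
  induction u with
  | ih1 a => simp [leaves]
  | ih2 x y hx hy => change 0 < (leaves x ++ leaves y).length; simp; omega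

theorem leaves_mul {α : Type*} (x y : FreeMagma α) : leaves (x * y) = leaves x ++ leaves y := rfl

theorem leaves_of {α : Type*} (a : α) : leaves (FreeMagma.of a) = [a] := rfl

theorem commutator_mul {α M : Type*} [LieRing M] (f : α → M) (x y : FreeMagma α) :
    commutator f (x * y) = ⁅commutator f x, commutator f y⁆ := rfl

theorem commutator_of {α M : Type*} [LieRing M] (f : α → M) (a : α) :
    commutator f (FreeMagma.of a) = f a := rfl

/-! ### Triangular decomposition and the grading by height -/

section Triangular

variable {R : ℕ} {𝔥 : Type*} [AddCommGroup 𝔥] [Module ℂ 𝔥] [FiniteDimensional ℂ 𝔥]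
  {D : CartanData R 𝔥} {L : Type*} [LieRing L] [LieAlgebra ℂ L]

namespace CartanData

/-- A functional on the span of the linearly independent roots takes any prescribed values on them;
extended to 𝔥*, it is evaluation at a point of the finite-dimensional space 𝔥. -/
theorem exists_root_eq (D : CartanData R 𝔥) (c : Fin R → ℂ) : ∃ X, ∀ i, D.root i X = c i := by
  obtain ⟨f, hf⟩ : ∃ f : Module.Dual ℂ (Module.Dual ℂ 𝔥), ∀ i, f (D.root i) = c i := by
    let b := Module.Basis.span D.root_linearIndependent
    obtain ⟨f, hf⟩ := LinearMap.exists_extend (b.constr ℂ c)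
    refine ⟨f, fun i => ?_⟩
    have h := LinearMap.congr_fun hf (b i)
    rw [Module.Basis.constr_basis] at h
    rw [← h, LinearMap.comp_apply, Submodule.subtype_apply, Module.Basis.span_apply]
  refine ⟨(Module.evalEquiv ℂ 𝔥).symm f, fun i => ?_⟩
  rw [Module.apply_evalEquiv_symm_apply, hf]

/-- An element `ρ` of `𝔥` on which all simple roots are `1`. -/
def rho (D : CartanData R 𝔥) : 𝔥 := (D.exists_root_eq fun _ => 1).choose

theorem root_rho (D : CartanData R 𝔥) (i : Fin R) : D.root i D.rho = 1 :=
  (D.exists_root_eq fun _ => 1).choose_spec i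

/-- The sum of the simple roots at the leaves of a bracketing. -/
def treeRoot (D : CartanData R 𝔥) (u : FreeMagma (Fin R)) : Module.Dual ℂ 𝔥 :=
  ((leaves u).map D.root).sum

theorem treeRoot_mul (D : CartanData R 𝔥) (u v : FreeMagma (Fin R)) :
    D.treeRoot (u * v) = D.treeRoot u + D.treeRoot v := by
  simp [treeRoot, leaves_mul]

theorem treeRoot_rho (D : CartanData R 𝔥) (u : FreeMagma (Fin R)) :
    D.treeRoot u D.rho = (leaves u).length := by
  induction u with
  | ih1 a => simp [treeRoot, leaves_of, root_rho]
  | ih2 x y hx hy =>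
    rw [treeRoot_mul, leaves_mul, LinearMap.add_apply, hx, hy]; simp

namespace Chevalley

variable (C : D.Chevalley L)

/-- The span of the commutators in the `F_i`. -/
def neg : Submodule ℂ L := Submodule.span ℂ (Set.range (commutator C.F))

/-- The span of the commutators in the `E_i`. -/
def pos : Submodule ℂ L := Submodule.span ℂ (Set.range (commutator C.E))

theorem lie_neg_mem {x y : L} (hx : x ∈ C.neg) (hy : y ∈ C.neg) : ⁅x, y⁆ ∈ C.neg := by
  induction hx, hy using Submodule.span_induction₂ with
  | mem_mem x y hx hy =>
    obtain ⟨u, rfl⟩ := hx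
    obtain ⟨v, rfl⟩ := hy
    exact Submodule.subset_span ⟨u * v, rfl⟩
  | zero_left => simp
  | zero_right => simp
  | add_left _ _ _ _ _ _ h h' => rw [add_lie]; exact add_mem h h'
  | add_right _ _ _ _ _ _ h h' => rw [lie_add]; exact add_mem h h'
  | smul_left r _ _ _ _ h => rw [smul_lie]; exact C.neg.smul_mem r h
  | smul_right r _ _ _ _ h => rw [lie_smul]; exact C.neg.smul_mem r h

theorem H_lie_commF (X : 𝔥) (u : FreeMagma (Fin R)) :
    ⁅C.H X, commutator C.F u⁆ = -(D.treeRoot u X • commutator C.F u) := by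
  induction u with
  | ih1 a => simp [commutator, C.HF, treeRoot, leaves_of]
  | ih2 x y hx hy =>
    rw [commutator_mul, leibniz_lie, hx, hy, treeRoot_mul, LinearMap.add_apply, add_smul, neg_lie,
      smul_lie, lie_neg, lie_smul, neg_add]

theorem H_lie_commE (X : 𝔥) (u : FreeMagma (Fin R)) :
    ⁅C.H X, commutator C.E u⁆ = D.treeRoot u X • commutator C.E u := by
  have h := C.swap.H_lie_commF X u
  change ⁅-C.H X, commutator C.E u⁆ = -(D.treeRoot u X • commutator C.E u) at h
  rwa [neg_lie, neg_inj] at h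

theorem H_lie_neg_mem (X : 𝔥) {y : L} (hy : y ∈ C.neg) : ⁅C.H X, y⁆ ∈ C.neg := by
  induction hy using Submodule.span_induction with
  | mem x hx =>
    obtain ⟨u, rfl⟩ := hx
    rw [H_lie_commF]
    exact neg_mem (C.neg.smul_mem _ (Submodule.subset_span ⟨u, rfl⟩))
  | zero => simp
  | add _ _ _ _ h h' => rw [lie_add]; exact add_mem h h'
  | smul r _ _ h => rw [lie_smul]; exact C.neg.smul_mem r h

/-- By the Leibniz rule E_i meets one subcommutator at a time. What it makes of it lies in 𝔥 + 𝔫 by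
induction, and 𝔥 + 𝔫 maps 𝔫 to itself. -/
theorem E_lie_neg_mem (i : Fin R) {y : L} (hy : y ∈ C.neg) :
    ⁅C.E i, y⁆ ∈ LinearMap.range C.H ⊔ C.neg := by
  have hb : ∀ z ∈ LinearMap.range C.H ⊔ C.neg, ∀ y ∈ C.neg, ⁅z, y⁆ ∈ C.neg := by
    intro z hz y hy
    obtain ⟨_, ⟨X, rfl⟩, n, hn, rfl⟩ := Submodule.mem_sup.1 hz
    rw [add_lie]
    exact add_mem (C.H_lie_neg_mem X hy) (C.lie_neg_mem hn hy)
  induction hy using Submodule.span_induction with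
  | mem x hx =>
    obtain ⟨u, rfl⟩ := hx
    induction u with
    | ih1 a =>
      rw [commutator_of, C.EF]
      split_ifs
      · exact Submodule.mem_sup_left ⟨_, rfl⟩
      · exact zero_mem _
    | ih2 x y hx hy =>
      change ⁅C.E i, commutator C.F (x * y)⁆ ∈ _
      rw [commutator_mul, leibniz_lie]
      refine Submodule.mem_sup_right (add_mem (hb _ hx _ (Submodule.subset_span ⟨y, rfl⟩)) ?_)
      rw [← lie_skew]
      exact neg_mem (hb _ hy _ (Submodule.subset_span ⟨x, rfl⟩))
  | zero => simp
  | add _ _ _ _ h h' => rw [lie_add]; exact add_mem h h'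
  | smul r _ _ h => rw [lie_smul]; exact Submodule.smul_mem _ r h

theorem F_lie_pos_mem (i : Fin R) {y : L} (hy : y ∈ C.pos) :
    ⁅C.F i, y⁆ ∈ LinearMap.range C.H ⊔ C.pos := by
  have h := C.swap.E_lie_neg_mem i hy
  have h' : LinearMap.range C.swap.H = LinearMap.range C.H := LinearMap.range_neg C.H
  rwa [h'] at h

theorem F_lie_neg_mem (i : Fin R) {y : L} (hy : y ∈ C.neg) : ⁅C.F i, y⁆ ∈ C.neg :=
  C.lie_neg_mem (Submodule.subset_span ⟨.of i, rfl⟩) hy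

/-- The sum S of the three parts is stable under the adjoint action of each generator. The elements
with this property form a subalgebra, hence it holds for all of L. So S is an ideal, in particular a
subalgebra, and it contains the generators. -/
theorem triangular : C.neg ⊔ LinearMap.range C.H ⊔ C.pos = ⊤ := by
  set S := C.neg ⊔ LinearMap.range C.H ⊔ C.pos with hS
  have hn : C.neg ≤ S := le_sup_left.trans le_sup_left
  have hh : LinearMap.range C.H ≤ S := le_sup_right.trans le_sup_left
  have hp : C.pos ≤ S := le_sup_right
  have hcases : ∀ (T : L →ₗ[ℂ] L), (∀ y ∈ C.neg, T y ∈ S) → (∀ X, T (C.H X) ∈ S) →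
      (∀ y ∈ C.pos, T y ∈ S) → ∀ s ∈ S, T s ∈ S := by
    intro T h1 h2 h3 s hs
    obtain ⟨a, ha, p, hp, rfl⟩ := Submodule.mem_sup.1 hs
    obtain ⟨n, hn, _, ⟨X, rfl⟩, rfl⟩ := Submodule.mem_sup.1 ha
    rw [map_add, map_add]
    exact add_mem (add_mem (h1 _ hn) (h2 X)) (h3 _ hp)
  let N : LieSubalgebra ℂ L :=
    { carrier := {x | ∀ s ∈ S, ⁅x, s⁆ ∈ S}
      zero_mem' := fun s _ => by simp
      add_mem' := fun ha hb s hs => by rw [add_lie]; exact add_mem (ha s hs) (hb s hs)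
      smul_mem' := fun c x hx s hs => by rw [smul_lie]; exact S.smul_mem c (hx s hs)
      lie_mem' := fun {x y} hx hy s hs => by
        rw [lie_lie]; exact sub_mem (hx _ (hy s hs)) (hy _ (hx s hs)) }
  have hN : N = ⊤ := by
    refine C.generate N (fun i => ?_) (fun i => ?_) (fun X => ?_)
    · refine hcases (LieAlgebra.ad ℂ L (C.E i)) (fun y hy => ?_) (fun X => ?_) (fun y hy => ?_)
      · exact sup_le hh hn (C.E_lie_neg_mem i hy)
      · rw [LieAlgebra.ad_apply, ← lie_skew, C.HE]
        exact neg_mem (S.smul_mem _ (hp (Submodule.subset_span ⟨.of i, rfl⟩)))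
      · exact hp (C.swap.F_lie_neg_mem i hy)
    · refine hcases (LieAlgebra.ad ℂ L (C.F i)) (fun y hy => ?_) (fun X => ?_) (fun y hy => ?_)
      · exact hn (C.F_lie_neg_mem i hy)
      · rw [LieAlgebra.ad_apply, ← lie_skew, C.HF, neg_neg]
        exact S.smul_mem _ (hn (Submodule.subset_span ⟨.of i, rfl⟩))
      · exact sup_le hh hp (C.F_lie_pos_mem i hy)
    · refine hcases (LieAlgebra.ad ℂ L (C.H X)) (fun y hy => ?_) (fun Y => ?_) (fun y hy => ?_)
      · exact hn (C.H_lie_neg_mem X hy)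
      · rw [LieAlgebra.ad_apply, C.HH]; exact zero_mem _
      · have h := C.swap.H_lie_neg_mem X hy
        change ⁅-C.H X, y⁆ ∈ C.pos at h
        rw [neg_lie] at h
        exact hp (neg_mem_iff.1 h)
  have hideal : ∀ x, ∀ s ∈ S, ⁅x, s⁆ ∈ S := fun x => by
    have : x ∈ N := hN ▸ LieSubalgebra.mem_top x
    exact this
  let S' : LieSubalgebra ℂ L := { S with lie_mem' := fun {x y} _ hy => hideal x y hy }
  have hS' : S' = ⊤ := C.generate S' (fun i => hp (Submodule.subset_span ⟨.of i, rfl⟩))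
    (fun i => hn (Submodule.subset_span ⟨.of i, rfl⟩)) (fun X => hh ⟨X, rfl⟩)
  rw [eq_top_iff]
  intro x _
  have : x ∈ S' := hS' ▸ LieSubalgebra.mem_top x
  exact this

/-! ### The grading by height -/

/-- The component of height `n`: an eigenspace of `ad ρ`. -/
def grade (n : ℤ) : Submodule ℂ L :=
  Module.End.eigenspace (LieAlgebra.ad ℂ L (C.H D.rho)) (n : ℂ)

theorem mem_grade {n : ℤ} {x : L} : x ∈ C.grade n ↔ ⁅C.H D.rho, x⁆ = (n : ℂ) • x :=
  Module.End.mem_eigenspace_iff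

theorem swap_grade (n : ℤ) : C.swap.grade n = C.grade (-n) := by
  ext x
  rw [mem_grade, mem_grade]
  change ⁅-C.H D.rho, x⁆ = _ ↔ _
  rw [neg_lie, neg_eq_iff_eq_neg, ← neg_smul]
  push_cast; rfl

theorem lie_mem_grade {m n : ℤ} {x y : L} (hx : x ∈ C.grade m) (hy : y ∈ C.grade n) :
    ⁅x, y⁆ ∈ C.grade (m + n) := by
  rw [mem_grade] at *
  rw [leibniz_lie, hx, hy, smul_lie, lie_smul, ← add_smul]; push_cast; rfl

theorem grade_independent : iSupIndep C.grade :=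
  (Module.End.eigenspaces_iSupIndep _).comp Int.cast_injective

theorem commF_mem_grade (u : FreeMagma (Fin R)) :
    commutator C.F u ∈ C.grade (-(leaves u).length) := by
  rw [mem_grade, H_lie_commF, treeRoot_rho, ← neg_smul]; push_cast; rfl

theorem commE_mem_grade (u : FreeMagma (Fin R)) :
    commutator C.E u ∈ C.grade (leaves u).length := by
  rw [mem_grade, H_lie_commE, treeRoot_rho]; push_cast; rfl

theorem H_mem_grade (X : 𝔥) : C.H X ∈ C.grade 0 := by
  rw [mem_grade, C.HH]; simp

/-- The elements of height `n` among the commutators and the elements of `𝔥`. -/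
def homogeneous (n : ℤ) : Set L :=
  {x | (∃ u, -((leaves u).length : ℤ) = n ∧ commutator C.F u = x) ∨
    (∃ u, ((leaves u).length : ℤ) = n ∧ commutator C.E u = x) ∨ (n = 0 ∧ ∃ X, C.H X = x)}

theorem span_homogeneous_le (n : ℤ) : Submodule.span ℂ (C.homogeneous n) ≤ C.grade n := by
  rw [Submodule.span_le]
  rintro x (⟨u, rfl, rfl⟩ | ⟨u, rfl, rfl⟩ | ⟨rfl, X, rfl⟩)
  exacts [C.commF_mem_grade u, C.commE_mem_grade u, C.H_mem_grade X]

theorem iSup_span_homogeneous : ⨆ n, Submodule.span ℂ (C.homogeneous n) = ⊤ := by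
  rw [eq_top_iff, ← C.triangular]
  refine sup_le (sup_le ?_ ?_) ?_
  · refine Submodule.span_le.2 ?_
    rintro _ ⟨u, rfl⟩
    exact Submodule.mem_iSup_of_mem _ (Submodule.subset_span (Or.inl ⟨u, rfl, rfl⟩))
  · rintro _ ⟨X, rfl⟩
    exact Submodule.mem_iSup_of_mem 0 (Submodule.subset_span (Or.inr (Or.inr ⟨rfl, X, rfl⟩)))
  · refine Submodule.span_le.2 ?_
    rintro _ ⟨u, rfl⟩
    exact Submodule.mem_iSup_of_mem _ (Submodule.subset_span (Or.inr (Or.inl ⟨u, rfl, rfl⟩)))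

theorem iSup_grade : ⨆ n, C.grade n = ⊤ :=
  top_le_iff.1 (C.iSup_span_homogeneous ▸ iSup_mono C.span_homogeneous_le)

end Chevalley
end CartanData

/-- Decompose an element of G i along the P j. The part outside P i lies in G i and in the span of
the other G j, so independence kills it. This identifies the eigenspaces of ad ρ with the spans of
commutators of the given height. -/
theorem _root_.iSupIndep.eq_of_le {ι M : Type*} [AddCommGroup M] [Module ℂ M]
    {P G : ι → Submodule ℂ M} (hG : iSupIndep G) (hle : ∀ i, P i ≤ G i) (hP : ⨆ i, P i = ⊤) :
    ∀ i, P i = G i := by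
  intro i
  refine le_antisymm (hle i) fun x hx => ?_
  have hx' : x ∈ P i ⊔ ⨆ j, ⨆ _ : j ≠ i, P j := by
    have h : ⨆ j, P j ≤ P i ⊔ ⨆ j, ⨆ _ : j ≠ i, P j := iSup_le fun j => ?_
    · exact h (hP ▸ Submodule.mem_top)
    by_cases hj : j = i
    · subst hj; exact le_sup_left
    · exact le_sup_of_le_right (le_iSup₂_of_le j hj le_rfl)
  obtain ⟨p, hp, q, hq, rfl⟩ := Submodule.mem_sup.1 hx'
  have hq' : q ∈ G i := (Submodule.add_mem_iff_right _ (hle i hp)).1 hx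
  have hq'' : q ∈ ⨆ j, ⨆ _ : j ≠ i, G j := iSup₂_mono (fun j _ => hle j) hq
  rw [Submodule.disjoint_def.1 (hG i) q hq' hq'', add_zero]
  exact hp

/-- Linear maps on the summands of a direct sum decomposition can be glued. -/
theorem exists_glue {ι M N : Type*} [AddCommGroup M] [Module ℂ M] [AddCommGroup N] [Module ℂ N]
    {G : ι → Submodule ℂ M} (hG : iSupIndep G) (htop : ⨆ i, G i = ⊤) (f : ∀ i, G i →ₗ[ℂ] N) :
    ∃ F : M →ₗ[ℂ] N, ∀ i (x : G i), F x = f i x := by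
  classical
  have hint : DirectSum.IsInternal G :=
    DirectSum.isInternal_submodule_of_iSupIndep_of_iSup_eq_top hG htop
  let e := LinearEquiv.ofBijective (DirectSum.coeLinearMap G) hint
  refine ⟨(DirectSum.toModule ℂ ι N f) ∘ₗ e.symm.toLinearMap, fun i x => ?_⟩
  have : e.symm x = DirectSum.lof ℂ ι (fun i => G i) i x := by
    rw [LinearEquiv.symm_apply_eq]
    exact (DirectSum.coeLinearMap_lof G i x).symm
  rw [LinearMap.comp_apply, LinearEquiv.coe_coe, this, DirectSum.toModule_lof]

end Triangular

/-! ### Construction of the invariant form -/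

section Invariant

variable {R : ℕ} {𝔥 : Type*} [AddCommGroup 𝔥] [Module ℂ 𝔥] [FiniteDimensional ℂ 𝔥]
  {D : CartanData R 𝔥} {L : Type*} [LieRing L] [LieAlgebra ℂ L]

namespace CartanData.Chevalley

variable (C : D.Chevalley L)

theorem grade_eq (n : ℤ) : C.grade n = Submodule.span ℂ (C.homogeneous n) :=
  (C.grade_independent.eq_of_le C.span_homogeneous_le C.iSup_span_homogeneous n).symm

theorem grade_zero : C.grade 0 = LinearMap.range C.H := by
  refine le_antisymm ?_ ?_
  · rw [grade_eq, Submodule.span_le]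
    rintro x (⟨u, hu, rfl⟩ | ⟨u, hu, rfl⟩ | ⟨-, X, rfl⟩)
    · have := leaves_length_pos u; omega
    · have := leaves_length_pos u; omega
    · exact ⟨X, rfl⟩
  · rintro _ ⟨X, rfl⟩
    exact C.H_mem_grade X

theorem grade_pos {n : ℤ} (hn : 0 < n) : C.grade n =
    Submodule.span ℂ {x | ∃ u, ((leaves u).length : ℤ) = n ∧ commutator C.E u = x} := by
  rw [grade_eq]
  congr 1
  ext x
  constructor
  · rintro (⟨u, hu, rfl⟩ | h | ⟨rfl, _⟩)
    · omega
    · exact h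
    · omega
  · exact fun h => Or.inr (Or.inl h)

theorem grade_pos_le {n : ℤ} (hn : 0 < n) : C.grade n ≤ C.pos := by
  rw [C.grade_pos hn, Submodule.span_le]
  rintro _ ⟨u, -, rfl⟩
  exact Submodule.subset_span ⟨u, rfl⟩

theorem grade_neg_le {n : ℤ} (hn : n < 0) : C.grade n ≤ C.neg := by
  have h := C.swap.grade_pos_le (n := -n) (by omega)
  rwa [swap_grade, neg_neg] at h

theorem grade_one : C.grade 1 = Submodule.span ℂ (Set.range C.E) := by
  refine le_antisymm ?_ ?_
  · rw [C.grade_pos one_pos, Submodule.span_le]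
    rintro x ⟨u, hu, rfl⟩
    induction u with
    | ih1 a => exact Submodule.subset_span ⟨a, rfl⟩
    | ih2 x y =>
      rw [leaves_mul, List.length_append] at hu
      have := leaves_length_pos x
      have := leaves_length_pos y
      omega
  · rw [Submodule.span_le]
    rintro _ ⟨i, rfl⟩
    exact C.commE_mem_grade (.of i)

theorem grade_neg_one : C.grade (-1) = Submodule.span ℂ (Set.range C.F) := by
  have h := C.swap.grade_one
  rwa [swap_grade] at h

/-- The brackets of two elements whose heights have the same sign and add up to `n`. -/
def brackets (n : ℤ) : Set L :=
  {z | ∃ p q x y, 0 < p * q ∧ p + q = n ∧ x ∈ C.grade p ∧ y ∈ C.grade q ∧ ⁅x, y⁆ = z}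

/-- A commutator with at least two leaves is a bracket of shorter ones of positive height. The
induction proving invariance runs on this. -/
theorem grade_le_span_brackets_of_pos {n : ℤ} (hn : 2 ≤ n) :
    C.grade n ≤ Submodule.span ℂ (C.brackets n) := by
  rw [C.grade_pos (by omega), Submodule.span_le]
  rintro x ⟨u, hu, rfl⟩
  refine Submodule.subset_span ?_
  induction u with
  | ih1 a => rw [leaves_of] at hu; simp at hu; omega
  | ih2 x y =>
    refine ⟨_, _, _, _, ?_, ?_, C.commE_mem_grade x, C.commE_mem_grade y, rfl⟩
    · have := leaves_length_pos x
      have := leaves_length_pos y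
      positivity
    · rw [← hu, leaves_mul, List.length_append]; push_cast; rfl

theorem grade_le_span_brackets {n : ℤ} (hn : 2 ≤ n.natAbs) :
    C.grade n ≤ Submodule.span ℂ (C.brackets n) := by
  rcases lt_or_ge n 0 with h | h
  · have h1 := C.swap.grade_le_span_brackets_of_pos (n := -n) (by omega)
    rw [swap_grade, neg_neg] at h1
    refine h1.trans (Submodule.span_mono ?_)
    rintro _ ⟨p, q, x, y, hpq, hn', hx, hy, rfl⟩
    rw [swap_grade] at hx hy
    exact ⟨-p, -q, x, y, by simpa using hpq, by omega, hx, hy, rfl⟩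
  · exact C.grade_le_span_brackets_of_pos (by omega)

variable {C}

theorem ext_grade {N : Type*} [AddCommGroup N] [Module ℂ N] {f g : L →ₗ[ℂ] N}
    (h : ∀ n, ∀ x ∈ C.grade n, f x = g x) : f = g := by
  have : ⨆ n, C.grade n ≤ LinearMap.eqLocus f g := iSup_le fun n x hx => h n x hx
  ext x
  exact this (C.iSup_grade ▸ Submodule.mem_top)

/-- The standard form on `𝔤`, with orthogonality stated for the grading by height. -/
structure IsForm (C : D.Chevalley L) (K : LinearMap.BilinForm ℂ L) : Prop where
  cartan : ∀ X Y, K (C.H X) (C.H Y) = D.form X Y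
  orth : ∀ {m n x y}, x ∈ C.grade m → y ∈ C.grade n → m + n ≠ 0 → K x y = 0
  EF : ∀ i j, K (C.E i) (C.F j) = if i = j then 1 else 0
  symm : ∀ x y, K x y = K y x
  inv : ∀ x y z, K ⁅x, y⁆ z = K x ⁅y, z⁆

/-- The properties of the standard form that hold by construction; `p` is the projection to `𝔥`. -/
structure PreForm (C : D.Chevalley L) (p : L →ₗ[ℂ] 𝔥) (K : LinearMap.BilinForm ℂ L) : Prop where
  proj_H : ∀ X, p (C.H X) = X
  orth : ∀ {m n x y}, x ∈ C.grade m → y ∈ C.grade n → m + n ≠ 0 → K x y = 0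
  cartan : ∀ X y, K (C.H X) y = D.form X (p y)
  symm : ∀ x y, K x y = K y x
  rho : ∀ {n x}, x ∈ C.grade n → ∀ y, n * K x y = D.form D.rho (p ⁅x, y⁆)

/-- Invariance forces n K(x, y) = K([ρ, x], y) = (ρ, p[x, y]) for x of height n. For n ≠ 0 this is
taken as the definition, and for n = 0 the given form on 𝔥. Symmetry holds because exchanging x and
y changes the sign of both n and [x, y]. -/
theorem exists_preForm (hH : Function.Injective C.H) : ∃ p K, PreForm C p K := by
  obtain ⟨p, hp⟩ : ∃ p : L →ₗ[ℂ] 𝔥, (∀ X, p (C.H X) = X) ∧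
      ∀ n x, x ∈ C.grade n → n ≠ 0 → p x = 0 := by
    let e : 𝔥 ≃ₗ[ℂ] C.grade 0 :=
      (LinearEquiv.ofInjective C.H hH).trans (LinearEquiv.ofEq _ _ C.grade_zero.symm)
    obtain ⟨p, hp⟩ := exists_glue C.grade_independent C.iSup_grade
      fun n => if h : n = 0 then h ▸ e.symm.toLinearMap else 0
    refine ⟨p, fun X => ?_, fun n x hx hn => ?_⟩
    · have := hp 0 (e X)
      rw [dif_pos rfl] at this
      have h2 : (e X : L) = C.H X := rfl
      rw [h2] at this
      rw [this]
      exact e.symm_apply_apply X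
    · have := hp n ⟨x, hx⟩
      rw [dif_neg hn] at this
      exact this
  obtain ⟨hpH, hp0⟩ := hp
  let B : LinearMap.BilinForm ℂ L := D.form.compl₁₂ p p
  let V : L →ₗ[ℂ] L →ₗ[ℂ] ℂ :=
    (LieAlgebra.ad ℂ L : L →ₗ[ℂ] Module.End ℂ L).compr₂ (D.form D.rho ∘ₗ p)
  obtain ⟨K, hK⟩ := exists_glue C.grade_independent C.iSup_grade
    fun n => (if n = 0 then B else (n : ℂ)⁻¹ • V) ∘ₗ (C.grade n).subtype
  have hK0 : ∀ x ∈ C.grade 0, ∀ y, K x y = D.form (p x) (p y) := fun x hx y => by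
    have := hK 0 ⟨x, hx⟩
    rw [if_pos rfl] at this
    exact LinearMap.congr_fun this y
  have hKn : ∀ n ≠ 0, ∀ x ∈ C.grade n, ∀ y, K x y = (n : ℂ)⁻¹ * D.form D.rho (p ⁅x, y⁆) :=
    fun n hn x hx y => by
      have := hK n ⟨x, hx⟩
      rw [if_neg hn] at this
      exact LinearMap.congr_fun this y
  have horth : ∀ {m n x y}, x ∈ C.grade m → y ∈ C.grade n → m + n ≠ 0 → K x y = 0 := by
    intro m n x y hx hy hmn
    by_cases hm : m = 0
    · subst hm
      rw [hK0 x hx, hp0 n y hy (by omega), map_zero]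
    · rw [hKn m hm x hx, hp0 _ _ (C.lie_mem_grade hx hy) hmn, map_zero, mul_zero]
  refine ⟨p, K, hpH, horth, fun X y => ?_, ?_, ?_⟩
  · rw [hK0 _ (C.H_mem_grade X), hpH]
  · suffices h : K = K.flip by
      intro x y; exact LinearMap.congr_fun₂ h x y
    refine ext_grade (C := C) fun m x hx => ext_grade (C := C) fun n y hy => ?_
    rw [LinearMap.flip_apply]
    by_cases hmn : m + n = 0
    · obtain rfl : n = -m := by omega
      by_cases hm : m = 0
      · subst hm
        rw [hK0 x hx, hK0 y (by simpa using hy)]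
        exact D.form_symm.eq _ _
      · have e : p ⁅y, x⁆ = -p ⁅x, y⁆ := by rw [← lie_skew, map_neg]
        rw [hKn m hm x hx, hKn (-m) (by omega) y hy, e, map_neg]
        push_cast
        rw [inv_neg, neg_mul_neg]
    · rw [horth hx hy hmn, horth hy hx (by omega)]
  · intro n x hx y
    by_cases hn : n = 0
    · subst hn
      rw [grade_zero] at hx
      obtain ⟨X, rfl⟩ := hx
      suffices h : D.form D.rho ∘ₗ p ∘ₗ (LieAlgebra.ad ℂ L (C.H X) : L →ₗ[ℂ] L) = 0 by
        have := LinearMap.congr_fun h y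
        simp only [LinearMap.comp_apply, LieAlgebra.ad_apply, LinearMap.zero_apply] at this
        rw [this]; simp
      refine ext_grade (C := C) fun m z hz => ?_
      simp only [LinearMap.comp_apply, LieAlgebra.ad_apply, LinearMap.zero_apply]
      by_cases hm : m = 0
      · subst hm
        rw [grade_zero] at hz
        obtain ⟨Y, rfl⟩ := hz
        rw [C.HH]; simp
      · rw [hp0 _ _ (C.lie_mem_grade (C.H_mem_grade X) hz) (by omega), map_zero]
    · rw [hKn n hn x hx, ← mul_assoc, mul_inv_cancel₀ (by exact_mod_cast hn), one_mul]

namespace PreForm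

variable {p : L →ₗ[ℂ] 𝔥} {K : LinearMap.BilinForm ℂ L} (h : PreForm C p K)
include h

/-- The form is invariant on homogeneous elements of height at most `N`. -/
def Cyclic (C : D.Chevalley L) (K : LinearMap.BilinForm ℂ L) (N : ℕ) : Prop :=
  ∀ p q r x y z, x ∈ C.grade p → y ∈ C.grade q → z ∈ C.grade r → p + q + r = 0 →
    p.natAbs ≤ N → q.natAbs ≤ N → r.natAbs ≤ N → K ⁅x, y⁆ z = K ⁅y, z⁆ x

/-- The Jacobi identity for x, y, z, projected to 𝔥 and paired with ρ; each term is rewritten by the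
defining property of the form. -/
theorem rho_jacobi {p q r : ℤ} {x y z : L} (hx : x ∈ C.grade p) (hy : y ∈ C.grade q)
    (hz : z ∈ C.grade r) :
    (p + q) * K ⁅x, y⁆ z + (q + r) * K ⁅y, z⁆ x + (r + p) * K ⁅z, x⁆ y = 0 := by
  have h1 := h.rho (C.lie_mem_grade hx hy) z
  have h2 := h.rho (C.lie_mem_grade hy hz) x
  have h3 := h.rho (C.lie_mem_grade hz hx) y
  push_cast at h1 h2 h3
  rw [h1, h2, h3, ← map_add, ← map_add, ← map_add, ← map_add]
  have : ⁅⁅x, y⁆, z⁆ + ⁅⁅y, z⁆, x⁆ + ⁅⁅z, x⁆, y⁆ = 0 := by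
    rw [← lie_skew ⁅x, y⁆ z, ← lie_skew ⁅y, z⁆ x, ← lie_skew ⁅z, x⁆ y, ← neg_add, ← neg_add,
      neg_eq_zero]
    have := lie_jacobi x y z
    rw [← this]; abel
  rw [this]; simp

theorem swap_lie (x y z : L) : K ⁅x, y⁆ z = -K ⁅y, x⁆ z := by
  rw [← lie_skew, map_neg, LinearMap.neg_apply]

/-- Both sides expand by the Jacobi identity. As r₁ and r₂ have the same sign and p, q are small,
all intermediate elements have height at most N, so the cyclicity already known moves the terms into
each other. -/
theorem cyclic_bracket {N : ℕ} (ih : Cyclic C K N) {p q r₁ r₂ : ℤ} {x y z₁ z₂ : L}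
    (hx : x ∈ C.grade p) (hy : y ∈ C.grade q) (hz₁ : z₁ ∈ C.grade r₁) (hz₂ : z₂ ∈ C.grade r₂)
    (hr : 0 < r₁ * r₂) (h0 : p + q + (r₁ + r₂) = 0) (hp : p.natAbs ≤ N) (hq : q.natAbs ≤ N)
    (hN : (r₁ + r₂).natAbs = N + 1) :
    K ⁅y, ⁅z₁, z₂⁆⁆ x = K ⁅⁅z₁, z₂⁆, x⁆ y := by
  have hr' : (0 < r₁ ∧ 0 < r₂) ∨ (r₁ < 0 ∧ r₂ < 0) := by
    rcases pos_and_pos_or_neg_and_neg_of_mul_pos hr with h | h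
    exacts [Or.inl h, Or.inr h]
  have e1 := ih _ _ _ _ _ _ (C.lie_mem_grade hy hz₁) hz₂ hx (by omega) (by omega) (by omega)
    (by omega)
  have e2 := ih _ _ _ _ _ _ hz₁ (C.lie_mem_grade hy hz₂) hx (by omega) (by omega) (by omega)
    (by omega)
  have e3 := ih _ _ _ _ _ _ (C.lie_mem_grade hy hz₂) hx hz₁ (by omega) (by omega) (by omega)
    (by omega)
  have e4 := ih _ _ _ _ _ _ hz₁ (C.lie_mem_grade hz₂ hx) hy (by omega) (by omega) (by omega)
    (by omega)
  have e5 := ih _ _ _ _ _ _ (C.lie_mem_grade hz₂ hx) hy hz₁ (by omega) (by omega) (by omega)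
    (by omega)
  have e6 := ih _ _ _ _ _ _ hz₂ (C.lie_mem_grade hz₁ hx) hy (by omega) (by omega) (by omega)
    (by omega)
  have e7 := ih _ _ _ _ _ _ (C.lie_mem_grade hz₁ hx) hy hz₂ (by omega) (by omega) (by omega)
    (by omega)
  rw [leibniz_lie y, lie_lie z₁, map_add, LinearMap.add_apply, map_sub, LinearMap.sub_apply, e1, e2, e3,
    e4, e5, e6, e7, h.symm ⁅z₂, x⁆, h.symm ⁅y, z₂⁆, h.swap_lie z₁ x]
  abel

/-- One of the two equalities comes from splitting z into brackets, possible because its height is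
at least 2 in absolute value. With p + q = -r and r ≠ 0, `rho_jacobi` then yields the other. -/
theorem cyclic_max {N : ℕ} (ih : Cyclic C K N) {p q r : ℤ} {x y z : L}
    (hx : x ∈ C.grade p) (hy : y ∈ C.grade q) (hz : z ∈ C.grade r) (h0 : p + q + r = 0)
    (hp : p.natAbs ≤ N) (hq : q.natAbs ≤ N) (hN : r.natAbs = N + 1) (hN1 : N ≠ 0) :
    K ⁅x, y⁆ z = K ⁅y, z⁆ x ∧ K ⁅y, z⁆ x = K ⁅z, x⁆ y := by
  have key : K ⁅y, z⁆ x = K ⁅z, x⁆ y := by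
    have hz' := C.grade_le_span_brackets (by omega) hz
    clear hz
    induction hz' using Submodule.span_induction with
    | mem z hz' =>
      obtain ⟨r₁, r₂, z₁, z₂, hr, rfl, hz₁, hz₂, rfl⟩ := hz'
      exact h.cyclic_bracket ih hx hy hz₁ hz₂ hr h0 hp hq hN
    | zero => simp
    | add z z' _ _ h1 h2 => rw [lie_add, add_lie, map_add, map_add, LinearMap.add_apply, h1, h2]; rfl
    | smul c z _ h1 => rw [lie_smul, smul_lie, map_smul, map_smul, LinearMap.smul_apply, h1]; rfl
  refine ⟨?_, key⟩
  have := h.rho_jacobi hx hy hz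
  rw [← key] at this
  have hr : (r : ℂ) ≠ 0 := by
    have : r ≠ 0 := by omega
    exact_mod_cast this
  have h0' : (p : ℂ) + q = -r := by
    have : ((p + q + r : ℤ) : ℂ) = 0 := by rw [h0]; simp
    push_cast at this
    linear_combination this
  refine mul_left_cancel₀ hr ?_
  linear_combination -this + (K ⁅x, y⁆ z) * h0' + (K ⁅y, z⁆ x) * h0'

/-- If three non-zero heights add up to zero, at most one has the maximal absolute value N + 1;
cyclic rotation moves it to the last place. -/
theorem cyclic_of_ne_zero {N : ℕ} (ih : Cyclic C K N) {p q r : ℤ} {x y z : L}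
    (hx : x ∈ C.grade p) (hy : y ∈ C.grade q) (hz : z ∈ C.grade r) (h0 : p + q + r = 0)
    (hp : p.natAbs ≤ N + 1) (hq : q.natAbs ≤ N + 1) (hr : r.natAbs ≤ N + 1) (hp0 : p ≠ 0)
    (hq0 : q ≠ 0) (hr0 : r ≠ 0) : K ⁅x, y⁆ z = K ⁅y, z⁆ x := by
  by_cases hr1 : r.natAbs = N + 1
  · exact (h.cyclic_max ih hx hy hz h0 (by omega) (by omega) hr1 (by omega)).1
  by_cases hp1 : p.natAbs = N + 1
  · obtain ⟨e1, e2⟩ := h.cyclic_max ih hy hz hx (by omega) (by omega) (by omega) hp1 (by omega)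
    exact (e1.trans e2).symm
  by_cases hq1 : q.natAbs = N + 1
  · exact (h.cyclic_max ih hz hx hy (by omega) (by omega) (by omega) hq1 (by omega)).2
  exact ih p q r x y z hx hy hz h0 (by omega) (by omega) (by omega)

theorem K_EF (i j : Fin R) : K (C.E i) (C.F j) = if i = j then 1 else 0 := by
  have h1 := h.rho (C.commE_mem_grade (.of i)) (C.F j)
  rw [commutator_of, C.EF, leaves_of] at h1
  simp only [List.length_singleton, Nat.cast_one, Int.cast_one, one_mul] at h1
  rw [h1]
  split_ifs
  · rw [h.proj_H, ← D.form_symm.eq]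
    change D.form (D.coroot i) D.rho = 1
    rw [coroot, LinearMap.BilinForm.apply_toDual_symm_apply, root_rho]
  · simp

theorem cartan_lie_one (Y : 𝔥) {x z : L} (hz : z ∈ C.grade 1) (hx : x ∈ C.grade (-1)) :
    K ⁅z, x⁆ (C.H Y) = K ⁅C.H Y, z⁆ x := by
  rw [grade_one] at hz
  rw [grade_neg_one] at hx
  induction hz, hx using Submodule.span_induction₂ with
  | mem_mem x y hx hy =>
    obtain ⟨i, rfl⟩ := hx
    obtain ⟨j, rfl⟩ := hy
    rw [C.HE, map_smul, LinearMap.smul_apply, h.K_EF, C.EF]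
    split_ifs
    · rw [h.cartan, h.proj_H, coroot, LinearMap.BilinForm.apply_toDual_symm_apply]; simp
    · simp
  | zero_left => simp
  | zero_right => simp
  | add_left _ _ _ _ _ _ h1 h2 =>
    rw [add_lie, lie_add, map_add, map_add, LinearMap.add_apply, h1, h2]; rfl
  | add_right _ _ _ _ _ _ h1 h2 => rw [lie_add, map_add, map_add, LinearMap.add_apply, h1, h2]
  | smul_left r _ _ _ _ h1 =>
    rw [smul_lie, lie_smul, map_smul, map_smul, LinearMap.smul_apply, h1]; rfl
  | smul_right r _ _ _ _ h1 => rw [lie_smul, map_smul, map_smul, LinearMap.smul_apply, h1]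

theorem cartan_skew_one (Y : 𝔥) {x z : L} (hz : z ∈ C.grade 1) (hx : x ∈ C.grade (-1)) :
    K ⁅C.H Y, z⁆ x = -K ⁅C.H Y, x⁆ z := by
  rw [grade_one] at hz
  rw [grade_neg_one] at hx
  induction hz, hx using Submodule.span_induction₂ with
  | mem_mem x y hx hy =>
    obtain ⟨i, rfl⟩ := hx
    obtain ⟨j, rfl⟩ := hy
    rw [C.HE, C.HF, map_smul, map_neg, map_smul, LinearMap.neg_apply, LinearMap.smul_apply,
      LinearMap.smul_apply, h.symm (C.F j), h.K_EF, neg_neg]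
    split_ifs with hij
    · rw [hij]
    · simp
  | zero_left => simp
  | zero_right => simp
  | add_left _ _ _ _ _ _ h1 h2 =>
    rw [lie_add, map_add, map_add, LinearMap.add_apply, h1, h2, neg_add]
  | add_right _ _ _ _ _ _ h1 h2 =>
    rw [lie_add, map_add, map_add, LinearMap.add_apply, h1, h2, neg_add]
  | smul_left r _ _ _ _ h1 =>
    rw [lie_smul, map_smul, map_smul, LinearMap.smul_apply, h1, smul_neg]
  | smul_right r _ _ _ _ h1 =>
    rw [lie_smul, map_smul, map_smul, LinearMap.smul_apply, h1, smul_neg]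

/-- For height ±1 this is the formula defining H_i. Beyond that z is split into brackets, and the
factors fall under cyclicity in smaller height or under the case without zero heights. -/
theorem cartan_lie {N : ℕ} (ih : Cyclic C K N) (Y : 𝔥) {r : ℤ} {x z : L}
    (hz : z ∈ C.grade r) (hx : x ∈ C.grade (-r)) (hr : r.natAbs ≤ N + 1) (hr0 : r ≠ 0) :
    K ⁅z, x⁆ (C.H Y) = K ⁅C.H Y, z⁆ x := by
  by_cases hr1 : r = 1
  · subst hr1; exact h.cartan_lie_one Y hz hx
  by_cases hr2 : r = -1
  · subst hr2
    have e := h.cartan_lie_one Y (by simpa using hx) hz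
    rw [h.swap_lie, e, h.cartan_skew_one Y (by simpa using hx) hz, neg_neg]
  have hz' := C.grade_le_span_brackets (by omega) hz
  clear hz
  induction hz' using Submodule.span_induction with
  | mem z hz' =>
    obtain ⟨r₁, r₂, z₁, z₂, hr12, rfl, hz₁, hz₂, rfl⟩ := hz'
    have hr' : (0 < r₁ ∧ 0 < r₂) ∨ (r₁ < 0 ∧ r₂ < 0) := by
      rcases pos_and_pos_or_neg_and_neg_of_mul_pos hr12 with h | h
      exacts [Or.inl h, Or.inr h]
    have hH := C.H_mem_grade Y
    have e1 := ih _ _ _ _ _ _ hH hz₁ (C.lie_mem_grade hz₂ hx) (by omega) (by omega) (by omega)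
      (by omega)
    have e2 := ih _ _ _ _ _ _ hH hz₂ (C.lie_mem_grade hz₁ hx) (by omega) (by omega) (by omega)
      (by omega)
    have e3 := h.cyclic_of_ne_zero ih (C.lie_mem_grade hH hz₁) hz₂ hx (by omega) (by omega)
      (by omega) (by omega) (by omega) (by omega) (by omega)
    have e4 := h.cyclic_of_ne_zero ih hz₁ (C.lie_mem_grade hH hz₂) hx (by omega) (by omega)
      (by omega) (by omega) (by omega) (by omega) (by omega)
    have e5 := h.cyclic_of_ne_zero ih (C.lie_mem_grade hH hz₂) hx hz₁ (by omega) (by omega)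
      (by omega) (by omega) (by omega) (by omega) (by omega)
    rw [leibniz_lie (C.H Y), lie_lie z₁, map_add, LinearMap.add_apply, map_sub, LinearMap.sub_apply,
      ← e1, ← e2, e3, e4, e5, h.symm ⁅z₂, x⁆, h.swap_lie x, h.symm ⁅z₁, x⁆, sub_eq_add_neg]
  | zero => simp
  | add z z' _ _ h1 h2 =>
    rw [lie_add, add_lie, map_add, map_add, LinearMap.add_apply, LinearMap.add_apply, h1, h2]
  | smul c z _ h1 =>
    rw [lie_smul, smul_lie, map_smul, map_smul, LinearMap.smul_apply, LinearMap.smul_apply, h1]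

/-- A height equal to zero can occur in any of the three places; each such case reduces to
`cartan_lie`. Two zeros force the third. -/
theorem cyclic (N : ℕ) : Cyclic C K N := by
  induction N with
  | zero =>
    intro p q r x y z hx hy hz h0 hp hq hr
    obtain ⟨rfl, rfl, rfl⟩ : p = 0 ∧ q = 0 ∧ r = 0 := by omega
    rw [grade_zero] at hx hy hz
    obtain ⟨X, rfl⟩ := hx
    obtain ⟨Y, rfl⟩ := hy
    obtain ⟨Z, rfl⟩ := hz
    rw [C.HH, C.HH]; simp
  | succ N ih =>
    intro p q r x y z hx hy hz h0 hp hq hr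
    by_cases hp0 : p = 0
    · subst hp0
      by_cases hq0 : q = 0
      · subst hq0
        exact ih 0 0 r x y z hx hy hz h0 (by omega) (by omega) (by omega)
      rw [grade_zero] at hx
      obtain ⟨X, rfl⟩ := hx
      obtain rfl : r = -q := by omega
      exact (h.cartan_lie ih X hy hz hq hq0).symm
    by_cases hq0 : q = 0
    · subst hq0
      rw [grade_zero] at hy
      obtain ⟨Y, rfl⟩ := hy
      obtain rfl : p = -r := by omega
      have hr0 : r ≠ 0 := by omega
      have e1 := h.cartan_lie ih Y hz hx hr hr0
      have e2 := h.cartan_lie ih Y hx (by rwa [neg_neg]) hp hp0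
      rw [← e1, h.swap_lie, ← e2, h.swap_lie, neg_neg]
    by_cases hr0 : r = 0
    · subst hr0
      rw [grade_zero] at hz
      obtain ⟨Z, rfl⟩ := hz
      obtain rfl : q = -p := by omega
      have e2 := h.cartan_lie ih Z hy (by rwa [neg_neg]) hq hq0
      rw [h.swap_lie y, ← e2, h.swap_lie y, neg_neg]
    exact h.cyclic_of_ne_zero ih hx hy hz h0 hp hq hr hp0 hq0 hr0

theorem isForm : IsForm C K where
  cartan X Y := by rw [h.cartan, h.proj_H]
  orth := h.orth
  EF := h.K_EF
  symm := h.symm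
  inv := by
    suffices H : ∀ p, ∀ x ∈ C.grade p, ∀ q, ∀ y ∈ C.grade q, ∀ r, ∀ z ∈ C.grade r,
        K ⁅x, y⁆ z = K x ⁅y, z⁆ by
      -- Both sides of the invariance are trilinear, so it suffices to compare them on homogeneous
      -- arguments.
      let A : L →ₗ[ℂ] L →ₗ[ℂ] L := (LieAlgebra.ad ℂ L : L →ₗ[ℂ] Module.End ℂ L)
      let f : L →ₗ[ℂ] L →ₗ[ℂ] L →ₗ[ℂ] ℂ := A.compr₂ K
      let g : L →ₗ[ℂ] L →ₗ[ℂ] L →ₗ[ℂ] ℂ :=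
        ((LinearMap.llcomp ℂ L L ℂ).flip ∘ₗ A).flip.flip.flip ∘ₗ K
      have hfg : f = g := ext_grade (C := C) fun p x hx => ext_grade (C := C) fun q y hy =>
        ext_grade (C := C) fun r z hz => H p x hx q y hy r z hz
      intro x y z
      exact LinearMap.congr_fun (LinearMap.congr_fun (LinearMap.congr_fun hfg x) y) z
    intro p x hx q y hy r z hz
    by_cases h0 : p + q + r = 0
    · rw [h.cyclic (p.natAbs + q.natAbs + r.natAbs) p q r x y z hx hy hz h0 (by omega) (by omega)
        (by omega), h.symm]
    · rw [h.orth (C.lie_mem_grade hx hy) hz h0, h.orth hx (C.lie_mem_grade hy hz) (by omega)]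

end PreForm

theorem exists_isForm (hH : Function.Injective C.H) : ∃ K, IsForm C K := by
  obtain ⟨p, K, h⟩ := exists_preForm hH
  exact ⟨K, h.isForm⟩

end CartanData.Chevalley
end Invariant

/-! ### Sums over the cobracket -/

section Cobracket

variable {α β V W : Type*} [AddCommGroup V] [Module ℂ V] [AddCommGroup W] [Module ℂ W]

/-- The sum of `b` over all pairs of leaves of two bracketings. -/
def treePair (b : α → α → ℂ) (x y : FreeMagma α) : ℂ :=
  ((leaves x).map fun p => ((leaves y).map fun q => b p q).sum).sum

/-- The sum of `Φ` over the terms of the cobracket `δ` of a commutator, where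
`δ [x, y] = b(x, y) (x ⊗ y - y ⊗ x) + [δ x, y] + [x, δ y]` and `δ` vanishes on generators. -/
def cobSum (b : α → α → ℂ) : FreeMagma α → (FreeMagma α → FreeMagma α → V) → V
  | .of _, _ => 0
  | .mul x y, Φ => treePair b x y • (Φ x y - Φ y x) +
      cobSum b x (fun s t => Φ (s * y) t + Φ s (t * y)) +
      cobSum b y (fun s t => Φ (x * s) t + Φ s (x * t))

theorem cobSum_of (b : α → α → ℂ) (a : α) (Φ : FreeMagma α → FreeMagma α → V) :
    cobSum b (.of a) Φ = 0 := rfl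

theorem cobSum_mul (b : α → α → ℂ) (x y : FreeMagma α) (Φ : FreeMagma α → FreeMagma α → V) :
    cobSum b (x * y) Φ = treePair b x y • (Φ x y - Φ y x) +
      cobSum b x (fun s t => Φ (s * y) t + Φ s (t * y)) +
      cobSum b y (fun s t => Φ (x * s) t + Φ s (x * t)) := rfl

/-- Only splittings occur whose two factors together have the leaves of `g`, each leaf as often as
in `g`. -/
theorem cobSum_congr (b : α → α → ℂ) (g : FreeMagma α) {Φ Ψ : FreeMagma α → FreeMagma α → V}
    (h : ∀ s t, (leaves s ++ leaves t).Perm (leaves g) → Φ s t = Ψ s t) :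
    cobSum b g Φ = cobSum b g Ψ := by
  induction g generalizing Φ Ψ with
  | ih1 a => rfl
  | ih2 x y hx hy =>
    simp only [leaves_mul] at h
    rw [cobSum_mul, cobSum_mul, h x y (.refl _), h y x List.perm_append_comm]
    refine congrArg₂ _ (congrArg₂ _ rfl ?_) ?_
    · refine hx fun s t hst => ?_
      rw [h (s * y) t, h s (t * y)]
      · rw [leaves_mul, ← List.append_assoc]; exact hst.append_right _
      · rw [leaves_mul, List.append_assoc]
        refine (List.Perm.append_left _ List.perm_append_comm).trans ?_
        rw [← List.append_assoc]; exact hst.append_right _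
    · refine hy fun s t hst => ?_
      rw [h (x * s) t, h s (x * t)]
      · rw [leaves_mul, ← List.append_assoc]
        refine (List.Perm.append_right _ List.perm_append_comm).trans ?_
        rw [List.append_assoc]; exact hst.append_left _
      · rw [leaves_mul, List.append_assoc]; exact hst.append_left _

theorem map_cobSum (f : V →ₗ[ℂ] W) (b : α → α → ℂ) (g : FreeMagma α)
    (Φ : FreeMagma α → FreeMagma α → V) :
    f (cobSum b g Φ) = cobSum b g fun s t => f (Φ s t) := by
  induction g generalizing Φ with
  | ih1 a => exact map_zero f
  | ih2 x y hx hy => simp only [cobSum_mul, map_add, map_smul, map_sub, hx, hy]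

theorem cobSum_add (b : α → α → ℂ) (g : FreeMagma α) (Φ Ψ : FreeMagma α → FreeMagma α → V) :
    cobSum b g (fun s t => Φ s t + Ψ s t) = cobSum b g Φ + cobSum b g Ψ := by
  induction g generalizing Φ Ψ with
  | ih1 a => exact (add_zero _).symm
  | ih2 x y hx hy =>
    have e1 := hx (fun s t => Φ (s * y) t + Φ s (t * y)) (fun s t => Ψ (s * y) t + Ψ s (t * y))
    have e2 := hy (fun s t => Φ (x * s) t + Φ s (x * t)) (fun s t => Ψ (x * s) t + Ψ s (x * t))
    simp only [cobSum_mul, add_add_add_comm (Φ _ _) (Ψ _ _), e1, e2, add_sub_add_comm, smul_add]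
    abel

theorem cobSum_smul (b : α → α → ℂ) (g : FreeMagma α) (c : ℂ)
    (Φ : FreeMagma α → FreeMagma α → V) :
    cobSum b g (fun s t => c • Φ s t) = c • cobSum b g Φ :=
  (map_cobSum (LinearMap.lsmul ℂ V c) b g Φ).symm

theorem cobSum_zero (b : α → α → ℂ) (g : FreeMagma α) :
    cobSum b g (fun _ _ => (0 : V)) = 0 := by
  simpa using cobSum_smul b g 0 (fun _ _ => (0 : V))

theorem cobSum_eq_zero (b : α → α → ℂ) (g : FreeMagma α) {Φ : FreeMagma α → FreeMagma α → V}
    (h : ∀ s t, (leaves s ++ leaves t).Perm (leaves g) → Φ s t = 0) : cobSum b g Φ = 0 :=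
  (cobSum_congr b g h).trans (cobSum_zero b g)

theorem cobSum_sum {ι : Type*} (b : α → α → ℂ) (g : FreeMagma α) (S : Finset ι)
    (Φ : ι → FreeMagma α → FreeMagma α → V) :
    cobSum b g (fun s t => ∑ i ∈ S, Φ i s t) = ∑ i ∈ S, cobSum b g (Φ i) := by
  classical
  induction S using Finset.induction_on with
  | empty => simpa using cobSum_zero b g
  | insert i S hi ih => simp only [sum_insert hi, cobSum_add, ih]

/-- The cobracket is antisymmetric: its defining term x ⊗ y - y ⊗ x is, and the Leibniz terms keep
this property. -/
theorem cobSum_flip (b : α → α → ℂ) (g : FreeMagma α) (Φ : FreeMagma α → FreeMagma α → V) :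
    cobSum b g (fun s t => Φ t s) = -cobSum b g Φ := by
  induction g generalizing Φ with
  | ih1 a => exact neg_zero.symm
  | ih2 x y hx hy =>
    have e1 := hx fun s t => Φ (s * y) t + Φ s (t * y)
    have e2 := hy fun s t => Φ (x * s) t + Φ s (x * t)
    simp only [add_comm (Φ (_ * y) _), add_comm (Φ (x * _) _)] at e1 e2
    simp only [cobSum_mul, add_comm (Φ (_ * y) _), add_comm (Φ (x * _) _), neg_add, ← e1, ← e2]
    rw [← smul_neg, neg_sub]

theorem leaves_map (f : α → β) (g : FreeMagma α) :
    leaves (FreeMagma.map f g) = (leaves g).map f := by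
  induction g with
  | ih1 a => rfl
  | ih2 x y hx hy => rw [map_mul, leaves_mul, leaves_mul, List.map_append, hx, hy]

theorem treePair_map (b : β → β → ℂ) (f : α → β) (x y : FreeMagma α) :
    treePair b (FreeMagma.map f x) (FreeMagma.map f y) = treePair (fun p q => b (f p) (f q)) x y := by
  simp only [treePair, leaves_map, List.map_map]; rfl

theorem cobSum_map (b : β → β → ℂ) (f : α → β) (g : FreeMagma α)
    (Φ : FreeMagma β → FreeMagma β → V) :
    cobSum b (FreeMagma.map f g) Φ =
      cobSum (fun p q => b (f p) (f q)) g fun s t => Φ (FreeMagma.map f s) (FreeMagma.map f t) := by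
  induction g generalizing Φ with
  | ih1 a => rfl
  | ih2 x y hx hy => simp only [map_mul, cobSum_mul, hx, hy, treePair_map]

theorem treePair_comm {b : α → α → ℂ} (hb : ∀ p q, b p q = b q p) (x y : FreeMagma α) :
    treePair b x y = treePair b y x := by
  have : ∀ l l' : List α, (l.map fun p => (l'.map fun q => b p q).sum).sum =
      (l'.map fun p => (l.map fun q => b p q).sum).sum := by
    intro l l'
    induction l with
    | nil => simp
    | cons a l ih => simp only [List.map_cons, List.sum_cons, ih, List.sum_map_add, hb a]
  exact this _ _

end Cobracket

/-! ### The invariant form turns brackets into cobrackets -/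

section FormCobracket

variable {R : ℕ} {𝔥 : Type*} [AddCommGroup 𝔥] [Module ℂ 𝔥] [FiniteDimensional ℂ 𝔥]
  {D : CartanData R 𝔥} {L : Type*} [LieRing L] [LieAlgebra ℂ L]

namespace CartanData

theorem form_coroot (D : CartanData R 𝔥) (i : Fin R) (X : 𝔥) :
    D.form (D.coroot i) X = D.root i X := by
  rw [coroot, LinearMap.BilinForm.apply_toDual_symm_apply]

theorem cartan_symm (D : CartanData R 𝔥) (i j : Fin R) : D.cartan i j = D.cartan j i := by
  rw [cartan, cartan, ← form_coroot, ← form_coroot]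
  exact D.form_symm.eq _ _

namespace Chevalley

variable {C : D.Chevalley L} {K : LinearMap.BilinForm ℂ L} (hK : C.IsForm K)
include hK

namespace IsForm

theorem swap : C.swap.IsForm K where
  cartan X Y := by
    change K (-C.H X) (-C.H Y) = _
    rw [map_neg, map_neg, LinearMap.neg_apply, neg_neg, hK.cartan]
  orth hx hy h := by
    rw [swap_grade] at hx hy
    exact hK.orth hx hy (by omega)
  EF i j := by
    change K (C.F i) (C.E j) = _
    rw [hK.symm, hK.EF]; simp only [eq_comm]
  symm := hK.symm
  inv := hK.inv

theorem lie_left (x y z : L) : K ⁅x, y⁆ z = -K y ⁅x, z⁆ := by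
  rw [← lie_skew, map_neg, LinearMap.neg_apply, hK.inv]

/-- `K([x, u] , ·)` for `[x, u] ∈ 𝔥`. -/
theorem lie_lie_of_mem_zero {x : L} (y : L) {u₁ u₂ : FreeMagma (Fin R)}
    (h0 : ⁅x, commutator C.F u₁⁆ ∈ C.grade 0) :
    K ⁅⁅x, commutator C.F u₁⁆, y⁆ (commutator C.F u₂) =
      treePair D.cartan u₁ u₂ * (K x (commutator C.F u₁) * K y (commutator C.F u₂)) := by
  rw [grade_zero] at h0
  obtain ⟨W, hW⟩ := h0
  -- Pairing with every Y in 𝔥 determines the Cartan element [x, u₁]: it is K(x, u₁) times the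
  -- element dual to the sum of the roots of u₁.
  have h1 : ∀ Y, D.form Y W = D.treeRoot u₁ Y * K x (commutator C.F u₁) := by
    intro Y
    rw [← hK.cartan, hW, ← lie_skew, map_neg, ← hK.inv, H_lie_commF, map_neg, LinearMap.neg_apply,
      map_smul, neg_neg, LinearMap.smul_apply, hK.symm x]; rfl
  rw [← hW, hK.lie_left, H_lie_commF, map_neg, map_smul, neg_neg, smul_eq_mul, ← mul_assoc]
  congr 1
  have h2 : ∀ l : List (Fin R), (l.map D.root).sum W =
      (l.map fun q => (((leaves u₁).map fun p => D.cartan q p)).sum).sum *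
        K x (commutator C.F u₁) := by
    intro l
    induction l with
    | nil => simp
    | cons a l ih =>
      simp only [List.map_cons, List.sum_cons, LinearMap.add_apply, ih, add_mul]
      rw [← form_coroot, h1]
      congr 2
      have h3 : ∀ l : List (Fin R), (l.map D.root).sum (D.coroot a) =
          (l.map fun p => D.cartan a p).sum := by
        intro l
        induction l with
        | nil => simp
        | cons c l ih => simp only [List.map_cons, List.sum_cons, LinearMap.add_apply, ih]; rfl
      exact h3 _
  rw [treePair_comm D.cartan_symm]
  exact h2 _

theorem commF_eq_zero {p : ℤ} {x : L} (hx : x ∈ C.grade p) {u : FreeMagma (Fin R)}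
    (h : p ≠ (leaves u).length) : K x (commutator C.F u) = 0 :=
  hK.orth hx (C.commF_mem_grade u) (by omega)

/-- The three terms belong to the three signs of the height of [x, u₁]. For height zero it is a
Cartan element and produces the coefficient b(u₁, u₂). For positive height the formula for u₂
applies to [x, u₁] and y. For negative height invariance moves u₂ to y, and the formula for u₁
applies to x and [y, u₂]. In each case the other two terms vanish for reasons of height. -/
theorem form_lie_aux {u₁ u₂ : FreeMagma (Fin R)}
    (ih₁ : ∀ {p q : ℤ} {x y : L}, 0 < p → 0 < q → x ∈ C.grade p → y ∈ C.grade q →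
      K ⁅x, y⁆ (commutator C.F u₁) =
        cobSum D.cartan u₁ fun s t => K x (commutator C.F s) * K y (commutator C.F t))
    (ih₂ : ∀ {p q : ℤ} {x y : L}, 0 < p → 0 < q → x ∈ C.grade p → y ∈ C.grade q →
      K ⁅x, y⁆ (commutator C.F u₂) =
        cobSum D.cartan u₂ fun s t => K x (commutator C.F s) * K y (commutator C.F t))
    {p q : ℤ} {x y : L} (hp : 0 < p) (hq : 0 < q) (hx : x ∈ C.grade p) (hy : y ∈ C.grade q) :
    K ⁅⁅x, commutator C.F u₁⁆, y⁆ (commutator C.F u₂) =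
      treePair D.cartan u₁ u₂ * (K x (commutator C.F u₁) * K y (commutator C.F u₂)) +
      (cobSum D.cartan u₂ fun s t => K x (commutator C.F (u₁ * s)) * K y (commutator C.F t)) +
      cobSum D.cartan u₁ fun s t => K x (commutator C.F s) * K y (commutator C.F (t * u₂)) := by
  have hxu := C.lie_mem_grade hx (C.commF_mem_grade u₁)
  have hlen : ∀ {s t u : FreeMagma (Fin R)}, (leaves s ++ leaves t).Perm (leaves u) →
      (leaves s).length + (leaves t).length = (leaves u).length := fun h => by
    rw [← h.length_eq, List.length_append]
  have hmul : ∀ s t : FreeMagma (Fin R), (leaves (s * t)).length =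
      (leaves s).length + (leaves t).length := fun s t => by rw [leaves_mul, List.length_append]
  rcases lt_trichotomy p (leaves u₁).length with h | h | h
  · rw [hK.commF_eq_zero hx (u := u₁) (by omega), cobSum_eq_zero D.cartan u₂ fun s t _ => by
      rw [hK.commF_eq_zero hx (by have := hmul u₁ s; omega), zero_mul]]
    have hyu := C.lie_mem_grade hy (C.commF_mem_grade u₂)
    rw [zero_mul, mul_zero, zero_add, zero_add, hK.inv]
    by_cases hq' : (leaves u₂).length < q
    · rw [hK.inv, ← lie_skew, map_neg, ← hK.inv, ih₁ hp (by omega) hx hyu]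
      rw [← neg_one_smul ℂ, ← cobSum_smul]
      refine cobSum_congr _ _ fun s t _ => ?_
      rw [commutator_mul, ← lie_skew (commutator C.F t), map_neg, hK.inv]
      simp
    -- Here [x, u₁] has negative height and [y, u₂] has height at most zero, so they are orthogonal.
    · rw [hK.orth hxu hyu (by omega), cobSum_eq_zero D.cartan u₁ fun s t hst => ?_]
      by_cases hs : p = (leaves s).length
      · have := hmul t u₂
        have := hlen hst
        rw [hK.commF_eq_zero hy (u := t * u₂), mul_zero]
        have := leaves_length_pos t
        omega
      · rw [hK.commF_eq_zero hx hs, zero_mul]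
  · rw [cobSum_eq_zero D.cartan u₂ fun s t _ => by
      have := leaves_length_pos s
      rw [hK.commF_eq_zero hx (by have := hmul u₁ s; omega), zero_mul],
      cobSum_eq_zero D.cartan u₁ fun s t hst => by
      have := leaves_length_pos t
      rw [hK.commF_eq_zero hx (by have := hlen hst; omega), zero_mul], add_zero, add_zero]
    refine hK.lie_lie_of_mem_zero y ?_
    rwa [h, add_neg_cancel] at hxu
  · rw [hK.commF_eq_zero hx (u := u₁) (by omega), cobSum_eq_zero D.cartan u₁ fun s t hst => by
      have := hlen hst
      rw [hK.commF_eq_zero hx (by omega), zero_mul], zero_mul, mul_zero, zero_add, add_zero,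
      ih₂ (by omega) hq hxu hy]
    refine cobSum_congr _ _ fun s t _ => ?_
    rw [hK.inv, commutator_mul]

/-- By invariance and the Jacobi identity, K([x,y], [u₁,u₂]) is the difference of K([[x,u₁],y], u₂)
and the same expression with x and y exchanged. Antisymmetry of the cobracket collects the two
versions of `form_lie_aux` into the Leibniz terms of δ[u₁,u₂]. -/
theorem form_lie_commF_grade (u : FreeMagma (Fin R)) {p q : ℤ} {x y : L} (hp : 0 < p) (hq : 0 < q)
    (hx : x ∈ C.grade p) (hy : y ∈ C.grade q) :
    K ⁅x, y⁆ (commutator C.F u) =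
      cobSum D.cartan u fun s t => K x (commutator C.F s) * K y (commutator C.F t) := by
  induction u generalizing p q x y with
  | ih1 a =>
    rw [cobSum_of]
    exact hK.commF_eq_zero (C.lie_mem_grade hx hy) (by rw [leaves_of]; simp; omega)
  | ih2 u₁ u₂ ih₁ ih₂ =>
    have e1 := hK.form_lie_aux ih₁ ih₂ hp hq hx hy
    have e2 := hK.form_lie_aux ih₁ ih₂ hq hp hy hx
    have e3 : K ⁅x, y⁆ (commutator C.F (u₁ * u₂)) =
        K ⁅⁅x, commutator C.F u₁⁆, y⁆ (commutator C.F u₂) -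
          K ⁅⁅y, commutator C.F u₁⁆, x⁆ (commutator C.F u₂) := by
      rw [commutator_mul, ← hK.inv, ← LinearMap.sub_apply, ← map_sub]
      congr 2
      rw [lie_lie x y, ← lie_skew ⁅x, commutator C.F u₁⁆ y, ← lie_skew ⁅y, commutator C.F u₁⁆ x]
      abel
    rw [e3, e1, e2, cobSum_mul]
    have f1 := cobSum_flip D.cartan u₂ fun s t =>
      K x (commutator C.F s) * K y (commutator C.F (u₁ * t))
    have f2 := cobSum_flip D.cartan u₁ fun s t =>
      K x (commutator C.F (s * u₂)) * K y (commutator C.F t)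
    simp only [mul_comm (K y _) (K x _)] 
    rw [f1, f2]
    simp only [cobSum_add, smul_eq_mul]
    ring

theorem form_lie_commF (u : FreeMagma (Fin R)) {x y : L} (hx : x ∈ C.pos) (hy : y ∈ C.pos) :
    K ⁅x, y⁆ (commutator C.F u) =
      cobSum D.cartan u fun s t => K x (commutator C.F s) * K y (commutator C.F t) := by
  induction hx, hy using Submodule.span_induction₂ with
  | mem_mem x y hx hy =>
    obtain ⟨v, rfl⟩ := hx
    obtain ⟨w, rfl⟩ := hy
    have := leaves_length_pos v
    have := leaves_length_pos w
    exact hK.form_lie_commF_grade u (by omega) (by omega) (C.commE_mem_grade v) (C.commE_mem_grade w)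
  | zero_left => simp [cobSum_zero]
  | zero_right => simp [cobSum_zero]
  | add_left _ _ _ _ _ _ h1 h2 =>
    simp only [add_lie, map_add, LinearMap.add_apply, h1, h2, add_mul, cobSum_add]
  | add_right _ _ _ _ _ _ h1 h2 =>
    simp only [lie_add, map_add, LinearMap.add_apply, h1, h2, mul_add, cobSum_add]
  | smul_left r _ _ _ _ h1 =>
    simp only [smul_lie, map_smul, LinearMap.smul_apply, h1, smul_mul_assoc, cobSum_smul]
  | smul_right r _ _ _ _ h1 =>
    simp only [lie_smul, map_smul, LinearMap.smul_apply, h1, mul_smul_comm, cobSum_smul]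

theorem form_lie_commE (v : FreeMagma (Fin R)) {x y : L} (hx : x ∈ C.neg) (hy : y ∈ C.neg) :
    K ⁅x, y⁆ (commutator C.E v) =
      cobSum D.cartan v fun s t => K x (commutator C.E s) * K y (commutator C.E t) :=
  hK.swap.form_lie_commF v hx hy

end IsForm
end Chevalley
end CartanData
end FormCobracket

/-! ### Elements commuting with all generators, and diagram symmetries -/

section Symmetry

variable {R : ℕ} {𝔥 : Type*} [AddCommGroup 𝔥] [Module ℂ 𝔥] [FiniteDimensional ℂ 𝔥]
  {D : CartanData R 𝔥} {L : Type*} [LieRing L] [LieAlgebra ℂ L]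

namespace CartanData

attribute [local instance 100] LieRing.ofAssociativeRing

namespace Chevalley

variable (C : D.Chevalley L)

theorem exists_proj (s : ℤ → Prop) :
    ∃ T : L →ₗ[ℂ] L, ∀ n x, x ∈ C.grade n → (s n → T x = x) ∧ (¬ s n → T x = 0) := by
  classical
  obtain ⟨T, hT⟩ := exists_glue C.grade_independent C.iSup_grade
    fun n => if s n then (C.grade n).subtype else 0
  refine ⟨T, fun n x hx => ⟨fun h => ?_, fun h => ?_⟩⟩
  · have := hT n ⟨x, hx⟩
    rwa [if_pos h] at this
  · have := hT n ⟨x, hx⟩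
    rwa [if_neg h] at this

/-- The projection to the components whose heights satisfy `s`. -/
def proj (s : ℤ → Prop) : L →ₗ[ℂ] L := (C.exists_proj s).choose

variable {C}

theorem proj_of {s : ℤ → Prop} {n : ℤ} {x : L} (hx : x ∈ C.grade n) (h : s n) : C.proj s x = x :=
  ((C.exists_proj s).choose_spec n x hx).1 h

theorem proj_of_not {s : ℤ → Prop} {n : ℤ} {x : L} (hx : x ∈ C.grade n) (h : ¬ s n) :
    C.proj s x = 0 :=
  ((C.exists_proj s).choose_spec n x hx).2 h

@[elab_as_elim]
theorem induction_grade {p : L → Prop} (hadd : ∀ x y, p x → p y → p (x + y))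
    (h0 : p 0) (hmem : ∀ n, ∀ x ∈ C.grade n, p x) (x : L) : p x :=
  Submodule.iSup_induction C.grade (motive := p) (C.iSup_grade ▸ Submodule.mem_top : x ∈ ⨆ n, C.grade n) hmem h0
    hadd

theorem proj_add_proj (x : L) :
    C.proj (· < 0) x + C.proj (· = 0) x + C.proj (0 < ·) x = x := by
  refine induction_grade (C := C) (fun x y hx hy => ?_) (by simp) (fun n x hx => ?_) x
  · simp only [map_add]
    conv_rhs => rw [← hx, ← hy]
    abel
  · rcases lt_trichotomy n 0 with h | h | h
    · rw [proj_of hx h, proj_of_not hx h.ne, proj_of_not hx h.not_gt, add_zero, add_zero]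
    · rw [proj_of_not hx (by omega), proj_of hx h, proj_of_not hx (by omega), add_zero, zero_add]
    · rw [proj_of_not hx h.not_gt, proj_of_not hx h.ne', proj_of hx h, add_zero, zero_add]

theorem proj_pos_mem (x : L) : C.proj (0 < ·) x ∈ C.pos := by
  refine induction_grade (C := C) (fun x y hx hy => ?_) (by simp) (fun n x hx => ?_) x
  · rw [map_add]; exact add_mem hx hy
  · by_cases h : 0 < n
    · rw [proj_of hx h]; exact C.grade_pos_le h hx
    · rw [proj_of_not hx h]; exact zero_mem _

theorem proj_neg_mem (x : L) : C.proj (· < 0) x ∈ C.neg := by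
  refine induction_grade (C := C) (fun x y hx hy => ?_) (by simp) (fun n x hx => ?_) x
  · rw [map_add]; exact add_mem hx hy
  · by_cases h : n < 0
    · rw [proj_of hx h]; exact C.grade_neg_le h hx
    · rw [proj_of_not hx h]; exact zero_mem _

theorem proj_zero_mem (x : L) : C.proj (· = 0) x ∈ LinearMap.range C.H := by
  refine induction_grade (C := C) (fun x y hx hy => ?_) (by simp) (fun n x hx => ?_) x
  · rw [map_add]; exact add_mem hx hy
  · by_cases h : n = 0
    · rw [proj_of hx h]; subst h; rwa [← grade_zero]
    · rw [proj_of_not hx h]; exact zero_mem _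

theorem proj_of_mem_neg {s : ℤ → Prop} (hs : ∀ n < 0, s n) {x : L} (hx : x ∈ C.neg) :
    C.proj s x = x := by
  induction hx using Submodule.span_induction with
  | mem x hx =>
    obtain ⟨u, rfl⟩ := hx
    exact proj_of (C.commF_mem_grade u) (hs _ (by have := leaves_length_pos u; omega))
  | zero => simp
  | add _ _ _ _ h1 h2 => rw [map_add, h1, h2]
  | smul c _ _ h1 => rw [map_smul, h1]

theorem proj_of_mem_pos {s : ℤ → Prop} (hs : ∀ n > 0, s n) {x : L} (hx : x ∈ C.pos) :
    C.proj s x = x := by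
  induction hx using Submodule.span_induction with
  | mem x hx =>
    obtain ⟨u, rfl⟩ := hx
    exact proj_of (C.commE_mem_grade u) (hs _ (by have := leaves_length_pos u; omega))
  | zero => simp
  | add _ _ _ _ h1 h2 => rw [map_add, h1, h2]
  | smul c _ _ h1 => rw [map_smul, h1]

theorem lie_proj {m : ℤ} {y : L} (hy : y ∈ C.grade m) (s : ℤ → Prop) (x : L) :
    ⁅y, C.proj s x⁆ = C.proj (fun n => s (n - m)) ⁅y, x⁆ := by
  refine induction_grade (C := C) (fun x x' hx hx' => ?_) (by simp) (fun n x hx => ?_) x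
  · rw [map_add, lie_add, lie_add, map_add, hx, hx']
  · have h := C.lie_mem_grade hy hx
    by_cases hs : s n
    · rw [proj_of hx hs, proj_of h (by rwa [add_sub_cancel_left])]
    · rw [proj_of_not hx hs, proj_of_not h (by rwa [add_sub_cancel_left]), lie_zero]

/-- X acts on the highest weight vector by Λ(X), and Λ is arbitrary. -/
theorem HasVerma.H_injective (hV : C.HasVerma) : Function.Injective C.H := by
  rw [injective_iff_map_eq_zero]
  intro X hX
  rw [← Module.forall_dual_apply_eq_zero_iff ℂ]
  intro Λ
  obtain ⟨ρ, -, -, hH⟩ := hV Λ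
  have h := LinearMap.congr_fun (hH X) (Finsupp.single [] 1)
  rw [hX, map_zero, vermaH_single] at h
  have h2 := DFunLike.congr_fun h []
  simpa [wordWeight] using h2.symm

variable (C) in
/-- The iterated commutator `[F_{i_1}, [F_{i_2}, …, F_{i_k}]]`. -/
def dynkinWord : List (Fin R) → L
  | [] => 0
  | [i] => C.F i
  | i :: j :: w => ⁅C.F i, dynkinWord (j :: w)⁆

variable (C) in
/-- The linear map that sends a word to the corresponding iterated commutator of the `F_i`. -/
def dynkin : Words R →ₗ[ℂ] L :=
  Finsupp.lsum ℂ fun w => LinearMap.toSpanSingleton ℂ _ (C.dynkinWord w)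

theorem dynkin_single (w : List (Fin R)) (c : ℂ) :
    C.dynkin (Finsupp.single w c) = c • C.dynkinWord w := by
  simp [dynkin]

theorem dynkin_vermaF (i : Fin R) (m : Words R) :
    C.dynkin (vermaF i m) = ⁅C.F i, C.dynkin m⁆ + m [] • C.F i := by
  induction m using Finsupp.induction_linear with
  | zero => simp
  | add f g hf hg => rw [map_add, map_add, map_add, hf, hg, lie_add, Finsupp.add_apply, add_smul]; abel
  | single w c =>
    rw [vermaF_single, dynkin_single, dynkin_single]
    cases w with
    | nil => simp [dynkinWord]
    | cons j w => simp [dynkinWord]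

/-- The Dynkin-Specht-Wever lemma: applied to the word expansion of a commutator with n leaves, the
left-to-right bracketing gives n times the commutator. The last clause records that left
multiplication by it commutes with appending letters. -/
theorem dynkin_commF {ρ : L →ₗ⁅ℂ⁆ Module.End ℂ (Words R)} (hF : ∀ i, ρ (C.F i) = vermaF i)
    (u : FreeMagma (Fin R)) :
    (∀ m, ρ (commutator C.F u) m [] = 0) ∧ (∀ m, C.dynkin (ρ (commutator C.F u) m) =
      ⁅commutator C.F u, C.dynkin m⁆ + (m [] * (leaves u).length) • commutator C.F u) ∧
    ∀ w m, ρ (commutator C.F u) (Finsupp.lmapDomain ℂ ℂ (· ++ w) m) =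
      Finsupp.lmapDomain ℂ ℂ (· ++ w) (ρ (commutator C.F u) m) := by
  induction u with
  | ih1 a =>
    rw [commutator_of, hF]
    refine ⟨fun m => ?_, fun m => ?_, fun w m => ?_⟩
    · exact Finsupp.mapDomain_of_notMem_range m [] (by simp)
    · rw [dynkin_vermaF]; simp [leaves_of]
    · simp only [vermaF, Finsupp.lmapDomain_apply, ← Finsupp.mapDomain_comp]; rfl
  | ih2 x y hx hy =>
    obtain ⟨hx1, hx2, hx3⟩ := hx
    obtain ⟨hy1, hy2, hy3⟩ := hy
    rw [commutator_mul, LieHom.map_lie]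
    refine ⟨fun m => ?_, fun m => ?_, fun w m => ?_⟩
    · rw [end_lie_apply, Finsupp.sub_apply, hx1, hy1, sub_zero]
    · rw [end_lie_apply, map_sub, lie_lie, leaves_mul, List.length_append]
      simp only [hx2, hy2, hx1, hy1, lie_add, lie_smul]
      rw [← lie_skew (commutator C.F y) (commutator C.F x)]
      push_cast
      simp only [mul_add, add_smul, smul_neg, zero_mul, zero_smul]
      abel
    · rw [end_lie_apply, end_lie_apply, map_sub, hy3, hx3, hx3, hy3]

/-- The factor n of the Dynkin-Specht-Wever lemma is the action of -ad ρ, which makes the statement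
linear in z. -/
theorem dynkin_neg {ρ : L →ₗ⁅ℂ⁆ Module.End ℂ (Words R)} (hF : ∀ i, ρ (C.F i) = vermaF i)
    {z : L} (hz : z ∈ C.neg) :
    (ρ z (Finsupp.single [] 1) [] = 0) ∧
    (C.dynkin (ρ z (Finsupp.single [] 1)) = -⁅C.H D.rho, z⁆) ∧
    ∀ j, ρ z (Finsupp.single [j] 1) =
      Finsupp.lmapDomain ℂ ℂ (· ++ [j]) (ρ z (Finsupp.single [] 1)) := by
  induction hz using Submodule.span_induction with
  | mem x hx =>
    obtain ⟨u, rfl⟩ := hx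
    obtain ⟨h1, h2, h3⟩ := dynkin_commF hF u
    refine ⟨h1 _, ?_, fun j => ?_⟩
    · rw [h2, H_lie_commF, treeRoot_rho, dynkin_single]
      simp [dynkinWord]
    · rw [← h3]; simp
  | zero => simp
  | add x y _ _ hx hy =>
    obtain ⟨h1, h2, h3⟩ := hx
    obtain ⟨h1', h2', h3'⟩ := hy
    refine ⟨?_, ?_, fun j => ?_⟩
    · rw [map_add, LinearMap.add_apply, Finsupp.add_apply, h1, h1', add_zero]
    · rw [map_add, LinearMap.add_apply, map_add, h2, h2', lie_add, neg_add]
    · rw [map_add, LinearMap.add_apply, LinearMap.add_apply, map_add, h3, h3']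
  | smul c x _ hx =>
    obtain ⟨h1, h2, h3⟩ := hx
    refine ⟨?_, ?_, fun j => ?_⟩
    · rw [map_smul, LinearMap.smul_apply, Finsupp.smul_apply, h1, smul_zero]
    · rw [map_smul, LinearMap.smul_apply, map_smul, h2, lie_smul, smul_neg]
    · rw [map_smul, LinearMap.smul_apply, LinearMap.smul_apply, map_smul, h3]

theorem eq_zero_of_mem_neg_of_mem_zero {z : L} (hz : z ∈ C.neg) (h0 : z ∈ C.grade 0) : z = 0 := by
  rw [← proj_of_mem_neg (s := (· < 0)) (fun n h => h) hz, proj_of_not (s := (· < 0)) h0 (lt_irrefl 0)]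

/-- With at least two letters, commuting with all F_j forces the word expansion m of z to satisfy j
m = m j for every letter j, and only constants do so in the free associative algebra. As z has no
constant term, m = 0, and the Dynkin map gives [ρ, z] = 0. With one letter 𝔫 is spanned by F, and
[E, cF] = c H with H ≠ 0. Without letters 𝔫 = 0. -/
theorem HasVerma.eq_zero_of_central (hV : C.HasVerma) {z : L} (hz : z ∈ C.neg)
    (hE : ∀ i, ⁅C.E i, z⁆ = 0) (hF : ∀ i, ⁅C.F i, z⁆ = 0) : z = 0 := by
  rcases subsingleton_or_nontrivial (Fin R) with hR | hR
  · rcases isEmpty_or_nonempty (Fin R) with hR' | ⟨⟨a⟩⟩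
    · have : IsEmpty (FreeMagma (Fin R)) := ⟨fun u => by
        induction u with
        | ih1 a => exact hR'.elim a
        | ih2 x y hx hy => exact hx⟩
      rw [neg, Set.range_eq_empty, Submodule.span_empty] at hz
      exact (Submodule.mem_bot ℂ).1 hz
    · have h1 : ∀ u, ∃ c : ℂ, commutator C.F u = c • C.F a := by
        intro u
        induction u with
        | ih1 b => exact ⟨1, by rw [commutator_of, Subsingleton.elim b a, one_smul]⟩
        | ih2 x y hx hy =>
          obtain ⟨c, hc⟩ := hx
          obtain ⟨d, hd⟩ := hy
          exact ⟨0, by rw [commutator_mul, hc, hd]; simp⟩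
      have h2 : C.neg ≤ Submodule.span ℂ {C.F a} := by
        refine Submodule.span_le.2 ?_
        rintro _ ⟨u, rfl⟩
        obtain ⟨c, hc⟩ := h1 u
        exact hc ▸ Submodule.smul_mem _ c (Submodule.mem_span_singleton_self _)
      obtain ⟨c, rfl⟩ := Submodule.mem_span_singleton.1 (h2 hz)
      have h3 := hE a
      rw [lie_smul, C.EF, if_pos rfl, smul_eq_zero] at h3
      rcases h3 with h3 | h3
      · rw [h3, zero_smul]
      · have h4 : D.coroot a = 0 := hV.H_injective (by rw [h3, map_zero])
        exact absurd ((LinearEquiv.map_eq_zero_iff _).1 h4) (D.root_linearIndependent.ne_zero a)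
  · obtain ⟨ρ, -, hρF, -⟩ := hV 0
    obtain ⟨h1, h2, h3⟩ := dynkin_neg hρF hz
    set m := ρ z (Finsupp.single [] 1) with hm
    have h4 : ∀ j, vermaF j m = Finsupp.lmapDomain ℂ ℂ (· ++ [j]) m := by
      intro j
      have h := LinearMap.congr_fun (congrArg ρ (hF j)) (Finsupp.single [] 1)
      rw [LieHom.map_lie, end_lie_apply, hρF, vermaF_single, h3, map_zero, LinearMap.zero_apply,
        sub_eq_zero] at h
      exact h
    have hm0 : m = 0 := by
      ext w
      cases w with
      | nil => exact h1
      | cons k w =>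
        -- Compare the coefficients of the word k w j in j m = m j: on the left it is zero since j ≠
        -- k, on the right it is the coefficient of k w in m.
        obtain ⟨j, hj⟩ := exists_ne k
        have h5 := DFunLike.congr_fun (h4 j) (k :: (w ++ [j]))
        rw [vermaF, Finsupp.lmapDomain_apply, Finsupp.lmapDomain_apply,
          Finsupp.mapDomain_of_notMem_range _ _ (by rintro ⟨w', hw'⟩; simp at hw'; exact hj hw'.1)] at h5
        rw [Finsupp.zero_apply, h5]
        exact (Finsupp.mapDomain_apply (List.append_left_injective [j]) m (k :: w)).symm
    rw [hm0, map_zero] at h2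
    refine eq_zero_of_mem_neg_of_mem_zero hz ?_
    rw [mem_grade, ← neg_inj, ← h2]; simp

/-- The generators are homogeneous, so the negative and the positive part of z also commute with
them, and both are zero by the preceding lemma and its mirror image. -/
theorem mem_range_of_central (hV : C.HasVerma) (hV' : C.swap.HasVerma) {z : L}
    (hE : ∀ i, ⁅C.E i, z⁆ = 0) (hF : ∀ i, ⁅C.F i, z⁆ = 0) : z ∈ LinearMap.range C.H := by
  have h1 : C.proj (· < 0) z = 0 := by
    refine hV.eq_zero_of_central (proj_neg_mem z) (fun i => ?_) (fun i => ?_)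
    · exact (lie_proj (C.commE_mem_grade (.of i)) _ _).trans (by rw [commutator_of, hE, map_zero])
    · exact (lie_proj (C.commF_mem_grade (.of i)) _ _).trans (by rw [commutator_of, hF, map_zero])
  have h2 : C.proj (0 < ·) z = 0 := by
    refine hV'.eq_zero_of_central (proj_pos_mem z) (fun i => ?_) (fun i => ?_)
    · exact (lie_proj (C.commF_mem_grade (.of i)) _ _).trans (by rw [commutator_of, hF, map_zero])
    · exact (lie_proj (C.commE_mem_grade (.of i)) _ _).trans (by rw [commutator_of, hE, map_zero])
  rw [← proj_add_proj (C := C) z, h1, h2, zero_add, add_zero]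
  exact proj_zero_mem z

variable (C) in
/-- An automorphism that permutes the `E_i`, the `F_i` and the `H_i`. -/
structure DiagramSymmetry where
  aut : L ≃ₗ⁅ℂ⁆ L
  perm : Equiv.Perm (Fin R)
  map_E : ∀ i, aut (C.E i) = C.E (perm i)
  map_F : ∀ i, aut (C.F i) = C.F (perm i)
  map_H : ∀ i, aut (C.H (D.coroot i)) = C.H (D.coroot (perm i))
  map_cartan : ∀ X, aut (C.H X) ∈ LinearMap.range C.H

/-- Only the images of the H_i are prescribed, and these need not span 𝔥. Choose Y in 𝔥 whose roots
are the permuted roots of X; then the image of X differs from Y by an element commuting with all E_i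
and F_i. -/
theorem map_cartan_of (hV : C.HasVerma) (hV' : C.swap.HasVerma) {aut : L ≃ₗ⁅ℂ⁆ L}
    {perm : Equiv.Perm (Fin R)} (hE : ∀ i, aut (C.E i) = C.E (perm i))
    (hF : ∀ i, aut (C.F i) = C.F (perm i)) (X : 𝔥) : aut (C.H X) ∈ LinearMap.range C.H := by
  obtain ⟨Y, hY⟩ := D.exists_root_eq fun i => D.root (perm.symm i) X
  have h : aut (C.H X) - C.H Y ∈ LinearMap.range C.H := by
    refine mem_range_of_central hV hV' (fun i => ?_) (fun i => ?_)
    · obtain ⟨i, rfl⟩ := perm.surjective i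
      rw [← lie_skew, sub_lie, C.HE, hY, perm.symm_apply_apply, ← hE, ← LieEquiv.map_lie, C.HE,
        map_smul, sub_self, neg_zero]
    · obtain ⟨i, rfl⟩ := perm.surjective i
      rw [← lie_skew, sub_lie, C.HF, hY, perm.symm_apply_apply, ← hF, ← LieEquiv.map_lie, C.HF,
        map_neg, map_smul, sub_self, neg_zero]
  rw [← sub_add_cancel (aut (C.H X)) (C.H Y)]
  exact add_mem h ⟨Y, rfl⟩

namespace DiagramSymmetry

variable (σ : C.DiagramSymmetry)

theorem aut_commE (u : FreeMagma (Fin R)) :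
    σ.aut (commutator C.E u) = commutator C.E (FreeMagma.map σ.perm u) := by
  induction u with
  | ih1 a => exact σ.map_E a
  | ih2 x y hx hy => rw [map_mul, commutator_mul, commutator_mul, LieEquiv.map_lie, hx, hy]

theorem aut_commF (u : FreeMagma (Fin R)) :
    σ.aut (commutator C.F u) = commutator C.F (FreeMagma.map σ.perm u) := by
  induction u with
  | ih1 a => exact σ.map_F a
  | ih2 x y hx hy => rw [map_mul, commutator_mul, commutator_mul, LieEquiv.map_lie, hx, hy]

theorem aut_mem_grade {n : ℤ} {x : L} (hx : x ∈ C.grade n) : σ.aut x ∈ C.grade n := by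
  rw [grade_eq] at hx
  induction hx using Submodule.span_induction with
  | mem x hx =>
    rcases hx with ⟨u, rfl, rfl⟩ | ⟨u, rfl, rfl⟩ | ⟨rfl, X, rfl⟩
    · rw [aut_commF]
      simpa [leaves_map] using C.commF_mem_grade (FreeMagma.map σ.perm u)
    · rw [aut_commE]
      simpa [leaves_map] using C.commE_mem_grade (FreeMagma.map σ.perm u)
    · rw [grade_zero]; exact σ.map_cartan X
  | zero => simp
  | add _ _ _ _ h1 h2 => rw [map_add]; exact add_mem h1 h2
  | smul c _ _ h1 => rw [map_smul]; exact Submodule.smul_mem _ c h1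

theorem aut_proj (s : ℤ → Prop) (x : L) : σ.aut (C.proj s x) = C.proj s (σ.aut x) := by
  refine induction_grade (C := C) (fun x y hx hy => ?_) (by simp) (fun n x hx => ?_) x
  · simp only [map_add, hx, hy]
  · by_cases h : s n
    · rw [proj_of hx h, proj_of (σ.aut_mem_grade hx) h]
    · rw [proj_of_not hx h, proj_of_not (σ.aut_mem_grade hx) h, map_zero]

variable {K : LinearMap.BilinForm ℂ L} (hK : C.IsForm K)
include hK

theorem E_ne_zero (i : Fin R) : C.E i ≠ 0 := by
  intro h
  have := hK.EF i i
  rw [h, if_pos rfl, map_zero, LinearMap.zero_apply] at this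
  exact zero_ne_one this

theorem cartan_perm (i j : Fin R) : D.cartan (σ.perm i) (σ.perm j) = D.cartan i j := by
  have h := congrArg σ.aut (C.HE (D.coroot i) j)
  rw [LieEquiv.map_lie, σ.map_H, map_smul, σ.map_E, C.HE] at h
  exact smul_left_injective ℂ (E_ne_zero hK (σ.perm j)) h

theorem root_eq_of_fixed {X : 𝔥} (hX : σ.aut (C.H X) = C.H X) (i : Fin R) :
    D.root (σ.perm i) X = D.root i X := by
  have h := congrArg σ.aut (C.HE X i)
  rw [LieEquiv.map_lie, hX, map_smul, σ.map_E, C.HE] at h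
  exact smul_left_injective ℂ (E_ne_zero hK (σ.perm i)) h

/-- The recursion through the cobracket determines these values from the b_ij, which the permutation
preserves. -/
theorem form_tree (v u : FreeMagma (Fin R)) :
    K (commutator C.E (FreeMagma.map σ.perm v)) (commutator C.F (FreeMagma.map σ.perm u)) =
      K (commutator C.E v) (commutator C.F u) := by
  induction v generalizing u with
  | ih1 a =>
    cases u with
    | of b =>
      change K (C.E (σ.perm a)) (C.F (σ.perm b)) = K (C.E a) (C.F b)
      rw [hK.EF, hK.EF]; simp
    | mul x y =>
      change K (commutator C.E (.of (σ.perm a))) (commutator C.F (FreeMagma.map σ.perm (x * y))) =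
        K (commutator C.E (.of a)) (commutator C.F (x * y))
      have := leaves_length_pos x
      have := leaves_length_pos y
      rw [hK.commF_eq_zero (C.commE_mem_grade (.of a)) (by simp [leaves_of, leaves_mul]; omega),
        hK.commF_eq_zero (C.commE_mem_grade (.of (σ.perm a)))
          (by simp [leaves_of, leaves_mul, leaves_map]; omega)]
  | ih2 x y hx hy =>
    have hm : ∀ v, commutator C.E v ∈ C.pos := fun v => Submodule.subset_span ⟨v, rfl⟩
    rw [map_mul, commutator_mul, commutator_mul, hK.form_lie_commF _ (hm _) (hm _),
      hK.form_lie_commF _ (hm _) (hm _), cobSum_map]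
    simp only [hx, hy, σ.cartan_perm hK]

/-- Restricted to x in the positive part because the automorphism need not be an isometry on 𝔥. -/
theorem form_aut {x : L} (hx : x ∈ C.pos) (y : L) : K (σ.aut x) (σ.aut y) = K x y := by
  induction hx using Submodule.span_induction with
  | mem x hx =>
    obtain ⟨v, rfl⟩ := hx
    refine induction_grade (C := C) (fun x y hx hy => ?_) (by simp) (fun n y hy => ?_) y
    · rw [map_add, map_add, map_add, hx, hy]
    · have hv := leaves_length_pos v
      rcases lt_or_ge n 0 with hn | hn
      · have hy' := C.grade_neg_le hn hy
        clear hy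
        induction hy' using Submodule.span_induction with
        | mem y hy =>
          obtain ⟨u, rfl⟩ := hy
          rw [aut_commE, aut_commF, σ.form_tree hK]
        | zero => simp
        | add _ _ _ _ h1 h2 => rw [map_add, map_add, map_add, h1, h2]
        | smul c _ _ h1 => rw [map_smul, map_smul, map_smul, h1]
      · rw [hK.orth (C.commE_mem_grade v) hy (by omega),
          hK.orth (σ.aut_mem_grade (C.commE_mem_grade v)) (σ.aut_mem_grade hy) (by omega)]
  | zero => simp
  | add _ _ _ _ h1 h2 => simp only [map_add, LinearMap.add_apply, h1, h2]
  | smul c _ _ h1 => simp only [map_smul, LinearMap.smul_apply, h1]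

end DiagramSymmetry
end Chevalley
end CartanData
end Symmetry

/-! ### Dual families and the action of the Casimir element -/

section Casimir

theorem map_one_tree {α : Type*} (u : FreeMagma α) :
    FreeMagma.map ⇑(1 : Equiv.Perm α) u = u := by
  induction u with
  | ih1 a => rfl
  | ih2 x y hx hy => rw [map_mul, hx, hy]

theorem map_mul_tree {α : Type*} (f g : Equiv.Perm α) (u : FreeMagma α) :
    FreeMagma.map ⇑(f * g) u = FreeMagma.map f (FreeMagma.map g u) := by
  induction u with
  | ih1 a => rfl
  | ih2 x y hx hy => simp only [map_mul, hx, hy]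

/-- A bilinear form of finite rank has dual families. -/
theorem exists_dual_family {P N W : Type*} [AddCommGroup P] [Module ℂ P] [AddCommGroup N]
    [Module ℂ N] [AddCommGroup W] [Module ℂ W] [FiniteDimensional ℂ W] (B : P →ₗ[ℂ] N →ₗ[ℂ] ℂ)
    (π : P →ₗ[ℂ] W) (hπ : ∀ x, π x = 0 → B x = 0) :
    ∃ (n : ℕ) (e : Fin n → P) (f : Fin n → N), ∀ x y, B x y = ∑ b, B x (f b) * B (e b) y := by
  have : FiniteDimensional ℂ (P ⧸ LinearMap.ker π) :=
    Module.Finite.equiv π.quotKerEquivRange.symm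
  have : FiniteDimensional ℂ (LinearMap.range B) := by
    have h : LinearMap.range B = LinearMap.range ((LinearMap.ker π).liftQ B hπ) :=
      (Submodule.range_liftQ _ _ _).symm
    rw [h]
    infer_instance
  let ev : N →ₗ[ℂ] Module.Dual ℂ (LinearMap.range B) :=
    LinearMap.flip (LinearMap.range B).subtype
  -- The range of B consists of functionals on N and has finite dimension. Since N separates them,
  -- every functional on this range is evaluation at a point of N; the f_b are points giving the
  -- coordinates of a basis.
  have hev : LinearMap.range ev = ⊤ := by
    by_contra h
    obtain ⟨g, hg, hle⟩ := Submodule.exists_le_ker_of_lt_top _ (lt_top_iff_ne_top.2 h)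
    obtain ⟨w, rfl⟩ := (Module.evalEquiv ℂ (LinearMap.range B)).surjective g
    refine hg ?_
    have hw : w = 0 := by
      ext y
      exact hle ⟨y, rfl⟩
    rw [hw, map_zero]
  let b := Module.finBasis ℂ (LinearMap.range B)
  choose e he using fun i => (b i).2
  choose f hf using fun i => LinearMap.range_eq_top.1 hev (b.coord i)
  refine ⟨_, e, f, fun x y => ?_⟩
  have h1 := b.sum_repr ⟨B x, x, rfl⟩
  have h2 := LinearMap.congr_fun (congrArg Subtype.val h1) y
  rw [← h2]
  simp only [AddSubmonoidClass.coe_finsetSum, SetLike.val_smul, LinearMap.sum_apply,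
    LinearMap.smul_apply, smul_eq_mul, he]
  refine sum_congr rfl fun i _ => ?_
  congr 1
  exact (LinearMap.congr_fun (hf i) ⟨B x, x, rfl⟩).symm

variable {R : ℕ} {𝔥 : Type*} [AddCommGroup 𝔥] [Module ℂ 𝔥] [FiniteDimensional ℂ 𝔥]
  {D : CartanData R 𝔥} {L : Type*} [LieRing L] [LieAlgebra ℂ L]

namespace CartanData.Chevalley

variable {C : D.Chevalley L}

namespace DiagramSymmetry

variable (σ : C.DiagramSymmetry) (T : ℕ)

/-- The sum over the first `T` powers of the automorphism. -/
def bar : L →ₗ[ℂ] L := ∑ j ∈ range T, ((σ.aut.toLinearEquiv ^ j : L ≃ₗ[ℂ] L) : L →ₗ[ℂ] L)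

theorem bar_apply (x : L) : σ.bar T x = ∑ j ∈ range T, (σ.aut.toLinearEquiv ^ j) x := by
  simp [bar, LinearMap.sum_apply]

theorem pow_succ_apply (j : ℕ) (x : L) :
    (σ.aut.toLinearEquiv ^ (j + 1)) x = σ.aut ((σ.aut.toLinearEquiv ^ j) x) := by
  rw [pow_succ']; rfl

theorem pow_induction {p : L → Prop} (h : ∀ x, p x → p (σ.aut x)) {x : L} (hx : p x) (j : ℕ) :
    p ((σ.aut.toLinearEquiv ^ j) x) := by
  induction j with
  | zero => exact hx
  | succ j ih => rw [pow_succ_apply]; exact h _ ih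

theorem pow_commE (j : ℕ) (u : FreeMagma (Fin R)) :
    (σ.aut.toLinearEquiv ^ j) (commutator C.E u) =
      commutator C.E (FreeMagma.map (σ.perm ^ j) u) := by
  induction j with
  | zero =>
    rw [pow_zero, pow_zero, map_one_tree]; rfl
  | succ j ih =>
    rw [pow_succ_apply, ih, aut_commE, pow_succ', map_mul_tree]

theorem pow_commF (j : ℕ) (u : FreeMagma (Fin R)) :
    (σ.aut.toLinearEquiv ^ j) (commutator C.F u) =
      commutator C.F (FreeMagma.map (σ.perm ^ j) u) := by
  induction j with
  | zero =>
    rw [pow_zero, pow_zero, map_one_tree]; rfl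
  | succ j ih =>
    rw [pow_succ_apply, ih, aut_commF, pow_succ', map_mul_tree]

theorem aut_mem_pos {x : L} (hx : x ∈ C.pos) : σ.aut x ∈ C.pos := by
  induction hx using Submodule.span_induction with
  | mem x hx =>
    obtain ⟨u, rfl⟩ := hx
    rw [aut_commE]; exact Submodule.subset_span ⟨_, rfl⟩
  | zero => simp
  | add _ _ _ _ h1 h2 => rw [map_add]; exact add_mem h1 h2
  | smul c _ _ h1 => rw [map_smul]; exact Submodule.smul_mem _ c h1

theorem aut_mem_neg {x : L} (hx : x ∈ C.neg) : σ.aut x ∈ C.neg := by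
  induction hx using Submodule.span_induction with
  | mem x hx =>
    obtain ⟨u, rfl⟩ := hx
    rw [aut_commF]; exact Submodule.subset_span ⟨_, rfl⟩
  | zero => simp
  | add _ _ _ _ h1 h2 => rw [map_add]; exact add_mem h1 h2
  | smul c _ _ h1 => rw [map_smul]; exact Submodule.smul_mem _ c h1

theorem bar_mem_pos {x : L} (hx : x ∈ C.pos) : σ.bar T x ∈ C.pos := by
  rw [bar_apply]
  exact sum_mem fun j _ => σ.pow_induction (p := (· ∈ C.pos)) (fun _ => σ.aut_mem_pos) hx j

theorem bar_mem_neg {x : L} (hx : x ∈ C.neg) : σ.bar T x ∈ C.neg := by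
  rw [bar_apply]
  exact sum_mem fun j _ => σ.pow_induction (p := (· ∈ C.neg)) (fun _ => σ.aut_mem_neg) hx j

theorem bar_mem_grade {n : ℤ} {x : L} (hx : x ∈ C.grade n) : σ.bar T x ∈ C.grade n := by
  rw [bar_apply]
  exact sum_mem fun j _ => σ.pow_induction (p := (· ∈ C.grade n)) (fun _ => σ.aut_mem_grade) hx j

variable {T}

theorem aut_bar (hT : σ.aut.toLinearEquiv ^ T = 1) (x : L) : σ.aut (σ.bar T x) = σ.bar T x := by
  rw [bar_apply, map_sum]
  simp only [← pow_succ_apply]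
  have h := (sum_range_succ' (fun j => (σ.aut.toLinearEquiv ^ j) x) T).symm.trans
    (sum_range_succ (fun j => (σ.aut.toLinearEquiv ^ j) x) T)
  rw [hT, pow_zero] at h
  exact add_right_cancel h

theorem bar_of_fixed {x : L} (hx : σ.aut x = x) : σ.bar T x = (T : ℂ) • x := by
  have h : ∀ j, (σ.aut.toLinearEquiv ^ j) x = x :=
    σ.pow_induction (p := (· = x)) (fun y hy => by rw [hy, hx]) rfl
  simp only [bar_apply, h, sum_const, card_range, Nat.cast_smul_eq_nsmul]

variable {K : LinearMap.BilinForm ℂ L} (hK : C.IsForm K)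
include hK

/-- The form distinguishes the E_a: otherwise E_a = E_{σ^T a} would pair with F_a both to 1 and to
0. -/
theorem perm_pow_eq_one (hT : σ.aut.toLinearEquiv ^ T = 1) : σ.perm ^ T = 1 := by
  ext a
  have h := σ.pow_commE T (.of a)
  rw [hT] at h
  change C.E a = C.E ((σ.perm ^ T) a) at h
  have h2 := hK.EF ((σ.perm ^ T) a) a
  rw [← h, hK.EF, if_pos rfl] at h2
  by_contra hne
  rw [if_neg (fun h3 => hne (by rw [h3]; rfl))] at h2
  exact one_ne_zero h2

theorem form_fixed {x y : L} (hx : x ∈ C.pos) (hfx : σ.aut x = x) :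
    K x (σ.bar T y) = T * K x y := by
  have h : ∀ j, K x ((σ.aut.toLinearEquiv ^ j) y) = K x y := by
    intro j
    induction j with
    | zero => rfl
    | succ j ih => rw [pow_succ_apply, ← ih]; nth_rw 1 [← hfx]; exact σ.form_aut hK hx _
  simp only [bar_apply, map_sum, h, sum_const, card_range, nsmul_eq_mul]

theorem form_bar_fixed {x y : L} (hx : x ∈ C.pos) (hfy : σ.aut y = y) :
    K (σ.bar T x) y = T * K x y := by
  have h : ∀ j, (σ.aut.toLinearEquiv ^ j) x ∈ C.pos ∧ K ((σ.aut.toLinearEquiv ^ j) x) y = K x y := by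
    intro j
    induction j with
    | zero => exact ⟨hx, rfl⟩
    | succ j ih =>
      refine ⟨pow_succ_apply σ j x ▸ σ.aut_mem_pos ih.1, ?_⟩
      rw [pow_succ_apply, ← ih.2]; nth_rw 1 [← hfy]
      exact σ.form_aut hK ih.1 _
  simp only [bar_apply, map_sum, LinearMap.sum_apply, fun j => (h j).2, sum_const, card_range,
    nsmul_eq_mul]

/-- Multiplied by T, both sides are K(x̄, ȳ). -/
theorem form_bar (hT : σ.aut.toLinearEquiv ^ T = 1) (hT0 : T ≠ 0) {x : L} (hx : x ∈ C.pos) (y : L) :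
    K (σ.bar T x) y = K x (σ.bar T y) := by
  have h1 := σ.form_bar_fixed hK (T := T) hx (σ.aut_bar hT y)
  rw [σ.form_fixed hK (σ.bar_mem_pos T hx) (σ.aut_bar hT x)] at h1
  exact mul_left_cancel₀ (Nat.cast_ne_zero.2 hT0) h1

/-- `∑_j (α_a, σ^j α_b)`. -/
def orbitCartan (σ : C.DiagramSymmetry) (T : ℕ) (a b : Fin R) : ℂ :=
  ∑ j ∈ range T, D.cartan a ((σ.perm ^ j) b)

omit hK in
/-- Dual families in the fixed parts of the span of the `E`-commutators and the `F`-commutators. -/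
structure DualFamily (σ : C.DiagramSymmetry) (K : LinearMap.BilinForm ℂ L) (B : Type) [Fintype B]
    where
  e : B → L
  f : B → L
  e_mem : ∀ b, e b ∈ C.pos
  f_mem : ∀ b, f b ∈ C.neg
  e_fixed : ∀ b, σ.aut (e b) = e b
  f_fixed : ∀ b, σ.aut (f b) = f b
  dual : ∀ x ∈ C.pos, σ.aut x = x → ∀ y ∈ C.neg, σ.aut y = y →
    K x y = ∑ b, K x (f b) * K (e b) y

end DiagramSymmetry

theorem lie_pos_mem {x y : L} (hx : x ∈ C.pos) (hy : y ∈ C.pos) : ⁅x, y⁆ ∈ C.pos :=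
  C.swap.lie_neg_mem hx hy

/-- Heights n and -n are paired, so the adjoint of a projection selects the opposite heights. -/
theorem IsForm.form_proj {K : LinearMap.BilinForm ℂ L} (hK : C.IsForm K) (s : ℤ → Prop) (x y : L) :
    K x (C.proj s y) = K (C.proj (fun n => s (-n)) x) y := by
  refine induction_grade (C := C) (fun x x' hx hx' => ?_) (by simp) (fun n x hx => ?_) x
  · simp only [map_add, LinearMap.add_apply, hx, hx']
  refine induction_grade (C := C) (fun y y' hy hy' => ?_) (by simp) (fun m y hy => ?_) y
  · simp only [map_add, hy, hy']
  by_cases h : n + m = 0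
  · obtain rfl : m = -n := by omega
    by_cases hs : s (-n)
    · rw [proj_of hy hs, proj_of hx hs]
    · rw [proj_of_not hy hs, proj_of_not hx hs, map_zero, map_zero, LinearMap.zero_apply]
  · have h1 : K x (C.proj s y) = 0 := by
      by_cases hs : s m
      · rw [proj_of hy hs, hK.orth hx hy h]
      · rw [proj_of_not hy hs, map_zero]
    have h2 : K (C.proj (fun n => s (-n)) x) y = 0 := by
      by_cases hs : s (-n)
      · rw [proj_of (s := fun n => s (-n)) hx hs, hK.orth hx hy h]
      · rw [proj_of_not (s := fun n => s (-n)) hx hs, map_zero, LinearMap.zero_apply]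
    rw [h1, h2]

theorem IsForm.form_proj_neg {K : LinearMap.BilinForm ℂ L} (hK : C.IsForm K) {x : L}
    (hx : x ∈ C.pos) (y : L) : K x (C.proj (· < 0) y) = K x y := by
  rw [hK.form_proj, proj_of_mem_pos (fun n hn => by omega) hx]

theorem IsForm.form_proj_pos {K : LinearMap.BilinForm ℂ L} (hK : C.IsForm K) {y : L}
    (hy : y ∈ C.neg) (x : L) : K (C.proj (0 < ·) x) y = K x y := by
  rw [hK.symm, hK.form_proj, proj_of_mem_neg (fun n hn => by omega) hy, hK.symm]

namespace DiagramSymmetry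

variable {σ : C.DiagramSymmetry} {K : LinearMap.BilinForm ℂ L} (hK : C.IsForm K)
  {B : Type} [Fintype B] (δ : σ.DualFamily K B)
include hK

theorem lie_fixed {x y : L} (hx : σ.aut x = x) (hy : σ.aut y = y) : σ.aut ⁅x, y⁆ = ⁅x, y⁆ := by
  rw [LieEquiv.map_lie, hx, hy]

/-- The dual families are inserted a second time, with index c. Invariance rearranges each factor so
that the sum over b can be contracted instead. The projections keep the contracted elements inside
𝔫_+ and 𝔫, where duality applies. -/
theorem sum_lie_lie {V U : L} (hV : V ∈ C.pos) (hVf : σ.aut V = V) (hU : U ∈ C.neg)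
    (hUf : σ.aut U = U) :
    ∑ b, K ⁅V, δ.e b⁆ ⁅δ.f b, U⁆ = ∑ b, K ⁅V, δ.f b⁆ (C.proj (0 < ·) ⁅δ.e b, U⁆) := by
  have h1 : ∀ b, K ⁅V, δ.e b⁆ ⁅δ.f b, U⁆ = ∑ c, K (C.proj (0 < ·) ⁅δ.e c, U⁆) (δ.f b) *
      K (δ.e b) (C.proj (· < 0) ⁅V, δ.f c⁆) := by
    intro b
    rw [δ.dual _ (lie_pos_mem hV (δ.e_mem b)) (lie_fixed hK hVf (δ.e_fixed b)) _
      (C.lie_neg_mem (δ.f_mem b) hU) (lie_fixed hK (δ.f_fixed b) hUf)]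
    refine sum_congr rfl fun c _ => ?_
    rw [hK.form_proj_pos (δ.f_mem b), hK.form_proj_neg (δ.e_mem b), ← lie_skew V (δ.e b), map_neg,
      LinearMap.neg_apply, hK.inv (δ.e b) V, hK.inv (δ.e c) U, ← lie_skew U (δ.f b), map_neg]
    ring
  simp only [h1]
  rw [sum_comm]
  refine sum_congr rfl fun c _ => ?_
  rw [← δ.dual _ (proj_pos_mem _) (by rw [aut_proj, lie_fixed hK (δ.e_fixed c) hUf]) _
    (proj_neg_mem _) (by rw [aut_proj, lie_fixed hK hVf (δ.f_fixed c)]),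
    hK.form_proj_neg (proj_pos_mem _), hK.symm]

/-- Invariance and the Jacobi identity write K([V,f_b], [e_b,U]) as -K(V, [[e_b,f_b],U]) +
K([V,e_b], [f_b,U]). After summation the second term cancels the positive part of [e_b,U] by
`sum_lie_lie`. -/
theorem sum_lie_proj_neg {V U : L} (hV : V ∈ C.pos) (hVf : σ.aut V = V) (hU : U ∈ C.neg)
    (hUf : σ.aut U = U) :
    ∑ b, K ⁅V, δ.f b⁆ (C.proj (· < 0) ⁅δ.e b, U⁆) =
      -K V ⁅∑ b, ⁅δ.e b, δ.f b⁆, U⁆ - ∑ b, K ⁅V, δ.f b⁆ (C.proj (· = 0) ⁅δ.e b, U⁆) := by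
  have h := sum_lie_lie hK δ hV hVf hU hUf
  have h1 : ∀ b, K ⁅V, δ.f b⁆ (C.proj (· < 0) ⁅δ.e b, U⁆) = -K V ⁅⁅δ.e b, δ.f b⁆, U⁆ +
      K ⁅V, δ.e b⁆ ⁅δ.f b, U⁆ - K ⁅V, δ.f b⁆ (C.proj (0 < ·) ⁅δ.e b, U⁆) -
        K ⁅V, δ.f b⁆ (C.proj (· = 0) ⁅δ.e b, U⁆) := by
    intro b
    have h2 := congrArg (K ⁅V, δ.f b⁆) (proj_add_proj (C := C) ⁅δ.e b, U⁆)
    have h3 : K ⁅V, δ.f b⁆ ⁅δ.e b, U⁆ = -K V ⁅⁅δ.e b, δ.f b⁆, U⁆ + K ⁅V, δ.e b⁆ ⁅δ.f b, U⁆ := by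
      rw [hK.inv, hK.inv, leibniz_lie (δ.f b), ← lie_skew (δ.f b) (δ.e b), map_add, neg_lie, map_neg]
    rw [map_add, map_add, h3] at h2
    linear_combination h2
  simp only [h1, sum_sub_distrib, sum_add_distrib, sum_neg_distrib, h, sum_lie, map_sum]
  ring

omit hK in
theorem treeRoot_map {X : 𝔥} (hX : ∀ i, D.root (σ.perm i) X = D.root i X) (j : ℕ)
    (u : FreeMagma (Fin R)) : D.treeRoot (FreeMagma.map (σ.perm ^ j) u) X = D.treeRoot u X := by
  have h : ∀ j i, D.root ((σ.perm ^ j) i) X = D.root i X := by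
    intro j i
    induction j with
    | zero => rfl
    | succ j ih => rw [pow_succ', Equiv.Perm.mul_apply, hX, ih]
  induction u with
  | ih1 a => simp [treeRoot, leaves_of, h]
  | ih2 x y hx hy =>
    rw [map_mul, treeRoot_mul, treeRoot_mul, LinearMap.add_apply, LinearMap.add_apply, hx, hy]

omit hK in
theorem H_lie_bar_commE {X : 𝔥} (hX : ∀ i, D.root (σ.perm i) X = D.root i X) (T : ℕ)
    (u : FreeMagma (Fin R)) : ⁅C.H X, σ.bar T (commutator C.E u)⁆ =
      D.treeRoot u X • σ.bar T (commutator C.E u) := by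
  simp only [bar_apply, lie_sum, smul_sum, pow_commE, H_lie_commE, treeRoot_map hX]

omit hK in
theorem H_lie_bar_commF {X : 𝔥} (hX : ∀ i, D.root (σ.perm i) X = D.root i X) (T : ℕ)
    (u : FreeMagma (Fin R)) : ⁅C.H X, σ.bar T (commutator C.F u)⁆ =
      -(D.treeRoot u X • σ.bar T (commutator C.F u)) := by
  simp only [bar_apply, lie_sum, smul_sum, pow_commF, H_lie_commF, treeRoot_map hX, sum_neg_distrib]

theorem exists_zero_part {x : L} (hx : σ.aut x = x) :
    ∃ X : 𝔥, C.H X = C.proj (· = 0) x ∧ ∀ i, D.root (σ.perm i) X = D.root i X := by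
  obtain ⟨X, hX⟩ := proj_zero_mem (C := C) x
  exact ⟨X, hX, fun i => σ.root_eq_of_fixed hK (by rw [hX, aut_proj, hx]) i⟩

variable {T : ℕ} (hT : σ.aut.toLinearEquiv ^ T = 1) (hT0 : T ≠ 0)
include hT hT0

/-- The action of the Cartan part of the Casimir element. -/
theorem sum_lie_lie_zero :
    ∃ X : 𝔥, (∀ i, D.root (σ.perm i) X = D.root i X) ∧ ∀ v u : FreeMagma (Fin R),
      (leaves v).length = (leaves u).length →
      K (σ.bar T (commutator C.E v)) ⁅∑ b, ⁅δ.e b, δ.f b⁆, σ.bar T (commutator C.F u)⁆ =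
        -(D.treeRoot u X * K (σ.bar T (commutator C.E v)) (σ.bar T (commutator C.F u))) := by
  obtain ⟨X, hX, hX2⟩ := exists_zero_part hK (σ := σ) (x := ∑ b, ⁅δ.e b, δ.f b⁆) (by
    rw [map_sum]; simp only [LieEquiv.map_lie, δ.e_fixed, δ.f_fixed])
  refine ⟨X, hX2, fun v u hlen => ?_⟩
  set V := σ.bar T (commutator C.E v)
  set U := σ.bar T (commutator C.F u) with hU
  -- As [V, U] has height zero, it only sees the Cartan part X of ∑ [e_b, f_b].
  have h0 : ⁅V, U⁆ ∈ C.grade 0 := by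
    have := C.lie_mem_grade (σ.bar_mem_grade T (C.commE_mem_grade v))
      (σ.bar_mem_grade T (C.commF_mem_grade u))
    rwa [hlen, add_neg_cancel] at this
  have h1 : K ⁅V, U⁆ (∑ b, ⁅δ.e b, δ.f b⁆) = K ⁅V, U⁆ (C.H X) := by
    rw [hX, hK.form_proj]
    simp only [neg_eq_zero]
    rw [proj_of (s := (· = 0)) h0 rfl]
  rw [← lie_skew, map_neg, ← hK.inv, h1, hK.inv, ← lie_skew, H_lie_bar_commF hX2, neg_neg, map_smul,
    smul_eq_mul]

theorem root_orbit_sum (a i : Fin R) :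
    D.root i (∑ j ∈ range T, D.coroot ((σ.perm ^ j) a)) = orbitCartan σ T i a := by
  rw [map_sum]
  exact sum_congr rfl fun j _ => D.cartan_symm _ _

theorem orbitCartan_perm (i a : Fin R) : orbitCartan σ T (σ.perm i) a = orbitCartan σ T i a := by
  obtain ⟨n, rfl⟩ := Nat.exists_eq_succ_of_ne_zero hT0
  rw [orbitCartan, orbitCartan, sum_range_succ', sum_range_succ]
  congr 1
  · refine sum_congr rfl fun j _ => ?_
    rw [pow_succ', Equiv.Perm.mul_apply, σ.cartan_perm hK]
  · have h := σ.perm_pow_eq_one hK hT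
    rw [← σ.cartan_perm hK i, ← Equiv.Perm.mul_apply, ← pow_succ', h, pow_zero]

/-- Let X be the Cartan part of [e_b, U]. Pairing it with [V, f_b] gives the weight of v at X times
K(V, f_b), while X is itself K(e_b, U) times the dual of the weight of u. Duality then sums the
products K(V, f_b) K(e_b, U). -/
theorem sum_proj_zero (v u : FreeMagma (Fin R)) :
    T * ∑ b, K ⁅σ.bar T (commutator C.E v), δ.f b⁆
        (C.proj (· = 0) ⁅δ.e b, σ.bar T (commutator C.F u)⁆) =
      treePair (orbitCartan σ T) u v *
        K (σ.bar T (commutator C.E v)) (σ.bar T (commutator C.F u)) := by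
  set V := σ.bar T (commutator C.E v) with hV
  set U := σ.bar T (commutator C.F u) with hU
  have hVp : V ∈ C.pos := σ.bar_mem_pos T (Submodule.subset_span ⟨_, rfl⟩)
  have hUn : U ∈ C.neg := σ.bar_mem_neg T (Submodule.subset_span ⟨_, rfl⟩)
  rw [δ.dual V hVp (σ.aut_bar hT _) U hUn (σ.aut_bar hT _), mul_sum, mul_sum]
  refine sum_congr rfl fun b _ => ?_
  obtain ⟨X, hX, hX2⟩ := exists_zero_part hK (σ := σ) (x := ⁅δ.e b, U⁆)
    (lie_fixed hK (δ.e_fixed b) (σ.aut_bar hT _))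
  have h1 : K ⁅V, δ.f b⁆ (C.H X) = D.treeRoot v X * K V (δ.f b) := by
    rw [hK.inv, ← lie_skew, map_neg, ← hK.inv, ← lie_skew, H_lie_bar_commE hX2, map_neg,
      LinearMap.neg_apply, neg_neg, map_smul, LinearMap.smul_apply, smul_eq_mul]
  have h2 : ∀ Y : 𝔥, (∀ i, D.root (σ.perm i) Y = D.root i Y) →
      D.form Y X = D.treeRoot u Y * K (δ.e b) U := by
    intro Y hY
    rw [← hK.cartan, hX, hK.form_proj]
    simp only [neg_eq_zero]
    rw [proj_of (s := (· = 0)) (C.H_mem_grade Y) rfl, hK.symm, hK.inv, ← lie_skew, H_lie_bar_commF hY, neg_neg,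
      map_smul, smul_eq_mul]
  -- X is known only against σ-invariant elements of 𝔥, so H_a is replaced by the sum of the H_{σ^j
  -- a}. This is the source of the orbit sums and of the factor T.
  have h3 : ∀ a, T * D.root a X =
      ((leaves u).map fun c => orbitCartan σ T c a).sum * K (δ.e b) U := by
    intro a
    have h4 : ∀ j, D.root ((σ.perm ^ j) a) X = D.root a X := by
      intro j
      induction j with
      | zero => rfl
      | succ j ih => rw [pow_succ', Equiv.Perm.mul_apply, hX2, ih]
    have h5 := h2 (∑ j ∈ range T, D.coroot ((σ.perm ^ j) a)) (fun i => by
      rw [root_orbit_sum hK hT hT0, root_orbit_sum hK hT hT0, orbitCartan_perm hK hT hT0])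
    rw [map_sum, LinearMap.sum_apply] at h5
    simp only [form_coroot, h4, sum_const, card_range, nsmul_eq_mul] at h5
    rw [h5]
    congr 1
    have h6 : ∀ l : List (Fin R), (l.map D.root).sum (∑ j ∈ range T, D.coroot ((σ.perm ^ j) a)) =
        (l.map fun c => orbitCartan σ T c a).sum := by
      intro l
      induction l with
      | nil => simp
      | cons c l ih =>
        rw [List.map_cons, List.sum_cons, LinearMap.add_apply, ih, root_orbit_sum hK hT hT0,
          List.map_cons, List.sum_cons]
    exact h6 _
  rw [← hX, h1, ← mul_assoc, mul_comm (K V _), ← mul_assoc]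
  congr 1
  rw [treePair]
  have h7 : ∀ l : List (Fin R), T * (l.map D.root).sum X =
      (((leaves u).map fun p => (l.map fun q => orbitCartan σ T p q).sum).sum) * K (δ.e b) U := by
    intro l
    induction l with
    | nil => simp
    | cons c l ih =>
      simp only [List.map_cons, List.sum_cons, List.sum_map_add, LinearMap.add_apply, mul_add,
        add_mul, ih, h3]
  exact h7 _

/-- The inner cobracket is K([v̄₁, v̄₂], u). A dual family separates v₁ from v₂ in it, and the outer
cobracket then reassembles K(v, [f_b, [e_b, U]_-]). -/
theorem cobSum_bar_eq (v u : FreeMagma (Fin R)) :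
    (cobSum D.cartan v fun v₁ v₂ => cobSum D.cartan u fun u₁ u₂ =>
      K (commutator C.E v₁) (σ.bar T (commutator C.F u₁)) *
        K (commutator C.E v₂) (σ.bar T (commutator C.F u₂))) =
    -∑ b, K ⁅σ.bar T (commutator C.E v), δ.f b⁆
        (C.proj (· < 0) ⁅δ.e b, σ.bar T (commutator C.F u)⁆) := by
  set U := σ.bar T (commutator C.F u) with hU
  have hTc : (T : ℂ) ≠ 0 := Nat.cast_ne_zero.2 hT0
  have hp : ∀ w, commutator C.E w ∈ C.pos := fun w => Submodule.subset_span ⟨w, rfl⟩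
  have hUn : U ∈ C.neg := σ.bar_mem_neg T (Submodule.subset_span ⟨_, rfl⟩)
  have hUf : σ.aut U = U := σ.aut_bar hT _
  -- Passing from u to U costs a factor 1/T, and replacing v̄₁ and v̄₂ by v₁ and v₂ against fixed
  -- elements gives T². The remaining T is absorbed when v is replaced by v̄ in the end.
  have h1 : ∀ v₁ v₂ : FreeMagma (Fin R), (cobSum D.cartan u fun u₁ u₂ =>
      K (commutator C.E v₁) (σ.bar T (commutator C.F u₁)) *
        K (commutator C.E v₂) (σ.bar T (commutator C.F u₂))) = -T * ∑ b,
          K (δ.f b) (commutator C.E v₁) * K (C.proj (· < 0) ⁅δ.e b, U⁆) (commutator C.E v₂) := by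
    intro v₁ v₂
    simp only [← σ.form_bar hK hT hT0 (hp _)]
    have hv₁ := σ.bar_mem_pos T (hp v₁)
    have hv₂ := σ.bar_mem_pos T (hp v₂)
    have hf₁ := σ.aut_bar hT (commutator C.E v₁)
    have hf₂ := σ.aut_bar hT (commutator C.E v₂)
    rw [← hK.form_lie_commF u hv₁ hv₂]
    refine mul_left_cancel₀ hTc ?_
    rw [← σ.form_fixed hK (lie_pos_mem hv₁ hv₂) (lie_fixed hK hf₁ hf₂), ← hU, hK.inv,
      ← hK.form_proj_neg hv₁, δ.dual _ hv₁ hf₁ _ (proj_neg_mem _)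
        (by rw [aut_proj, lie_fixed hK hf₂ hUf]), mul_sum, mul_sum]
    refine sum_congr rfl fun b _ => ?_
    rw [hK.form_proj_neg (δ.e_mem b), ← hK.inv, ← lie_skew, map_neg, LinearMap.neg_apply, hK.inv,
      ← hK.form_proj_neg hv₂, σ.form_bar_fixed hK (hp _) (δ.f_fixed b),
      σ.form_bar_fixed hK (hp _) (by rw [aut_proj, lie_fixed hK (δ.e_fixed b) hUf]),
      hK.symm (δ.f b), hK.symm _ (commutator C.E v₂)]
    ring
  have h2 := cobSum_smul D.cartan v (-T : ℂ) fun v₁ v₂ => ∑ b,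
          K (δ.f b) (commutator C.E v₁) * K (C.proj (· < 0) ⁅δ.e b, U⁆) (commutator C.E v₂)
  simp only [h1]
  simp only [smul_eq_mul] at h2
  rw [h2, cobSum_sum, neg_mul, neg_inj, mul_sum]
  refine sum_congr rfl fun b _ => ?_
  rw [← hK.form_lie_commE v (δ.f_mem b) (proj_neg_mem _), hK.symm, ← σ.form_bar_fixed hK (hp v)
    (lie_fixed hK (δ.f_fixed b) (by rw [aut_proj, lie_fixed hK (δ.e_fixed b) hUf])), hK.inv]

include δ in
/-- The double cobracket acts on the pairing of two commutators of equal weight by a scalar. -/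
theorem cobSum_cobSum (v u : FreeMagma (Fin R)) (hlen : (leaves v).length = (leaves u).length) :
    (cobSum D.cartan v fun v₁ v₂ => cobSum D.cartan u fun u₁ u₂ =>
      K (commutator C.E v₁) (σ.bar T (commutator C.F u₁)) *
        K (commutator C.E v₂) (σ.bar T (commutator C.F u₂))) =
    (treePair (orbitCartan σ T) u v - ((leaves u).map fun c => orbitCartan σ T c c).sum) *
      K (commutator C.E v) (σ.bar T (commutator C.F u)) := by
  have hTc : (T : ℂ) ≠ 0 := Nat.cast_ne_zero.2 hT0
  have hp : ∀ w, commutator C.E w ∈ C.pos := fun w => Submodule.subset_span ⟨w, rfl⟩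
  obtain ⟨X, -, hX⟩ := sum_lie_lie_zero hK δ hT hT0
  have h : ∀ v u : FreeMagma (Fin R), (leaves v).length = (leaves u).length →
    (cobSum D.cartan v fun v₁ v₂ => cobSum D.cartan u fun u₁ u₂ =>
      K (commutator C.E v₁) (σ.bar T (commutator C.F u₁)) *
        K (commutator C.E v₂) (σ.bar T (commutator C.F u₂))) =
    (treePair (orbitCartan σ T) u v - T * D.treeRoot u X) *
      K (commutator C.E v) (σ.bar T (commutator C.F u)) := by
    intro v u hlen
    have h1 := sum_proj_zero hK δ hT hT0 v u
    have hUf := σ.aut_bar hT (commutator C.F u)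
    have hVf := σ.aut_bar hT (commutator C.E v)
    rw [cobSum_bar_eq hK δ hT hT0, sum_lie_proj_neg hK δ (σ.bar_mem_pos T (hp v)) hVf
      (σ.bar_mem_neg T (Submodule.subset_span ⟨_, rfl⟩)) hUf, hX v u hlen]
    rw [σ.form_bar_fixed hK (hp v) hUf] at h1 ⊢
    refine mul_left_cancel₀ hTc ?_
    linear_combination h1
  -- On a single generator the cobracket is zero while K(E_a, bar F_a) is a positive integer, so the
  -- scalar of `h` must vanish there; this determines α_a(X).
  have h2 : ∀ a, T * D.root a X = orbitCartan σ T a a := by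
    intro a
    have h3 := h (.of a) (.of a) rfl
    have h4 : K (commutator C.E (.of a)) (σ.bar T (commutator C.F (.of a))) =
        ((range T).filter fun j => a = (σ.perm ^ j) a).card := by
      rw [bar_apply, map_sum, card_filter, Nat.cast_sum]
      refine sum_congr rfl fun j _ => ?_
      rw [pow_commF]
      exact (hK.EF a ((σ.perm ^ j) a)).trans (by push_cast; rfl)
    have h5 : 0 < ((range T).filter fun j => a = (σ.perm ^ j) a).card :=
      card_pos.2 ⟨0, mem_filter.2 ⟨mem_range.2 (Nat.pos_of_ne_zero hT0), rfl⟩⟩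
    rw [cobSum_of, h4, eq_comm, mul_eq_zero, or_iff_left (Nat.cast_ne_zero.2 h5.ne'),
      sub_eq_zero] at h3
    simp only [treePair, treeRoot, leaves_of, List.map_cons, List.map_nil, List.sum_cons,
      List.sum_nil, add_zero] at h3
    exact h3.symm
  rw [h v u hlen]
  congr 2
  rw [treeRoot]
  generalize leaves u = l
  induction l with
  | nil => simp
  | cons c l ih =>
    simp only [List.map_cons, List.sum_cons, LinearMap.add_apply, mul_add, ih, h2]

end DiagramSymmetry
end CartanData.Chevalley
end Casimir

/-! ### A bilinear form on the exterior algebra -/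

section Exterior

open ExteriorAlgebra

variable {J : Type*} [Fintype J]

/-- The exterior algebra of the functions on a finite set. -/
abbrev Ext (J : Type*) := ExteriorAlgebra ℂ (J → ℂ)

/-- The diagonal form with weights `c` on the functions on a finite set. -/
def diagForm (c : J → ℂ) : LinearMap.BilinForm ℂ (J → ℂ) :=
  LinearMap.mk₂ ℂ (fun w w' => ∑ j, c j * w j * w' j)
    (fun _ _ _ => by simp only [Pi.add_apply, mul_add, add_mul, sum_add_distrib])
    (fun _ _ _ => by
      simp only [Pi.smul_apply, smul_eq_mul, mul_sum]; exact sum_congr rfl fun _ _ => by ring)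
    (fun _ _ _ => by simp only [Pi.add_apply, mul_add, sum_add_distrib])
    (fun _ _ _ => by
      simp only [Pi.smul_apply, smul_eq_mul, mul_sum]; exact sum_congr rfl fun _ _ => by ring)

theorem diagForm_apply (c w w' : J → ℂ) : diagForm c w w' = ∑ j, c j * w j * w' j := rfl

theorem diagForm_comm (c w w' : J → ℂ) : diagForm c w w' = diagForm c w' w :=
  sum_congr rfl fun _ _ => by ring

@[elab_as_elim]
theorem ext_induction {P : Ext J → Prop} (algebraMap : ∀ r : ℂ, P (algebraMap ℂ (Ext J) r))
    (add : ∀ x y, P x → P y → P (x + y)) (ι_mul : ∀ x w, P x → P (ι ℂ w * x)) (a : Ext J) : P a :=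
  CliffordAlgebra.left_induction (Q := 0) algebraMap add ι_mul a

/-- Contraction by a function, with respect to the diagonal form. -/
def ctr (c : J → ℂ) (w : J → ℂ) : Ext J →ₗ[ℂ] Ext J := CliffordAlgebra.contractLeft (diagForm c w)

variable (c : J → ℂ)

theorem ctr_ι_mul (w w' : J → ℂ) (a : Ext J) :
    ctr c w (ι ℂ w' * a) = diagForm c w w' • a - ι ℂ w' * ctr c w a :=
  CliffordAlgebra.contractLeft_ι_mul _ _ _

theorem ctr_algebraMap (w : J → ℂ) (r : ℂ) : ctr c w (algebraMap ℂ _ r) = 0 :=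
  CliffordAlgebra.contractLeft_algebraMap _ _ _

theorem ctr_ctr (w : J → ℂ) (a : Ext J) : ctr c w (ctr c w a) = 0 := CliffordAlgebra.contractLeft_contractLeft _ _

/-- The anti-homomorphism that sends a product of functions to the contraction by them. -/
def ctrHom : Ext J →ₐ[ℂ] (Module.End ℂ (Ext J))ᵐᵒᵖ :=
  ExteriorAlgebra.lift ℂ ⟨(MulOpposite.opLinearEquiv ℂ).toLinearMap ∘ₗ CliffordAlgebra.contractLeft ∘ₗ diagForm c,
    fun w => by
      apply MulOpposite.unop_injective
      exact LinearMap.ext fun a => ctr_ctr c w a⟩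

/-- The form on the exterior algebra induced by the diagonal form. -/
def extForm : LinearMap.BilinForm ℂ (Ext J) :=
  LinearMap.mk₂ ℂ (fun a b => algebraMapInv ((ctrHom c a).unop b))
    (fun _ _ _ => by simp) (fun _ _ _ => by simp) (fun _ _ _ => by simp) (fun _ _ _ => by simp)

theorem extForm_apply (a b : Ext J) : extForm c a b = algebraMapInv ((ctrHom c a).unop b) := rfl

theorem extForm_ι_mul (w : J → ℂ) (a b : Ext J) :
    extForm c (ι ℂ w * a) b = extForm c a (ctr c w b) := by
  rw [extForm_apply, extForm_apply, map_mul, ctrHom, ExteriorAlgebra.lift_ι_apply]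
  rfl

theorem extForm_one (b : Ext J) : extForm c 1 b = algebraMapInv b := by
  rw [extForm_apply, map_one]; rfl

theorem extForm_algebraMap (r : ℂ) (b : Ext J) :
    extForm c (algebraMap ℂ _ r) b = r * algebraMapInv b := by
  rw [Algebra.algebraMap_eq_smul_one, map_smul, LinearMap.smul_apply, extForm_one, smul_eq_mul]

theorem algebraMapInv_ι_mul (w : J → ℂ) (a : Ext J) :
    algebraMapInv (ι ℂ w * a) = 0 := by
  rw [map_mul, algebraMapInv, ExteriorAlgebra.lift_ι_apply, LinearMap.zero_apply, zero_mul]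

/-- Multiplication by a function is adjoint to contraction in the first argument by construction;
induction on that argument gives it in the second, and symmetry of the form follows. -/
theorem extForm_mul_ι (w : J → ℂ) (a b : Ext J) :
    extForm c a (ι ℂ w * b) = extForm c (ctr c w a) b := by
  induction a using ext_induction generalizing b with
  | algebraMap r =>
    rw [extForm_algebraMap, ctr_algebraMap, algebraMapInv_ι_mul, mul_zero, map_zero,
      LinearMap.zero_apply]
  | add x y hx hy => rw [map_add, map_add, map_add, LinearMap.add_apply, LinearMap.add_apply, hx, hy]
  | ι_mul x v hx =>
    rw [extForm_ι_mul, ctr_ι_mul, ctr_ι_mul, map_sub, map_sub, LinearMap.sub_apply, extForm_ι_mul,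
      hx, map_smul, map_smul, LinearMap.smul_apply, diagForm_comm]

theorem extForm_comm (a b : Ext J) : extForm c a b = extForm c b a := by
  induction a using ext_induction generalizing b with
  | algebraMap r =>
    induction b using ext_induction with
    | algebraMap s =>
      rw [extForm_algebraMap, extForm_algebraMap, AlgHom.commutes, AlgHom.commutes]
      exact mul_comm _ _
    | add x y hx hy => rw [map_add, map_add, LinearMap.add_apply, hx, hy]
    | ι_mul x v hx =>
      rw [extForm_mul_ι, extForm_ι_mul, ctr_algebraMap, map_zero, map_zero, LinearMap.zero_apply]
  | add x y hx hy => rw [map_add, map_add, LinearMap.add_apply, hx, hy]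
  | ι_mul x v hx =>
    rw [extForm_ι_mul, extForm_mul_ι, hx]

/-- An element on which contractions act as derivations up to the sign `s`, and which commutes with
functions up to the same sign. -/
structure HasParity (s : ℂ) (a : Ext J) : Prop where
  ctr_mul : ∀ (c w : J → ℂ) (b : Ext J), ctr c w (a * b) = ctr c w a * b + s • (a * ctr c w b)
  mul_ι : ∀ w : J → ℂ, a * ι ℂ w = s • (ι ℂ w * a)

theorem HasParity.ι (w : J → ℂ) : HasParity (-1) (ι ℂ w) where
  ctr_mul c w' b := by
    have h := ctr_ι_mul c w' w 1
    have h1 : ctr c w' 1 = 0 := by simpa using ctr_algebraMap c w' 1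
    rw [mul_one, h1, mul_zero, sub_zero] at h
    rw [ctr_ι_mul, h, smul_mul_assoc, one_mul, neg_one_smul, sub_eq_add_neg]
  mul_ι w' := by
    rw [neg_one_smul]
    exact eq_neg_of_add_eq_zero_left (ExteriorAlgebra.ι_add_mul_swap w w')

theorem HasParity.one : HasParity 1 (1 : Ext J) where
  ctr_mul c w b := by
    have h1 : ctr c w 1 = 0 := by simpa using ctr_algebraMap c w 1
    rw [h1, one_mul, one_mul, zero_mul, zero_add, one_smul]
  mul_ι w := by simp

theorem HasParity.mul {s t : ℂ} {a b : Ext J} (ha : HasParity s a) (hb : HasParity t b) :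
    HasParity (s * t) (a * b) where
  ctr_mul c w d := by
    rw [mul_assoc, ha.ctr_mul, hb.ctr_mul, ha.ctr_mul, mul_add, smul_add, add_mul,
      smul_mul_assoc, mul_smul_comm, smul_smul, mul_assoc, mul_assoc, mul_assoc, add_assoc]
  mul_ι w := by
    rw [mul_assoc, hb.mul_ι, mul_smul_comm, ← mul_assoc, ha.mul_ι, smul_mul_assoc, smul_smul,
      mul_assoc, mul_comm s]

theorem HasParity.prod (l : List (J → ℂ)) :
    HasParity ((-1) ^ l.length) (l.map (ExteriorAlgebra.ι ℂ)).prod := by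
  induction l with
  | nil => simpa using HasParity.one
  | cons w l ih => simpa [pow_succ'] using (HasParity.ι w).mul ih

theorem HasParity.mul_prod {s : ℂ} {a : Ext J} (ha : HasParity s a) (l : List (J → ℂ)) :
    a * (l.map (ExteriorAlgebra.ι ℂ)).prod =
      s ^ l.length • ((l.map (ExteriorAlgebra.ι ℂ)).prod * a) := by
  induction l with
  | nil => simp
  | cons w l ih =>
    rw [List.map_cons, List.prod_cons, ← mul_assoc, ha.mul_ι, smul_mul_assoc, mul_assoc, ih,
      mul_smul_comm, smul_smul, List.length_cons, pow_succ', mul_assoc]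

/-- The restriction of functions to a subset. -/
def restrict (S : Set J) : (J → ℂ) →ₗ[ℂ] (J → ℂ) :=
  open Classical in LinearMap.pi fun j => if j ∈ S then LinearMap.proj j else 0

theorem restrict_apply_of_mem {S : Set J} {j : J} (hj : j ∈ S) (w : J → ℂ) :
    restrict S w j = w j := by
  simp [restrict, hj]

theorem restrict_apply_of_notMem {S : Set J} {j : J} (hj : j ∉ S) (w : J → ℂ) :
    restrict S w j = 0 := by
  simp [restrict, hj]

theorem restrict_eq_self {S : Set J} {w : J → ℂ} (h : ∀ j ∉ S, w j = 0) : restrict S w = w := by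
  ext j
  by_cases hj : j ∈ S
  · exact restrict_apply_of_mem hj w
  · rw [restrict_apply_of_notMem hj, h j hj]

theorem restrict_eq_zero {S : Set J} {w : J → ℂ} (h : ∀ j ∈ S, w j = 0) : restrict S w = 0 := by
  ext j
  by_cases hj : j ∈ S
  · rw [restrict_apply_of_mem hj, h j hj]; rfl
  · exact restrict_apply_of_notMem hj w

theorem diagForm_restrict (S : Set J) (w w' : J → ℂ) :
    diagForm c (restrict S w) w' = diagForm c w (restrict S w') := by
  refine sum_congr rfl fun j _ => ?_
  by_cases hj : j ∈ S
  · rw [restrict_apply_of_mem hj, restrict_apply_of_mem hj]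
  · rw [restrict_apply_of_notMem hj, restrict_apply_of_notMem hj, mul_zero, mul_zero, zero_mul]

theorem ctr_map_restrict (S : Set J) (w : J → ℂ) (a : Ext J) :
    ctr c w (map (restrict S) a) = map (restrict S) (ctr c (restrict S w) a) := by
  induction a using ext_induction with
  | algebraMap r =>
    rw [AlgHom.commutes, ctr_algebraMap, ctr_algebraMap, map_zero]
  | add x y hx hy => simp only [map_add, hx, hy]
  | ι_mul x v hx =>
    rw [map_mul, map_apply_ι, ctr_ι_mul, ctr_ι_mul, map_sub, map_mul, map_apply_ι, map_smul, hx,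
      diagForm_restrict]

theorem extForm_map_restrict (S : Set J) (a b : Ext J) :
    extForm c (map (restrict S) a) b = extForm c a (map (restrict S) b) := by
  induction a using ext_induction generalizing b with
  | algebraMap r =>
    rw [AlgHom.commutes, extForm_algebraMap, extForm_algebraMap]
    congr 1
    have h : (algebraMapInv : Ext J →ₐ[ℂ] ℂ).comp (map (restrict S)) = algebraMapInv := by
      ext w
      simp [algebraMapInv]
    exact (AlgHom.congr_fun h b).symm
  | add x y hx hy => simp only [map_add, LinearMap.add_apply, hx, hy]
  | ι_mul x v hx =>
    rw [map_mul, map_apply_ι, extForm_ι_mul, extForm_ι_mul, ctr_map_restrict, hx]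

theorem ctr_map_of_disjoint {S S' : Set J} (h : Disjoint S S') (w : J → ℂ) (a : Ext J) :
    ctr c (restrict S w) (map (restrict S') a) = 0 := by
  rw [ctr_map_restrict]
  have h0 : restrict S' (restrict S w) = 0 :=
    restrict_eq_zero fun j hj => restrict_apply_of_notMem (Set.disjoint_right.1 h hj) w
  rw [h0]
  change map _ (CliffordAlgebra.contractLeft (diagForm c 0) a) = 0
  rw [map_zero, map_zero, LinearMap.zero_apply, map_zero]

/-- The second term of the Leibniz rule drops out, so no parity of `a` is needed. -/
theorem ctr_mul_of_ctr_eq_zero {w : J → ℂ} (a : Ext J) {b : Ext J} (hb : ctr c w b = 0) :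
    ctr c w (a * b) = ctr c w a * b := by
  induction a using ext_induction with
  | algebraMap r =>
    rw [ctr_algebraMap, zero_mul, ← Algebra.smul_def, map_smul, hb, smul_zero]
  | add x y hx hy => rw [add_mul, map_add, map_add, add_mul, hx, hy]
  | ι_mul x v hx =>
    rw [mul_assoc, ctr_ι_mul, ctr_ι_mul, hx, sub_mul, smul_mul_assoc, mul_assoc]

/-- The form is multiplicative on products of elements with disjoint supports. -/
theorem extForm_mul_mul {S S' : Set J} (h : Disjoint S S') (a b d e : Ext J) :
    extForm c (map (restrict S) a * map (restrict S') b)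
      (map (restrict S) d * map (restrict S') e) =
    extForm c (map (restrict S) a) (map (restrict S) d) *
      extForm c (map (restrict S') b) (map (restrict S') e) := by
  induction a using ext_induction generalizing d with
  | algebraMap r =>
    induction d using ext_induction with
    | algebraMap s =>
      rw [AlgHom.commutes, AlgHom.commutes, ← Algebra.smul_def, ← Algebra.smul_def, map_smul,
        map_smul, LinearMap.smul_apply, extForm_algebraMap, AlgHom.commutes]
      simp only [smul_eq_mul, Algebra.algebraMap_self, RingHom.id_apply]
      ring
    | add x y hx hy => simp only [map_add, add_mul, hx, hy]
    | ι_mul x v hx =>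
      rw [map_mul (ExteriorAlgebra.map _) _ x, map_apply_ι, mul_assoc, extForm_mul_ι, extForm_mul_ι, AlgHom.commutes,
        ctr_mul_of_ctr_eq_zero _ _ (ctr_map_of_disjoint c h v b), ctr_algebraMap]
      simp only [zero_mul, map_zero, LinearMap.zero_apply]
  | add x y hx hy => simp only [map_add, add_mul, LinearMap.add_apply, hx, hy]
  | ι_mul x v hx =>
    rw [map_mul (ExteriorAlgebra.map _) _ x, map_apply_ι, mul_assoc, extForm_ι_mul, extForm_ι_mul,
      ctr_mul_of_ctr_eq_zero _ _ (ctr_map_of_disjoint c h v e), ctr_map_restrict, hx]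

theorem ctr_ιMulti (v : J → ℂ) {n : ℕ} (w : Fin (n + 1) → J → ℂ) :
    ctr c v (ιMulti ℂ (n + 1) w) =
      ∑ i : Fin (n + 1), ((-1) ^ (i : ℕ) * diagForm c v (w i)) • ιMulti ℂ n (w ∘ i.succAbove) := by
  induction n with
  | zero =>
    rw [ιMulti_succ_apply, ctr_ι_mul, ιMulti_zero_apply, Fin.sum_univ_one, ιMulti_zero_apply]
    have h1 : ctr c v 1 = 0 := by simpa using ctr_algebraMap c v 1
    rw [h1]; simp
  | succ n ih =>
    rw [ιMulti_succ_apply, ctr_ι_mul, ih]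
    conv_rhs => rw [Fin.sum_univ_succ]
    rw [sub_eq_add_neg]
    congr 1
    · simp [Matrix.vecTail, Function.comp_def]
    · rw [mul_sum, ← sum_neg_distrib]
      refine sum_congr rfl fun i _ => ?_
      rw [ιMulti_succ_apply, mul_smul_comm, ← neg_smul]
      congr 1
      · rw [Fin.val_succ, pow_succ]; simp [Matrix.vecTail]
      · congr 2
        ext j
        simp [Matrix.vecTail]

/-- Contraction by the first factor is the Laplace expansion of the Gram determinant along its first
row. -/
theorem extForm_ιMulti {n : ℕ} (w w' : Fin n → J → ℂ) :
    extForm c (ιMulti ℂ n w) (ιMulti ℂ n w') =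
      (Matrix.of fun i j => diagForm c (w i) (w' j)).det := by
  induction n with
  | zero => simp [extForm_one]
  | succ n ih =>
    rw [ιMulti_succ_apply, extForm_ι_mul, ctr_ιMulti, map_sum, Matrix.det_succ_row_zero]
    refine sum_congr rfl fun i _ => ?_
    rw [map_smul, ih, smul_eq_mul]
    rfl

end Exterior

/-! ### Dependence of the cobracket on its coefficients -/

section TreePair

theorem treePair_add {α : Type*} (b b' : α → α → ℂ) (x y : FreeMagma α) :
    treePair (fun p q => b p q + b' p q) x y = treePair b x y + treePair b' x y := by
  simp only [treePair, List.sum_map_add]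

theorem treePair_mul_left {α : Type*} (c : ℂ) (b : α → α → ℂ) (x y : FreeMagma α) :
    treePair (fun p q => c * b p q) x y = c * treePair b x y := by
  simp only [treePair, List.sum_map_mul_left]

theorem treePair_sum {α ι : Type*} (S : Finset ι) (b : ι → α → α → ℂ) (x y : FreeMagma α) :
    treePair (fun p q => ∑ i ∈ S, b i p q) x y = ∑ i ∈ S, treePair (b i) x y := by
  classical
  induction S using Finset.induction_on with
  | empty => simp [treePair]
  | insert i S hi ih => simp only [sum_insert hi, treePair_add, ih]

theorem treePair_split_left {α : Type*} (b : α → α → ℂ) {s t x : FreeMagma α} (y : FreeMagma α)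
    (h : (leaves s ++ leaves t).Perm (leaves x)) :
    treePair b x y = treePair b s y + treePair b t y := by
  rw [treePair, ← (h.map _).sum_eq, List.map_append, List.sum_append]; rfl

theorem treePair_eq_zero {α : Type*} {b : α → α → ℂ} {x y : FreeMagma α}
    (h : ∀ p ∈ leaves x, ∀ q ∈ leaves y, b p q = 0) : treePair b x y = 0 := by
  refine List.sum_eq_zero fun a ha => ?_
  obtain ⟨p, hp, rfl⟩ := List.mem_map.1 ha
  refine List.sum_eq_zero fun a ha => ?_
  obtain ⟨q, hq, rfl⟩ := List.mem_map.1 ha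
  exact h p hp q hq

variable {α V : Type*} [AddCommGroup V] [Module ℂ V]

theorem cobSum_coeff_sub (b b' : α → α → ℂ) (g : FreeMagma α) (Φ : FreeMagma α → FreeMagma α → V) :
    cobSum (fun p q => b p q - b' p q) g Φ = cobSum b g Φ - cobSum b' g Φ := by
  induction g generalizing Φ with
  | ih1 a => exact (sub_zero _).symm
  | ih2 x y hx hy =>
    have h : treePair (fun p q => b p q - b' p q) x y = treePair b x y - treePair b' x y := by
      have := treePair_add (fun p q => b p q - b' p q) b' x y
      simp only [sub_add_cancel] at this
      exact eq_sub_of_add_eq this.symm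
    rw [cobSum_mul, cobSum_mul, cobSum_mul, hx, hy, h, sub_smul]
    abel

theorem leaves_ne_nil (u : FreeMagma α) : leaves u ≠ [] :=
  List.ne_nil_of_length_pos (leaves_length_pos u)

/-- A splitting s ⊗ t only receives coefficients between a leaf of s and a leaf of t. Both orders of
the pair are needed because each splitting also occurs flipped. -/
theorem cobSum_eq_zero_of_coeff {b : α → α → ℂ} (g : FreeMagma α)
    {Φ : FreeMagma α → FreeMagma α → V}
    (h : ∀ s t, (leaves s ++ leaves t).Perm (leaves g) → ∀ p ∈ leaves s, ∀ q ∈ leaves t,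
      b p q ≠ 0 ∨ b q p ≠ 0 → Φ s t = 0) : cobSum b g Φ = 0 := by
  induction g generalizing Φ with
  | ih1 a => rfl
  | ih2 x y hx hy =>
    rw [cobSum_mul, hx, hy, add_zero, add_zero]
    · by_cases hb : ∀ p ∈ leaves x, ∀ q ∈ leaves y, b p q = 0
      · rw [treePair_eq_zero hb, zero_smul]
      · push Not at hb
        obtain ⟨p, hp, q, hq, hpq⟩ := hb
        rw [h x y (.refl _) p hp q hq (.inl hpq),
          h y x List.perm_append_comm q hq p hp (.inr hpq), sub_zero, smul_zero]
    · intro s t hst p hp q hq hpq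
      rw [h (x * s) t _ p (List.mem_append_right _ hp) q hq hpq,
        h s (x * t) _ p hp q (List.mem_append_right _ hq) hpq, add_zero]
      · rw [leaves_mul, leaves_mul, ← List.append_assoc]
        refine (List.Perm.append_right _ List.perm_append_comm).trans ?_
        rw [List.append_assoc]; exact hst.append_left _
      · rw [leaves_mul, leaves_mul, List.append_assoc]; exact hst.append_left _
    · intro s t hst p hp q hq hpq
      rw [h (s * y) t _ p (List.mem_append_left _ hp) q hq hpq,
        h s (t * y) _ p hp q (List.mem_append_left _ hq) hpq, add_zero]
      · rw [leaves_mul, leaves_mul, ← List.append_assoc]; exact hst.append_right _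
      · rw [leaves_mul, leaves_mul, List.append_assoc]
        refine (List.Perm.append_left _ List.perm_append_comm).trans ?_
        rw [← List.append_assoc]; exact hst.append_right _

theorem cobSum_congr_of_coeff {b b' : α → α → ℂ} (g : FreeMagma α)
    {Φ : FreeMagma α → FreeMagma α → V}
    (h : ∀ s t, (leaves s ++ leaves t).Perm (leaves g) → ∀ p ∈ leaves s, ∀ q ∈ leaves t,
      Φ s t ≠ 0 → b p q = b' p q ∧ b q p = b' q p) : cobSum b g Φ = cobSum b' g Φ := by
  rw [← sub_eq_zero, ← cobSum_coeff_sub]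
  refine cobSum_eq_zero_of_coeff g fun s t hst p hp q hq hpq => ?_
  by_contra hne
  obtain ⟨h1, h2⟩ := h s t hst p hp q hq hne
  rw [h1, h2, sub_self, sub_self] at hpq
  simp at hpq

end TreePair

/-! ### Commutators as elements of the exterior algebra -/

section Evaluation

open ExteriorAlgebra

variable {T m : ℕ} [NeZero T]

/-- The hyperplane `K` is `ω^k t_p = ω^l t_q`, for `a = (k, p)`, `b = (l, q)`. -/
def Joins (a b : ZMod T × Fin m) (K : DiagIndex T m) : Prop :=
  (K.1.1.1 = a.2 ∧ K.1.1.2 = b.2 ∧ K.2 = b.1 - a.1) ∨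
    (K.1.1.1 = b.2 ∧ K.1.1.2 = a.2 ∧ K.2 = a.1 - b.1)

theorem Joins.comm {a b : ZMod T × Fin m} {K : DiagIndex T m} : Joins a b K ↔ Joins b a K := or_comm

open Classical in
/-- The indicator function of the hyperplane that joins two leaves. -/
def edgeVec (a b : ZMod T × Fin m) : DiagIndex T m ⊕ Fin m → ℂ :=
  Sum.elim (fun K => if Joins a b K then 1 else 0) 0

theorem edgeVec_comm (a b : ZMod T × Fin m) : edgeVec a b = edgeVec b a := by
  ext j
  rcases j with K | p
  · have h := Joins.comm (a := a) (b := b) (K := K)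
    by_cases h1 : Joins a b K
    · simp [edgeVec, h1, h.1 h1]
    · simp [edgeVec, h1, mt h.2 h1]
  · rfl

/-- The sum of the hyperplanes that join a leaf of `x` to a leaf of `y`. -/
def crossVec (x y : FreeMagma (ZMod T × Fin m)) : DiagIndex T m ⊕ Fin m → ℂ :=
  fun j => treePair (fun a b => edgeVec a b j) x y

theorem crossVec_inr (x y : FreeMagma (ZMod T × Fin m)) (p : Fin m) : crossVec x y (.inr p) = 0 :=
  treePair_eq_zero fun _ _ _ _ => rfl

theorem crossVec_comm (x y : FreeMagma (ZMod T × Fin m)) : crossVec x y = crossVec y x := by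
  ext j
  exact treePair_comm (fun p q => by rw [edgeVec_comm]) x y

theorem crossVec_split_left {s t x : FreeMagma (ZMod T × Fin m)} (y : FreeMagma (ZMod T × Fin m))
    (h : (leaves s ++ leaves t).Perm (leaves x)) :
    crossVec x y = crossVec s y + crossVec t y := by
  ext j
  exact treePair_split_left _ y h

theorem diagForm_crossVec (c w : DiagIndex T m ⊕ Fin m → ℂ) (x y : FreeMagma (ZMod T × Fin m)) :
    diagForm c w (crossVec x y) = treePair (fun a b => diagForm c w (edgeVec a b)) x y := by
  simp only [diagForm_apply, crossVec, treePair_sum, treePair_mul_left]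

/-- The coordinate function of an index. -/
def indexVec (p : Fin m) : DiagIndex T m ⊕ Fin m → ℂ := Pi.single (.inr p) 1

/-- The element of the exterior algebra attached to a bracketing. -/
def ev : FreeMagma (ZMod T × Fin m) → Ext (DiagIndex T m ⊕ Fin m)
  | .of a => ι ℂ (indexVec a.2)
  | .mul x y => ι ℂ (crossVec x y) * (ev x * ev y)

theorem ev_of (a : ZMod T × Fin m) : ev (.of a) = ι ℂ (indexVec a.2) := rfl

theorem ev_mul (x y : FreeMagma (ZMod T × Fin m)) :
    ev (x * y) = ι ℂ (crossVec x y) * (ev x * ev y) := rfl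

theorem hasParity_ev (g : FreeMagma (ZMod T × Fin m)) : HasParity (-1) (ev g) := by
  induction g with
  | ih1 a => exact HasParity.ι _
  | ih2 x y hx hy => rw [ev_mul]; simpa using (HasParity.ι (crossVec x y)).mul (hx.mul hy)

theorem ev_mul_ι (x : FreeMagma (ZMod T × Fin m)) (w : DiagIndex T m ⊕ Fin m → ℂ) :
    ev x * ι ℂ w = -(ι ℂ w * ev x) := by
  rw [(hasParity_ev x).mul_ι, neg_one_smul]

/-- A bracketing with n leaves has degree 2n - 1, which is odd. -/
theorem ev_anticomm (x y : FreeMagma (ZMod T × Fin m)) : ev x * ev y = -(ev y * ev x) := by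
  induction y with
  | ih1 a => exact ev_mul_ι x _
  | ih2 s t hs ht =>
    rw [ev_mul, ← mul_assoc, ev_mul_ι, neg_mul, mul_assoc, ← mul_assoc (ev x), hs, neg_mul, mul_neg,
      mul_assoc (ev s), ht, mul_neg, mul_neg, mul_assoc, mul_assoc, neg_neg]

theorem diagForm_indexVec (c w : DiagIndex T m ⊕ Fin m → ℂ) (p : Fin m) :
    diagForm c w (indexVec p) = c (.inr p) * w (.inr p) := by
  rw [diagForm_apply, Finset.sum_eq_single (.inr p)]
  · simp [indexVec]
  · intro j _ hj
    simp [indexVec, hj]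
  · simp

/-- Contracting the factor c(x, y) splits [x, y] into x and y with the coefficient of the cobracket.
Contracting inside x splits x into s and t; then c(x, y) = c(s, y) + c(t, y) distributes the join
with y over the two pieces, which is the Leibniz rule of the cobracket. The 2 arises since s ⊗ t - t
⊗ s becomes 2 ev(s) ev(t). Leaves contribute nothing, because w vanishes on the coordinates. -/
theorem ctr_ev (c : DiagIndex T m ⊕ Fin m → ℂ) {w : DiagIndex T m ⊕ Fin m → ℂ}
    (hw : ∀ p, w (.inr p) = 0) (g : FreeMagma (ZMod T × Fin m)) :
    (2 : ℂ) • ctr c w (ev g) =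
      cobSum (fun a b => diagForm c w (edgeVec a b)) g fun s t => ev s * ev t := by
  induction g with
  | ih1 a =>
    have h := ctr_ι_mul c w (indexVec a.2) 1
    have h1 : ctr c w 1 = 0 := by simpa using ctr_algebraMap c w 1
    rw [mul_one, h1, diagForm_indexVec, hw, mul_zero, mul_zero, zero_smul, sub_zero] at h
    rw [cobSum_of, ev_of, h, smul_zero]
  | ih2 x y hx hy =>
    -- Left multiplication by c(x, y) and right multiplication by ev(y) are linear, so they can be
    -- taken inside the cobracket of x; the sign comes from moving odd elements past each other.
    have e1 : (cobSum (fun a b => diagForm c w (edgeVec a b)) x fun s t =>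
        ev (s * y) * ev t + ev s * ev (t * y)) =
        -(ι ℂ (crossVec x y) * (((2 : ℂ) • ctr c w (ev x)) * ev y)) := by
      rw [hx]
      have := map_cobSum (-(LinearMap.mulLeft ℂ (ι ℂ (crossVec x y)) ∘ₗ LinearMap.mulRight ℂ (ev y)))
        (fun a b => diagForm c w (edgeVec a b)) x fun s t => ev s * ev t
      simp only [LinearMap.neg_apply, LinearMap.comp_apply, LinearMap.mulLeft_apply,
        LinearMap.mulRight_apply] at this
      rw [this]
      refine cobSum_congr _ _ fun s t hst => ?_
      rw [crossVec_split_left y hst, ev_mul, ev_mul, map_add, add_mul, mul_assoc, mul_assoc,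
        ev_anticomm y t, ← mul_assoc (ev s), ev_mul_ι, neg_mul, mul_neg, mul_neg, neg_add]
      simp only [mul_assoc]
    have e2 : (cobSum (fun a b => diagForm c w (edgeVec a b)) y fun s t =>
        ev (x * s) * ev t + ev s * ev (x * t)) =
        ι ℂ (crossVec x y) * (ev x * ((2 : ℂ) • ctr c w (ev y))) := by
      rw [hy]
      have := map_cobSum (LinearMap.mulLeft ℂ (ι ℂ (crossVec x y)) ∘ₗ LinearMap.mulLeft ℂ (ev x))
        (fun a b => diagForm c w (edgeVec a b)) y fun s t => ev s * ev t
      simp only [LinearMap.comp_apply, LinearMap.mulLeft_apply] at this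
      rw [this]
      refine cobSum_congr _ _ fun s t hst => ?_
      rw [crossVec_comm x y, crossVec_split_left x hst, ev_mul, ev_mul, map_add, add_mul,
        crossVec_comm x s, crossVec_comm x t]
      congr 1
      · simp only [mul_assoc]
      · rw [← mul_assoc (ev s), ev_mul_ι, neg_mul, mul_assoc, ← mul_assoc (ev s), ev_anticomm s x]
        simp only [neg_mul, mul_neg, neg_neg, mul_assoc]
    rw [cobSum_mul, e1, e2, ev_mul, ctr_ι_mul, (hasParity_ev x).ctr_mul, diagForm_crossVec,
      ev_anticomm y x, sub_neg_eq_add, ← two_smul ℂ (ev x * ev y)]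
    simp only [mul_add, smul_sub, smul_add, smul_mul_assoc, mul_smul_comm, neg_smul, one_smul,
      mul_neg, smul_neg]
    rw [smul_comm]
    abel

end Evaluation

/-! ### Products with disjoint indices and the recursion for the form -/

section Factorization

open ExteriorAlgebra

variable {T m : ℕ} [NeZero T]

/-- The indices at the leaves of a bracketing. -/
def indices (g : FreeMagma (ZMod T × Fin m)) : Set (Fin m) := {p | ∃ a ∈ leaves g, a.2 = p}

theorem indices_of (a : ZMod T × Fin m) : indices (.of a) = {a.2} := by
  ext p; simp [indices, leaves_of, eq_comm]

theorem indices_mul (x y : FreeMagma (ZMod T × Fin m)) :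
    indices (x * y) = indices x ∪ indices y := by
  ext p; simp only [indices, leaves_mul, List.mem_append, Set.mem_union, Set.mem_ofPred_eq]; aesop

theorem indices_nonempty (g : FreeMagma (ZMod T × Fin m)) : (indices g).Nonempty := by
  obtain ⟨a, ha⟩ := List.exists_mem_of_ne_nil _ (leaves_ne_nil g)
  exact ⟨a.2, a, ha, rfl⟩

theorem mem_indices {g : FreeMagma (ZMod T × Fin m)} {a : ZMod T × Fin m} (h : a ∈ leaves g) :
    a.2 ∈ indices g := ⟨a, h, rfl⟩

/-- The hyperplanes and the coordinates with indices in `X`. -/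
def support (T : ℕ) {m : ℕ} (X : Set (Fin m)) : Set (DiagIndex T m ⊕ Fin m) :=
  {j | Sum.elim (fun K => K.1.1.1 ∈ X ∧ K.1.1.2 ∈ X) (· ∈ X) j}

theorem disjoint_support {X Y : Set (Fin m)} (h : Disjoint X Y) :
    Disjoint (support T X) (support T Y) := by
  rw [Set.disjoint_left]
  rintro (K | p) hX hY
  · exact Set.disjoint_left.1 h hX.1 hY.1
  · exact Set.disjoint_left.1 h hX hY

theorem support_empty : support T (∅ : Set (Fin m)) = ∅ := by
  ext j; rcases j with K | p <;> simp [support]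

theorem joins_mem {a b : ZMod T × Fin m} {K : DiagIndex T m} (h : Joins a b K) :
    (K.1.1.1 = a.2 ∧ K.1.1.2 = b.2) ∨ (K.1.1.1 = b.2 ∧ K.1.1.2 = a.2) := by
  rcases h with ⟨h1, h2, -⟩ | ⟨h1, h2, -⟩
  · exact .inl ⟨h1, h2⟩
  · exact .inr ⟨h1, h2⟩

theorem edgeVec_ne_zero {a b : ZMod T × Fin m} {j : DiagIndex T m ⊕ Fin m} (h : edgeVec a b j ≠ 0) :
    ∃ K, j = .inl K ∧ Joins a b K := by
  rcases j with K | p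
  · refine ⟨K, rfl, ?_⟩
    by_contra hK
    exact h (by simp [edgeVec, hK])
  · exact absurd rfl h

theorem restrict_crossVec_of_subset {X Y : Set (Fin m)} {x y : FreeMagma (ZMod T × Fin m)}
    (hx : indices x ⊆ X) (hy : indices y ⊆ X) :
    restrict (support T X ∪ support T Y) (crossVec x y) = crossVec x y := by
  refine restrict_eq_self fun j hj => treePair_eq_zero fun a ha b hb => ?_
  by_contra h
  obtain ⟨K, rfl, hK⟩ := edgeVec_ne_zero h
  refine hj (.inl ?_)
  rcases joins_mem hK with ⟨h1, h2⟩ | ⟨h1, h2⟩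
  · exact ⟨h1 ▸ hx (mem_indices ha), h2 ▸ hy (mem_indices hb)⟩
  · exact ⟨h1 ▸ hy (mem_indices hb), h2 ▸ hx (mem_indices ha)⟩

theorem restrict_crossVec_of_disjoint {X Y : Set (Fin m)} (h : Disjoint X Y)
    {x y : FreeMagma (ZMod T × Fin m)} (hx : indices x ⊆ X) (hy : indices y ⊆ Y) :
    restrict (support T X ∪ support T Y) (crossVec x y) = 0 := by
  refine restrict_eq_zero fun j hj => treePair_eq_zero fun a ha b hb => ?_
  by_contra h0
  obtain ⟨K, rfl, hK⟩ := edgeVec_ne_zero h0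
  have h1 := hx (mem_indices ha)
  have h2 := hy (mem_indices hb)
  rw [Set.disjoint_left] at h
  rcases joins_mem hK with ⟨h3, h4⟩ | ⟨h3, h4⟩ <;> rcases hj with hj | hj
  · exact h hj.2 (h4 ▸ h2)
  · exact h (h3 ▸ h1) hj.1
  · exact h hj.1 (h3 ▸ h2)
  · exact h (h4 ▸ h1) hj.2

theorem map_restrict_ev_of_subset {X : Set (Fin m)} (Y : Set (Fin m))
    {g : FreeMagma (ZMod T × Fin m)} (h : indices g ⊆ X) :
    map (restrict (support T X ∪ support T Y)) (ev g) = ev g := by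
  induction g with
  | ih1 a =>
    rw [ev_of, map_apply_ι]
    congr 1
    refine restrict_eq_self fun j hj => ?_
    rw [indexVec, Pi.single_apply, if_neg]
    rintro rfl
    exact hj (.inl (h (mem_indices (List.mem_singleton_self a))))
  | ih2 x y hx hy =>
    rw [indices_mul, Set.union_subset_iff] at h
    rw [ev_mul, map_mul (ExteriorAlgebra.map _), map_mul (ExteriorAlgebra.map _), map_apply_ι,
      hx h.1, hy h.2, restrict_crossVec_of_subset h.1 h.2]

theorem map_restrict_ev_of_subset_right (X : Set (Fin m)) {Y : Set (Fin m)}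
    {g : FreeMagma (ZMod T × Fin m)} (h : indices g ⊆ Y) :
    map (restrict (support T X ∪ support T Y)) (ev g) = ev g := by
  rw [Set.union_comm, map_restrict_ev_of_subset X h]

theorem map_restrict_ev_eq_self {X : Set (Fin m)} {g : FreeMagma (ZMod T × Fin m)}
    (h : indices g ⊆ X) : map (restrict (support T X)) (ev g) = ev g := by
  simpa [support_empty] using map_restrict_ev_of_subset ∅ h

/-- Either a leaf lies outside X ∪ Y, or some join takes place between a part inside X and a part
inside Y; no hyperplane of that join has both indices in X or both in Y. -/
theorem map_restrict_ev_eq_zero {X Y : Set (Fin m)} (hd : Disjoint X Y)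
    {g : FreeMagma (ZMod T × Fin m)} (hX : ¬ indices g ⊆ X) (hY : ¬ indices g ⊆ Y) :
    map (restrict (support T X ∪ support T Y)) (ev g) = 0 := by
  induction g with
  | ih1 a =>
    rw [ev_of, map_apply_ι, indexVec]
    have h0 : restrict (support T X ∪ support T Y) (Pi.single (.inr a.2) 1) = 0 := by
      refine restrict_eq_zero fun j hj => ?_
      rw [Pi.single_apply, if_neg]
      rintro rfl
      rw [indices_of, Set.singleton_subset_iff] at hX hY
      exact hj.elim hX hY
    rw [h0, map_zero]
  | ih2 x y hx hy =>
    rw [ev_mul, map_mul (ExteriorAlgebra.map _), map_mul (ExteriorAlgebra.map _), map_apply_ι]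
    by_cases h1 : ¬ indices x ⊆ X ∧ ¬ indices x ⊆ Y
    · rw [hx h1.1 h1.2, zero_mul, mul_zero]
    by_cases h2 : ¬ indices y ⊆ X ∧ ¬ indices y ⊆ Y
    · rw [hy h2.1 h2.2, mul_zero, mul_zero]
    rw [indices_mul, Set.union_subset_iff] at hX hY
    have h0 : restrict (support T X ∪ support T Y) (crossVec x y) = 0 := by
      by_cases hxX : indices x ⊆ X
      · by_cases hyX : indices y ⊆ X
        · exact absurd ⟨hxX, hyX⟩ hX
        · exact restrict_crossVec_of_disjoint hd hxX (by tauto)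
      · have hxY : indices x ⊆ Y := by tauto
        rw [crossVec_comm]
        exact restrict_crossVec_of_disjoint hd (by tauto) hxY
    rw [h0, map_zero, zero_mul]

variable (c : DiagIndex T m ⊕ Fin m → ℂ)

/-- ev(x) is supported on the indices of x, so by adjointness ev(g) may be restricted to that
support, where it vanishes. -/
theorem extForm_ev_eq_zero {x g : FreeMagma (ZMod T × Fin m)} (h : ¬ indices g ⊆ indices x) :
    extForm c (ev x) (ev g) = 0 := by
  have h0 : ¬ indices g ⊆ ∅ := fun h0 => (indices_nonempty g).ne_empty (Set.subset_empty_iff.1 h0)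
  rw [← map_restrict_ev_of_subset ∅ (subset_refl (indices x)), extForm_map_restrict,
    map_restrict_ev_eq_zero (Set.disjoint_empty _) h h0, map_zero]

theorem indices_eq_of_extForm_ne_zero {x g : FreeMagma (ZMod T × Fin m)}
    (h : extForm c (ev x) (ev g) ≠ 0) : indices g = indices x := by
  refine subset_antisymm ?_ ?_
  · by_contra h0
    exact h (extForm_ev_eq_zero c h0)
  · by_contra h0
    exact h ((extForm_comm c _ _).trans (extForm_ev_eq_zero c h0))

theorem algebraMapInv_ev (g : FreeMagma (ZMod T × Fin m)) : algebraMapInv (ev g) = 0 := by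
  induction g with
  | ih1 a => rw [ev_of, ← mul_one (ι ℂ _), algebraMapInv_ι_mul]
  | ih2 x y _ _ => rw [ev_mul, algebraMapInv_ι_mul]

theorem extForm_ev_mul_ev_of_subset {x y g₁ g₂ : FreeMagma (ZMod T × Fin m)}
    (hd : Disjoint (indices x) (indices y)) (h₁ : indices g₁ ⊆ indices x)
    (h₂ : indices g₂ ⊆ indices y) :
    extForm c (ev x * ev y) (ev g₁ * ev g₂) =
      extForm c (ev x) (ev g₁) * extForm c (ev y) (ev g₂) := by
  have h := extForm_mul_mul c (disjoint_support (T := T) hd) (ev x) (ev y) (ev g₁) (ev g₂)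
  rwa [map_restrict_ev_eq_self subset_rfl, map_restrict_ev_eq_self subset_rfl,
    map_restrict_ev_eq_self h₁, map_restrict_ev_eq_self h₂] at h

theorem extForm_ev_mul_ev_of_subset_left {x y g₁ g₂ : FreeMagma (ZMod T × Fin m)}
    (hd : Disjoint (indices x) (indices y)) (h₁ : indices g₁ ⊆ indices x)
    (h₂ : indices g₂ ⊆ indices x) : extForm c (ev x * ev y) (ev g₁ * ev g₂) = 0 := by
  have h := extForm_mul_mul c (disjoint_support (T := T) hd) (ev x) (ev y) (ev g₁ * ev g₂) 1
  rwa [map_mul (ExteriorAlgebra.map _) (ev g₁), map_restrict_ev_eq_self subset_rfl,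
    map_restrict_ev_eq_self subset_rfl, map_restrict_ev_eq_self h₁, map_restrict_ev_eq_self h₂,
    map_one, mul_one, extForm_comm c (ev y), extForm_one, algebraMapInv_ev, mul_zero] at h

/-- The form on products of two bracketings with disjoint indices. -/
theorem extForm_ev_mul_ev {x y : FreeMagma (ZMod T × Fin m)}
    (hd : Disjoint (indices x) (indices y)) (g₁ g₂ : FreeMagma (ZMod T × Fin m)) :
    extForm c (ev x * ev y) (ev g₁ * ev g₂) =
      extForm c (ev x) (ev g₁) * extForm c (ev y) (ev g₂) -
        extForm c (ev x) (ev g₂) * extForm c (ev y) (ev g₁) := by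
  have hx0 : ∀ {g : FreeMagma (ZMod T × Fin m)}, indices g ⊆ indices y →
      extForm c (ev x) (ev g) = 0 := fun {g} h => extForm_ev_eq_zero c fun h' =>
    (indices_nonempty g).ne_empty (disjoint_self.1 (hd.mono h' h))
  have hy0 : ∀ {g : FreeMagma (ZMod T × Fin m)}, indices g ⊆ indices x →
      extForm c (ev y) (ev g) = 0 := fun {g} h => extForm_ev_eq_zero c fun h' =>
    (indices_nonempty g).ne_empty (disjoint_self.1 (hd.mono h h'))
  have hQ : extForm c (ev x * ev y) (ev g₁ * ev g₂) = extForm c (ev x * ev y)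
      (map (restrict (support T (indices x) ∪ support T (indices y))) (ev g₁) *
        map (restrict (support T (indices x) ∪ support T (indices y))) (ev g₂)) := by
    rw [← map_mul (ExteriorAlgebra.map _), ← extForm_map_restrict, map_mul (ExteriorAlgebra.map _),
      map_restrict_ev_of_subset _ subset_rfl, map_restrict_ev_of_subset_right _ subset_rfl]
  by_cases h₁ : ¬ indices g₁ ⊆ indices x ∧ ¬ indices g₁ ⊆ indices y
  · rw [hQ, map_restrict_ev_eq_zero hd h₁.1 h₁.2, extForm_ev_eq_zero c h₁.1,
      extForm_ev_eq_zero c h₁.2]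
    simp
  by_cases h₂ : ¬ indices g₂ ⊆ indices x ∧ ¬ indices g₂ ⊆ indices y
  · rw [hQ, map_restrict_ev_eq_zero hd h₂.1 h₂.2, extForm_ev_eq_zero c h₂.1,
      extForm_ev_eq_zero c h₂.2]
    simp
  by_cases hx₁ : indices g₁ ⊆ indices x
  · by_cases hx₂ : indices g₂ ⊆ indices x
    · rw [extForm_ev_mul_ev_of_subset_left c hd hx₁ hx₂, hy0 hx₁, hy0 hx₂]; simp
    · have hy₂ : indices g₂ ⊆ indices y := by tauto
      rw [extForm_ev_mul_ev_of_subset c hd hx₁ hy₂, hy0 hx₁, mul_zero, sub_zero]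
  · have hy₁ : indices g₁ ⊆ indices y := by tauto
    by_cases hx₂ : indices g₂ ⊆ indices x
    · rw [ev_anticomm g₁, map_neg, extForm_ev_mul_ev_of_subset c hd hx₂ hy₁, hx0 hy₁, zero_mul,
        zero_sub]
    · have hy₂ : indices g₂ ⊆ indices y := by tauto
      rw [ev_anticomm x, map_neg, LinearMap.neg_apply,
        extForm_ev_mul_ev_of_subset_left c hd.symm hy₁ hy₂, hx0 hy₁, hx0 hy₂]; simp

/-- Pairing with a bracket is given by the cobracket. -/
theorem extForm_ev_bracket {x y : FreeMagma (ZMod T × Fin m)}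
    (hd : Disjoint (indices x) (indices y)) (g : FreeMagma (ZMod T × Fin m)) :
    extForm c (ev (x * y)) (ev g) =
      cobSum (fun a b => diagForm c (crossVec x y) (edgeVec a b)) g
        fun s t => extForm c (ev x) (ev s) * extForm c (ev y) (ev t) := by
  -- The factor c(x, y) passes to the other side as a contraction, which `ctr_ev` evaluates. Pairing
  -- ev(x) ev(y) with ev(s) ev(t) gives an antisymmetrized product, so the cobracket yields a second
  -- factor 2 that cancels the first.
  have h := congrArg (extForm c (ev x * ev y)) (ctr_ev c (crossVec_inr x y) g)
  rw [map_smul, map_cobSum] at h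
  simp only [extForm_ev_mul_ev c hd, sub_eq_add_neg, cobSum_add] at h
  simp only [← neg_one_smul ℂ (_ * _), cobSum_smul] at h
  rw [cobSum_flip _ _ fun s t => extForm c (ev x) (ev s) * extForm c (ev y) (ev t), neg_one_smul,
    neg_neg, ← two_smul ℂ] at h
  rw [ev_mul, extForm_ι_mul]
  exact smul_right_injective ℂ (two_ne_zero (α := ℂ)) h

theorem extForm_ev_of_of (a b : ZMod T × Fin m) :
    extForm c (ev (.of a)) (ev (.of b)) = if a.2 = b.2 then c (.inr a.2) else 0 := by
  rw [ev_of, ev_of, ← mul_one (ι ℂ (indexVec a.2)), extForm_ι_mul, extForm_one,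
    ← mul_one (ι ℂ (indexVec b.2)), ctr_ι_mul]
  have h1 : ctr c (indexVec a.2) 1 = 0 := by simpa using ctr_algebraMap c (indexVec a.2) 1
  rw [h1, mul_zero, sub_zero, diagForm_comm, diagForm_indexVec, map_smul, map_one, smul_eq_mul,
    mul_one, indexVec, Pi.single_apply]
  by_cases h : a.2 = b.2 <;> simp [h]

theorem extForm_ev_of_mul (a : ZMod T × Fin m) (x y : FreeMagma (ZMod T × Fin m)) :
    extForm c (ev (.of a)) (ev (x * y)) = 0 := by
  rw [ev_of, ← mul_one (ι ℂ (indexVec a.2)), extForm_ι_mul, extForm_one, ev_mul, ctr_ι_mul,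
    diagForm_comm, diagForm_indexVec, crossVec_inr, mul_zero, zero_smul, zero_sub, map_neg,
    algebraMapInv_ι_mul, neg_zero]

end Factorization

/-! ### The Cauchy-Binet formula -/

section Determinant

/-- The Cauchy-Binet formula, as a sum over all tuples. -/
theorem sum_det_mul_det {n : ℕ} {I : Type*} [Fintype I] (A B : Fin n → I → ℂ) (a : I → ℂ) :
    ∑ H : Fin n → I, (Matrix.of fun i j => A i (H j)).det * (Matrix.of fun i j => B i (H j)).det *
      ∏ j, a (H j) =
    n.factorial * (Matrix.of fun i j => ∑ K, a K * A i K * B j K).det := by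
  classical
  have h1 : ∀ (s : Equiv.Perm (Fin n)) (H : Fin n → I), (Matrix.of fun i j => B i (H (s j))).det =
      ((Equiv.Perm.sign s : ℤ) : ℂ) * (Matrix.of fun i j => B i (H j)).det := fun s H =>
    Matrix.det_permute' s (Matrix.of fun i j => B i (H j))
  have h2 : ∀ s : Equiv.Perm (Fin n), ((Equiv.Perm.sign s : ℤ) : ℂ) *
      ((Equiv.Perm.sign s : ℤ) : ℂ) = 1 := fun s => by
    rw [← Int.cast_mul, ← Units.val_mul, Int.units_mul_self]; simp
  have h3 : ∀ H : Fin n → I, (Matrix.of fun i j => A i (H j)).det =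
      ∑ s : Equiv.Perm (Fin n), ((Equiv.Perm.sign s : ℤ) : ℂ) * ∏ i, A i (H (s i)) := by
    intro H
    rw [← Matrix.det_transpose, Matrix.det_apply']
    rfl
  -- Relabelling the tuple H by s absorbs the sign into the second determinant, so all permutations
  -- contribute equally; this is the factor n!.
  have h4 : ∀ s : Equiv.Perm (Fin n), ∑ H : Fin n → I, ((Equiv.Perm.sign s : ℤ) : ℂ) *
      (∏ i, A i (H (s i))) * (Matrix.of fun i j => B i (H j)).det * ∏ j, a (H j) =
      ∑ H : Fin n → I, (∏ i, A i (H i)) * (Matrix.of fun i j => B i (H j)).det * ∏ j, a (H j) := by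
    intro s
    refine Fintype.sum_equiv (s.symm.arrowCongr (Equiv.refl I)) _ _ fun H => ?_
    have h5 : ∀ i, (s.symm.arrowCongr (Equiv.refl I)) H i = H (s i) := fun i => rfl
    simp only [h5, h1]
    rw [Equiv.prod_comp s fun j => a (H j)]
    ring
  have h6 : ∑ H : Fin n → I, (∏ i, A i (H i)) * (Matrix.of fun i j => B i (H j)).det *
      ∏ j, a (H j) = (Matrix.of fun i j => ∑ K, a K * A i K * B j K).det := by
    rw [← Matrix.det_transpose (Matrix.of fun i j => ∑ K, a K * A i K * B j K)]
    simp only [Matrix.det_apply', Matrix.of_apply, Matrix.transpose_apply, mul_sum, sum_mul]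
    rw [sum_comm]
    refine sum_congr rfl fun t _ => ?_
    rw [Finset.prod_univ_sum, Fintype.piFinset_univ, mul_sum]
    refine sum_congr rfl fun H _ => ?_
    rw [prod_mul_distrib, prod_mul_distrib]
    ring
  simp only [h3, sum_mul]
  rw [sum_comm]
  simp only [h4, h6, sum_const, card_univ, Fintype.card_perm, Fintype.card_fin, nsmul_eq_mul]

end Determinant

/-! ### Agreement of the signs of flags with the exterior algebra -/

section Sign

open ExteriorAlgebra

variable {T m : ℕ} [NeZero T]

/-- The sums of hyperplanes for the successive joinings of a bracketing. -/
def crossList : FreeMagma (ZMod T × Fin m) → List (DiagIndex T m ⊕ Fin m → ℂ)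
  | .of _ => []
  | .mul x y => crossList x ++ crossList y ++ [crossVec x y]

theorem crossList_mul (x y : FreeMagma (ZMod T × Fin m)) :
    crossList (x * y) = crossList x ++ crossList y ++ [crossVec x y] := rfl

theorem length_crossList (g : FreeMagma (ZMod T × Fin m)) :
    (crossList g).length + 1 = (leaves g).length := by
  induction g with
  | ih1 a => rfl
  | ih2 x y hx hy =>
    rw [crossList_mul, leaves_mul, List.length_append, List.length_append, List.length_append,
      ← hx, ← hy, List.length_singleton]
    omega

/-- The product of the functions in a list. -/
def wedge (l : List (DiagIndex T m ⊕ Fin m → ℂ)) : Ext (DiagIndex T m ⊕ Fin m) :=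
  (l.map (ι ℂ)).prod

theorem wedge_append (l l' : List (DiagIndex T m ⊕ Fin m → ℂ)) :
    wedge (l ++ l') = wedge l * wedge l' := by
  rw [wedge, List.map_append, List.prod_append]; rfl

theorem wedge_singleton (w : DiagIndex T m ⊕ Fin m → ℂ) : wedge [w] = ι ℂ w := by
  simp [wedge]

theorem joinSign_mul (x y : FreeMagma (ZMod T × Fin m)) :
    joinSign (x * y) = joinSign x * joinSign y * (-1) ^ ((leaves y).length + 1) := rfl

/-- Collect the hyperplane factors in the order of joining and the leaves in reversed order. Moving
ev(y) past the leaves of x, and c(x, y) past the earlier hyperplane factors, produces the sign of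
the joining rule up to a power of -1 depending only on the number of leaves. -/
theorem ev_eq_wedge (g : FreeMagma (ZMod T × Fin m)) :
    ev g = ((-1) ^ ((leaves g).length + 1) * joinSign g) •
      (wedge (crossList g) * wedge (((leaves g).reverse.map Prod.snd).map indexVec)) := by
  induction g with
  | ih1 a => simp [crossList, leaves_of, wedge, ev_of, joinSign]
  | ih2 x y hx hy =>
    set A := wedge (crossList x)
    set B := wedge (((leaves x).reverse.map Prod.snd).map indexVec) with hB
    set C := wedge (crossList y)
    set D := wedge (((leaves y).reverse.map Prod.snd).map indexVec)
    have h1 : B * (C * D) = (-1 : ℂ) ^ (leaves x).length • (C * D * B) := by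
      have hp := (HasParity.prod (crossList y)).mul
        (HasParity.prod (((leaves y).reverse.map Prod.snd).map (indexVec (T := T))))
      have h := hp.mul_prod (((leaves x).reverse.map Prod.snd).map indexVec)
      simp only [List.length_map, List.length_reverse, ← pow_add, ← length_crossList y] at h
      have h2 : (-1 : ℂ) ^ ((crossList y).length + ((crossList y).length + 1)) = -1 := by
        rw [← add_assoc, pow_succ, ← two_mul, pow_mul]; simp
      rw [h2] at h
      change C * D * B = (-1 : ℂ) ^ (leaves x).length • (B * (C * D)) at h
      rw [h, smul_smul, ← pow_add, ← two_mul, pow_mul]; simp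
    have h3 : ι ℂ (crossVec x y) * (A * C) =
        (-1 : ℂ) ^ ((leaves x).length + (leaves y).length) • (A * C * ι ℂ (crossVec x y)) := by
      have h := (HasParity.ι (crossVec x y)).mul_prod (crossList x ++ crossList y)
      rw [List.length_append] at h
      rw [← wedge_append, ← length_crossList x, ← length_crossList y]
      refine h.trans ?_
      congr 1
      rw [show (crossList x).length + 1 + ((crossList y).length + 1) =
        (crossList x).length + (crossList y).length + 2 by omega, pow_add _ _ 2]; simp
    rw [ev_mul, hx, hy, crossList_mul, leaves_mul, joinSign_mul, wedge_append, wedge_append,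
      wedge_singleton, List.reverse_append, List.map_append, List.map_append, wedge_append,
      smul_mul_smul_comm, mul_smul_comm, mul_assoc A, h1, mul_smul_comm, mul_smul_comm, smul_smul,
      ← mul_assoc A, ← mul_assoc A, ← mul_assoc (ι ℂ _), ← mul_assoc (ι ℂ _), h3, smul_mul_assoc,
      smul_mul_assoc, smul_smul, mul_assoc _ D B, List.length_append]
    congr 1
    have h4 : (-1 : ℂ) ^ (leaves x).length * (-1 : ℂ) ^ (leaves x).length = 1 := by
      rw [← mul_pow]; simp
    simp only [pow_add, pow_one]
    linear_combination (joinSign x * joinSign y * (-1) ^ (leaves x).length *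
      (-1) ^ (leaves y).length * (-1) ^ (leaves y).length) * h4

theorem wedge_eq_wedgeSign (l : List (Fin m)) (hl : l.length = m) :
    wedge (l.map (indexVec (T := T))) = wedgeSign l • ιMulti ℂ m (indexVec (T := T)) := by
  classical
  obtain ⟨f, rfl⟩ : ∃ f : Fin m → Fin m, l = List.ofFn f := by
    refine ⟨fun i => l[i], ?_⟩
    apply List.ext_getElem <;> simp [hl]
  have h0 : wedge ((List.ofFn f).map (indexVec (T := T))) = ιMulti ℂ m fun i => indexVec (f i) := by
    rw [wedge, ιMulti_apply, List.map_ofFn, List.map_ofFn]; rfl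
  rw [h0, wedgeSign]
  by_cases hf : Function.Injective f
  · have hb := Finite.injective_iff_bijective.1 hf
    rw [Finset.sum_eq_single (Equiv.ofBijective f hb)]
    · rw [if_pos (by rfl)]
      have h := AlternatingMap.map_perm (ιMulti ℂ m) (indexVec (T := T)) (Equiv.ofBijective f hb)
      refine h.trans ?_
      rw [Units.smul_def, ← Int.cast_smul_eq_zsmul ℂ]
    · intro s _ hs
      exact if_neg fun h => hs (Equiv.ext fun i => congrFun (List.ofFn_injective h) i)
    · simp
  · rw [sum_eq_zero, zero_smul]
    · rw [Function.not_injective_iff] at hf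
      obtain ⟨i, j, hij, hne⟩ := hf
      exact (ιMulti ℂ m).map_eq_zero_of_eq _ (congrArg indexVec hij) hne
    · intro s _
      refine if_neg fun h => hf ?_
      rw [← List.ofFn_injective h]
      exact s.injective

theorem nodup_of_flagSign_ne_zero {g : FreeMagma (ZMod T × Fin m)} (h : flagSign g ≠ 0) :
    ((leaves g).map Prod.snd).Nodup ∧ ∀ p, p ∈ (leaves g).map Prod.snd := by
  obtain ⟨s, -, hs⟩ := Finset.exists_ne_zero_of_sum_ne_zero (left_ne_zero_of_mul h)
  have hs' : List.ofFn s = (leaves g).reverse.map Prod.snd := by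
    by_contra h0; exact hs (if_neg h0)
  have h1 : (leaves g).map Prod.snd = (List.ofFn s).reverse := by
    rw [hs', List.map_reverse, List.reverse_reverse]
  rw [h1, List.nodup_reverse]
  refine ⟨List.nodup_ofFn.2 s.injective, fun p => ?_⟩
  rw [List.mem_reverse, List.mem_ofFn]
  exact s.surjective p

theorem ev_eq_flagSign {g : FreeMagma (ZMod T × Fin m)} (hg : (leaves g).length = m) :
    ev g = ((-1) ^ (m + 1) * flagSign g) •
      (wedge (crossList g) * ιMulti ℂ m (indexVec (T := T))) := by
  rw [ev_eq_wedge, wedge_eq_wedgeSign _ (by simpa using hg), mul_smul_comm, smul_smul, hg, flagSign]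
  congr 1
  ring

/-- The sum of all hyperplanes. -/
def allVec (T m : ℕ) : DiagIndex T m ⊕ Fin m → ℂ := Sum.elim 1 0

/-- Each function in the list is a factor of ev(g), so its product with ev(g) is zero. -/
theorem crossList_sum_mul_ev (g : FreeMagma (ZMod T × Fin m)) :
    ι ℂ (crossList g).sum * ev g = 0 := by
  induction g with
  | ih1 a => simp [crossList]
  | ih2 x y hx hy =>
    rw [crossList_mul, List.sum_append, List.sum_append, List.sum_singleton, map_add, map_add,
      add_mul, add_mul, ev_mul]
    have h1 : ι ℂ (crossVec x y) * (ι ℂ (crossVec x y) * (ev x * ev y)) = 0 := by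
      rw [← mul_assoc, ι_sq_zero, zero_mul]
    have h2 : ∀ w : DiagIndex T m ⊕ Fin m → ℂ, ι ℂ w * (ι ℂ (crossVec x y) * (ev x * ev y)) =
        -(ι ℂ (crossVec x y) * (ι ℂ w * (ev x * ev y))) := fun w => by
      rw [← mul_assoc (ι ℂ w), eq_neg_of_add_eq_zero_left (ι_add_mul_swap w (crossVec x y)),
        neg_mul, mul_assoc]
    rw [h1, h2, h2, ← mul_assoc _ (ev x), hx, zero_mul, mul_zero, ev_anticomm x, mul_neg,
      ← mul_assoc _ (ev y), hy]
    simp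

/-- Since the functions of earlier steps are killed, the sum of all hyperplanes may be replaced by
the sum of those not yet used, which belongs to the last step of the flag. Moving it behind the
other m - 1 factors cancels the sign (-1)^(m+1). -/
theorem allVec_mul_ev {g : FreeMagma (ZMod T × Fin m)} (hg : (leaves g).length = m) :
    ι ℂ (allVec T m) * ev g = flagSign g •
      (wedge (crossList g ++ [allVec T m - (crossList g).sum]) *
        ιMulti ℂ m (indexVec (T := T))) := by
  have h0 : ι ℂ (allVec T m) * ev g = ι ℂ (allVec T m - (crossList g).sum) * ev g := by
    rw [map_sub, sub_mul, crossList_sum_mul_ev, sub_zero]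
  have h1 := (HasParity.ι (allVec T m - (crossList g).sum)).mul_prod (crossList g)
  change _ * wedge (crossList g) = _ • (wedge (crossList g) * _) at h1
  have h2 := length_crossList g
  rw [hg] at h2
  rw [h0, ev_eq_flagSign hg, mul_smul_comm, ← mul_assoc, h1, smul_mul_assoc, smul_smul,
    wedge_append, wedge_singleton]
  congr 1
  rw [mul_right_comm, ← pow_add, show m + 1 + (crossList g).length =
    2 * ((crossList g).length + 1) by omega, pow_mul]
  simp

variable (a : DiagIndex T m → ℂ)

/-- The form on products of hyperplane functions times the coordinate functions. -/
theorem extForm_wedge {l l' : List (DiagIndex T m ⊕ Fin m → ℂ)} (hl : l.length = m)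
    (hl' : l'.length = m) (h : ∀ w ∈ l, ∀ p, w (.inr p) = 0) (h' : ∀ w ∈ l', ∀ p, w (.inr p) = 0) :
    extForm (Sum.elim a 1) (wedge l * ιMulti ℂ m (indexVec (T := T)))
      (wedge l' * ιMulti ℂ m (indexVec (T := T))) =
    (Matrix.of fun i j : Fin m => ∑ K, a K * l[i] (.inl K) * l'[j] (.inl K)).det := by
  have hd : Disjoint (Set.range (Sum.inl : DiagIndex T m → DiagIndex T m ⊕ Fin m))
      (Set.range Sum.inr) := Set.isCompl_range_inl_range_inr.disjoint
  have h1 : ∀ {l : List (DiagIndex T m ⊕ Fin m → ℂ)} (hl : l.length = m)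
      (h : ∀ w ∈ l, ∀ p, w (.inr p) = 0),
      wedge l = ιMulti ℂ m (fun i : Fin m => l[i]) ∧
      map (restrict (Set.range Sum.inl)) (ιMulti ℂ m (fun i : Fin m => l[i])) =
        ιMulti ℂ m (fun i : Fin m => l[i]) := by
    intro l hl h
    constructor
    · rw [wedge, ιMulti_apply]
      congr 1
      apply List.ext_getElem <;> simp [hl]
    · rw [map_apply_ιMulti]
      congr 1
      ext1 i
      refine restrict_eq_self fun j hj => ?_
      rcases j with K | p
      · exact absurd ⟨K, rfl⟩ hj
      · exact h _ (List.getElem_mem _) p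
  have h2 : map (restrict (Set.range Sum.inr)) (ιMulti ℂ m (indexVec (T := T))) =
      ιMulti ℂ m (indexVec (T := T)) := by
    rw [map_apply_ιMulti]
    congr 1
    ext1 i
    refine restrict_eq_self fun j hj => ?_
    rcases j with K | p
    · simp [indexVec]
    · exact absurd ⟨p, rfl⟩ hj
  have h3 := extForm_mul_mul (Sum.elim a 1) hd (ιMulti ℂ m (fun i : Fin m => l[i]))
    (ιMulti ℂ m (indexVec (T := T))) (ιMulti ℂ m (fun i : Fin m => l'[i]))
    (ιMulti ℂ m (indexVec (T := T)))
  rw [(h1 hl h).2, (h1 hl' h').2, h2] at h3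
  rw [(h1 hl h).1, (h1 hl' h').1, h3, extForm_ιMulti, extForm_ιMulti]
  -- The coordinates have weight 1, so their Gram matrix is the identity and only the hyperplane
  -- block remains.
  have h4 : (Matrix.of fun i j : Fin m => diagForm (Sum.elim a 1) (indexVec (T := T) i)
      (indexVec j)) = 1 := by
    ext i j
    rw [Matrix.of_apply, diagForm_indexVec, Matrix.one_apply]
    simp [indexVec, Pi.single_apply, eq_comm]
  rw [h4, Matrix.det_one, mul_one]
  congr 2
  ext i j
  rw [diagForm_apply, Fintype.sum_sum_type]
  simp [h _ (List.getElem_mem _)]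

end Sign

/-! ### Flags of commutators and the hyperplanes acquired at each step -/

section Flags

variable {T m : ℕ} [NeZero T] {ω : ℂ} (hω : IsPrimitiveRoot ω T)

theorem covBy_of_mem {V : Type*} [AddCommGroup V] [Module ℂ V] {S C : Submodule ℂ V} (hS : S ≤ C)
    {w : V} (hw : w ∈ C) (hw' : w ∉ S) (h : ∀ t ∈ C, ∃ z : ℂ, t - z • w ∈ S) : S ⋖ C := by
  have h1 : C = Submodule.span ℂ {w} ⊔ S := by
    refine le_antisymm (fun t ht => ?_) (sup_le ?_ hS)
    · obtain ⟨z, hz⟩ := h t ht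
      rw [← add_sub_cancel (z • w) t]
      exact add_mem (Submodule.mem_sup_left (Submodule.smul_mem _ _
        (Submodule.mem_span_singleton_self w))) (Submodule.mem_sup_right hz)
    · rwa [Submodule.span_singleton_le_iff_mem]
  rw [h1]
  exact Submodule.covBy_span_singleton_sup hw'

theorem foldr_inf_append {M : Type*} [AddCommGroup M] [Module ℂ M] (C : Submodule ℂ M)
    (l l' : List (Submodule ℂ M)) :
    C ⊓ (l ++ l').foldr (· ⊓ ·) ⊤ = C ⊓ l.foldr (· ⊓ ·) ⊤ ⊓ l'.foldr (· ⊓ ·) ⊤ := by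
  induction l generalizing C with
  | nil => simp
  | cons S l ih => simp only [List.cons_append, List.foldr_cons, ← inf_assoc, ih]

open Classical in
/-- Successive intersections of `C` with the subspaces in the first list drop the dimension by one,
and the functions in the second list are the indicators of the hyperplanes that contain the new
subspace but not the old one. -/
def Adapted (ω : ℂ) : Submodule ℂ (Fin m → ℂ) → List (Submodule ℂ (Fin m → ℂ)) →
    List (DiagIndex T m ⊕ Fin m → ℂ) → Prop
  | _, [], [] => True
  | C, S :: Ss, N :: Ns => (C ⊓ S ⋖ C ∧ ∀ K, N (.inl K) =
      if C ⊓ S ≤ diagHyp ω K ∧ ¬ C ≤ diagHyp ω K then 1 else 0) ∧ Adapted ω (C ⊓ S) Ss Ns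
  | _, [], _ :: _ => False
  | _, _ :: _, [] => False

theorem Adapted.append {C : Submodule ℂ (Fin m → ℂ)} {Ss Ss' : List (Submodule ℂ (Fin m → ℂ))}
    {Ns Ns' : List (DiagIndex T m ⊕ Fin m → ℂ)} (h : Adapted ω C Ss Ns)
    (h' : Adapted ω (C ⊓ Ss.foldr (· ⊓ ·) ⊤) Ss' Ns') : Adapted ω C (Ss ++ Ss') (Ns ++ Ns') := by
  induction Ss generalizing C Ns with
  | nil =>
    cases Ns with
    | nil => simpa using h'
    | cons N Ns => exact h.elim
  | cons S Ss ih =>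
    cases Ns with
    | nil => exact h.elim
    | cons N Ns =>
      refine ⟨h.1, ih h.2 ?_⟩
      rwa [List.foldr_cons, ← inf_assoc] at h'

-- The indicators telescope: a hyperplane is acquired at one step at most, because the subspaces
-- decrease.
open Classical in
theorem Adapted.sum {C : Submodule ℂ (Fin m → ℂ)} {Ss : List (Submodule ℂ (Fin m → ℂ))}
    {Ns : List (DiagIndex T m ⊕ Fin m → ℂ)} (h : Adapted ω C Ss Ns) (K : DiagIndex T m) :
    Ns.sum (.inl K) = (if C ⊓ Ss.foldr (· ⊓ ·) ⊤ ≤ diagHyp ω K then 1 else 0) -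
      if C ≤ diagHyp ω K then 1 else 0 := by
  induction Ss generalizing C Ns with
  | nil =>
    cases Ns with
    | nil => simp
    | cons N Ns => exact h.elim
  | cons S Ss ih =>
    cases Ns with
    | nil => exact h.elim
    | cons N Ns =>
      have h1 : C ≤ diagHyp ω K → C ⊓ S ≤ diagHyp ω K := fun h => inf_le_left.trans h
      rw [List.sum_cons, Pi.add_apply, ih h.2, h.1.2, List.foldr_cons, ← inf_assoc]
      by_cases h2 : C ≤ diagHyp ω K
      · simp [h2, h1 h2]
      · simp [h2]

open Classical in
theorem Adapted.get {C : Submodule ℂ (Fin m → ℂ)} {Ss : List (Submodule ℂ (Fin m → ℂ))}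
    {Ns : List (DiagIndex T m ⊕ Fin m → ℂ)} (h : Adapted ω C Ss Ns) (i : ℕ) (hi : i < Ns.length) :
    C ⊓ (Ss.take (i + 1)).foldr (· ⊓ ·) ⊤ ⋖ C ⊓ (Ss.take i).foldr (· ⊓ ·) ⊤ ∧
    ∀ K, Ns[i] (.inl K) = if C ⊓ (Ss.take (i + 1)).foldr (· ⊓ ·) ⊤ ≤ diagHyp ω K ∧
      ¬ C ⊓ (Ss.take i).foldr (· ⊓ ·) ⊤ ≤ diagHyp ω K then 1 else 0 := by
  induction Ss generalizing C Ns i with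
  | nil =>
    cases Ns with
    | nil => exact absurd hi (Nat.not_lt_zero i)
    | cons N Ns => exact h.elim
  | cons S Ss ih =>
    cases Ns with
    | nil => exact h.elim
    | cons N Ns =>
      cases i with
      | zero => simpa using h.1
      | succ i =>
        have := ih h.2 i (by simpa using hi)
        simpa [← inf_assoc] using this

/-- The vectors supported on the indices in `X`. -/
def vecsOn (X : Set (Fin m)) : Set (Fin m → ℂ) := {t | ∀ p ∉ X, t p = 0}

/-- A vector on which all leaves of a bracketing take the value `1`. -/
def witness (ω : ℂ) : FreeMagma (ZMod T × Fin m) → Fin m → ℂ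
  | .of a => Pi.single a.2 (ω ^ a.1.val)⁻¹
  | .mul x y => witness ω x + witness ω y

/-- The indices at the leaves are distinct. -/
def Distinct (g : FreeMagma (ZMod T × Fin m)) : Prop := ((leaves g).map Prod.snd).Nodup

theorem distinct_mul {x y : FreeMagma (ZMod T × Fin m)} :
    Distinct (x * y) ↔ Distinct x ∧ Distinct y ∧ Disjoint (indices x) (indices y) := by
  rw [Distinct, leaves_mul, List.map_append, List.nodup_append']
  refine and_congr Iff.rfl (and_congr Iff.rfl ?_)
  rw [Set.disjoint_left, List.Disjoint]
  refine forall_congr' fun p => ?_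
  simp only [indices, Set.mem_ofPred_eq, List.mem_map]

theorem witness_mul (x y : FreeMagma (ZMod T × Fin m)) :
    witness ω (x * y) = witness ω x + witness ω y := rfl

theorem witness_mem (g : FreeMagma (ZMod T × Fin m)) : witness ω g ∈ vecsOn (indices g) := by
  induction g with
  | ih1 a =>
    intro p hp
    rw [indices_of] at hp
    exact Pi.single_eq_of_ne hp _
  | ih2 x y hx hy =>
    intro p hp
    rw [indices_mul, Set.mem_union, not_or] at hp
    rw [witness_mul, Pi.add_apply, hx p hp.1, hy p hp.2, add_zero]

theorem vecsOn_mono {X Y : Set (Fin m)} (h : X ⊆ Y) : vecsOn X ⊆ vecsOn Y :=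
  fun _ ht p hp => ht p fun hX => hp (h hX)

theorem mem_islandEdge_of_vecsOn {X : Set (Fin m)} {x : FreeMagma (ZMod T × Fin m)}
    (h : Disjoint (indices x) X) {t : Fin m → ℂ} (ht : t ∈ vecsOn X) : t ∈ islandEdge ω x := by
  intro a ha b hb
  rw [ht _ (Set.disjoint_left.1 h (mem_indices ha)), ht _ (Set.disjoint_left.1 h (mem_indices hb)),
    mul_zero, mul_zero]

theorem islandEdge_of (a : ZMod T × Fin m) : islandEdge ω (.of a) = ⊤ := by
  refine eq_top_iff.2 fun t _ x hx y hy => ?_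
  rw [leaves_of, List.mem_singleton] at hx hy
  rw [hx, hy]

theorem islandEdge_mul_le_left (x y : FreeMagma (ZMod T × Fin m)) :
    islandEdge ω (x * y) ≤ islandEdge ω x :=
  fun _ ht a ha b hb => ht a (List.mem_append_left _ ha) b (List.mem_append_left _ hb)

theorem islandEdge_mul_le_right (x y : FreeMagma (ZMod T × Fin m)) :
    islandEdge ω (x * y) ≤ islandEdge ω y :=
  fun _ ht a ha b hb => ht a (List.mem_append_right _ ha) b (List.mem_append_right _ hb)

theorem exists_value {x : FreeMagma (ZMod T × Fin m)} {t : Fin m → ℂ} (ht : t ∈ islandEdge ω x) :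
    ∃ z, ∀ a ∈ leaves x, ω ^ a.1.val * t a.2 = z := by
  obtain ⟨b, hb⟩ := List.exists_mem_of_ne_nil _ (leaves_ne_nil x)
  exact ⟨_, fun a ha => ht a ha b hb⟩

theorem mem_islandEdge_mul {x y : FreeMagma (ZMod T × Fin m)} {t : Fin m → ℂ} (z : ℂ)
    (hx : ∀ a ∈ leaves x, ω ^ a.1.val * t a.2 = z) (hy : ∀ a ∈ leaves y, ω ^ a.1.val * t a.2 = z) :
    t ∈ islandEdge ω (x * y) := by
  have h : ∀ a ∈ leaves (x * y), ω ^ a.1.val * t a.2 = z := fun a ha =>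
    (List.mem_append.1 ha).elim (hx a) (hy a)
  exact fun a ha b hb => (h a ha).trans (h b hb).symm

include hω

theorem pow_val_ne_zero (k : ZMod T) : ω ^ k.val ≠ 0 :=
  pow_ne_zero _ (hω.ne_zero (NeZero.ne T))

theorem pow_val_add (k l : ZMod T) : ω ^ (k + l).val = ω ^ k.val * ω ^ l.val := by
  rw [ZMod.val_add, ← pow_eq_pow_mod _ hω.pow_eq_one, pow_add]

theorem pow_val_injective {k l : ZMod T} (h : ω ^ k.val = ω ^ l.val) : k = l :=
  ZMod.val_injective T (hω.pow_inj (ZMod.val_lt k) (ZMod.val_lt l) h)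

theorem witness_leaf {g : FreeMagma (ZMod T × Fin m)} (hg : Distinct g) :
    ∀ a ∈ leaves g, ω ^ a.1.val * witness ω g a.2 = 1 := by
  induction g with
  | ih1 b =>
    intro a ha
    rw [leaves_of, List.mem_singleton] at ha
    rw [ha, witness, Pi.single_eq_same, mul_inv_cancel₀ (pow_val_ne_zero hω _)]
  | ih2 x y hx hy =>
    obtain ⟨h1, h2, h3⟩ := distinct_mul.1 hg
    intro a ha
    rw [witness_mul, Pi.add_apply, mul_add]
    rcases List.mem_append.1 ha with h | h
    · rw [hx h1 a h, witness_mem y _ (Set.disjoint_left.1 h3 (mem_indices h)), mul_zero, add_zero]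
    · rw [hy h2 a h, witness_mem x _ (Set.disjoint_right.1 h3 (mem_indices h)), mul_zero, zero_add]

theorem witness_mem_islandEdge {g : FreeMagma (ZMod T × Fin m)} (hg : Distinct g) :
    witness ω g ∈ islandEdge ω g := fun a ha b hb =>
  (witness_leaf hω hg a ha).trans (witness_leaf hω hg b hb).symm

theorem witness_ne_zero {g : FreeMagma (ZMod T × Fin m)} (hg : Distinct g) {a : ZMod T × Fin m}
    (ha : a ∈ leaves g) : witness ω g a.2 ≠ 0 :=
  right_ne_zero_of_mul (ne_of_eq_of_ne (witness_leaf hω hg a ha) one_ne_zero)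

theorem mem_diagHyp_of_joins {a b : ZMod T × Fin m} {K : DiagIndex T m} (h : Joins a b K)
    {t : Fin m → ℂ} : t ∈ diagHyp ω K ↔ ω ^ a.1.val * t a.2 = ω ^ b.1.val * t b.2 := by
  have key : ∀ (k l : ZMod T) (z w : ℂ), z = ω ^ (l - k).val * w ↔
      ω ^ k.val * z = ω ^ l.val * w := by
    intro k l z w
    conv_rhs => rw [← add_sub_cancel k l, pow_val_add hω, mul_assoc]
    exact (mul_right_inj' (pow_val_ne_zero hω k)).symm
  change t K.1.1.1 = ω ^ K.2.val * t K.1.1.2 ↔ _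
  rcases h with ⟨h1, h2, h3⟩ | ⟨h1, h2, h3⟩
  · rw [h1, h2, h3, key]
  · rw [h1, h2, h3, key, eq_comm]

/-- The hyperplanes that contain the island of `[x, y]` but not both islands of `x` and `y`. -/
theorem exists_joins_iff {x y : FreeMagma (ZMod T × Fin m)} (hg : Distinct (x * y))
    {C : Submodule ℂ (Fin m → ℂ)} (hC : vecsOn (indices (x * y)) ⊆ C) (K : DiagIndex T m) :
    (C ⊓ islandEdge ω x ⊓ islandEdge ω y ⊓ islandEdge ω (x * y) ≤ diagHyp ω K ∧
      ¬ C ⊓ islandEdge ω x ⊓ islandEdge ω y ≤ diagHyp ω K) ↔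
    ∃ a ∈ leaves x, ∃ b ∈ leaves y, Joins a b K := by
  obtain ⟨hx, hy, hd⟩ := distinct_mul.1 hg
  rw [indices_mul] at hC
  have wxC : witness ω x ∈ C := hC (vecsOn_mono Set.subset_union_left (witness_mem x))
  have wyC : witness ω y ∈ C := hC (vecsOn_mono Set.subset_union_right (witness_mem y))
  have wxx := witness_mem_islandEdge hω hx
  have wyy := witness_mem_islandEdge hω hy
  have wxy : witness ω x ∈ islandEdge ω y := mem_islandEdge_of_vecsOn hd.symm (witness_mem x)
  have wyx : witness ω y ∈ islandEdge ω x := mem_islandEdge_of_vecsOn hd (witness_mem y)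
  have hxy : ∀ {a : ZMod T × Fin m}, a ∈ leaves x → witness ω y a.2 = 0 := fun ha =>
    witness_mem y _ (Set.disjoint_left.1 hd (mem_indices ha))
  have hyx : ∀ {a : ZMod T × Fin m}, a ∈ leaves y → witness ω x a.2 = 0 := fun ha =>
    witness_mem x _ (Set.disjoint_right.1 hd (mem_indices ha))
  constructor
  · rintro ⟨h1, h2⟩
    obtain ⟨t, ⟨⟨htC, htx⟩, hty⟩, htK⟩ := SetLike.not_le_iff_exists.1 h2
    obtain ⟨z, hz⟩ := exists_value htx
    obtain ⟨w, hw⟩ := exists_value hty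
    -- Otherwise subtract a multiple of the witness of x from t, so that x and y get the same value.
    -- The result lies in the joined island, hence in K, and then so does t.
    have hKx : witness ω x ∉ diagHyp ω K := by
      intro h
      refine htK ?_
      rw [← sub_add_cancel t ((z - w) • witness ω x)]
      refine add_mem (h1 ⟨⟨⟨sub_mem htC (Submodule.smul_mem _ _ wxC),
        sub_mem htx (Submodule.smul_mem _ _ wxx)⟩, sub_mem hty (Submodule.smul_mem _ _ wxy)⟩,
        mem_islandEdge_mul w (fun a ha => ?_) fun a ha => ?_⟩) (Submodule.smul_mem _ _ h)
      · rw [Pi.sub_apply, Pi.smul_apply, smul_eq_mul]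
        linear_combination hz a ha - (z - w) * witness_leaf hω hx a ha
      · rw [Pi.sub_apply, Pi.smul_apply, smul_eq_mul, hyx ha, mul_zero, sub_zero, hw a ha]
    have hKy : witness ω y ∉ diagHyp ω K := by
      intro h
      refine htK ?_
      rw [← sub_add_cancel t ((w - z) • witness ω y)]
      refine add_mem (h1 ⟨⟨⟨sub_mem htC (Submodule.smul_mem _ _ wyC),
        sub_mem htx (Submodule.smul_mem _ _ wyx)⟩, sub_mem hty (Submodule.smul_mem _ _ wyy)⟩,
        mem_islandEdge_mul z (fun a ha => ?_) fun a ha => ?_⟩) (Submodule.smul_mem _ _ h)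
      · rw [Pi.sub_apply, Pi.smul_apply, smul_eq_mul, hxy ha, mul_zero, sub_zero, hz a ha]
      · rw [Pi.sub_apply, Pi.smul_apply, smul_eq_mul]
        linear_combination hw a ha - (w - z) * witness_leaf hω hy a ha
    -- The sum of the witnesses lies in K but neither summand does. So one index of K belongs to x
    -- and the other to y, and the exponent of ω is determined by the non-zero coordinates.
    have hK : witness ω x + witness ω y ∈ diagHyp ω K :=
      h1 ⟨⟨⟨add_mem wxC wyC, add_mem wxx wyx⟩, add_mem wxy wyy⟩,
        mem_islandEdge_mul 1
          (fun a ha => by rw [Pi.add_apply, hxy ha, add_zero, witness_leaf hω hx a ha])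
          fun a ha => by rw [Pi.add_apply, hyx ha, zero_add, witness_leaf hω hy a ha]⟩
    have hKx' : ¬ witness ω x K.1.1.1 = ω ^ K.2.val * witness ω x K.1.1.2 := hKx
    have hKy' : ¬ witness ω y K.1.1.1 = ω ^ K.2.val * witness ω y K.1.1.2 := hKy
    have mx : K.1.1.1 ∈ indices x ∨ K.1.1.2 ∈ indices x := by
      by_contra h
      push Not at h
      exact hKx' (by rw [witness_mem x _ h.1, witness_mem x _ h.2, mul_zero])
    have my : K.1.1.1 ∈ indices y ∨ K.1.1.2 ∈ indices y := by
      by_contra h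
      push Not at h
      exact hKy' (by rw [witness_mem y _ h.1, witness_mem y _ h.2, mul_zero])
    have fin : ∀ {a b : ZMod T × Fin m} {K' : DiagIndex T m}, a ∈ leaves x → b ∈ leaves y →
        Joins a b K' → witness ω x + witness ω y ∈ diagHyp ω K' := by
      intro a b K' ha hb h
      rw [mem_diagHyp_of_joins hω h, Pi.add_apply, Pi.add_apply, hxy ha, hyx hb, add_zero, zero_add,
        witness_leaf hω hx a ha, witness_leaf hω hy b hb]
    have hK' : (witness ω x + witness ω y) K.1.1.1 =
      ω ^ K.2.val * (witness ω x + witness ω y) K.1.1.2 := hK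
    have uniq : ∀ {k : ZMod T} {z : ℂ}, z ≠ 0 → ω ^ K.2.val * z = ω ^ k.val * z → K.2 = k :=
      fun hz h => pow_val_injective hω (mul_right_cancel₀ hz h)
    rcases mx with ⟨a, ha, hap⟩ | ⟨a, ha, haq⟩
    · rcases my with hp | ⟨b, hb, hbq⟩
      · exact absurd hp (Set.disjoint_left.1 hd ⟨a, ha, hap⟩)
      · refine ⟨a, ha, b, hb, .inl ⟨hap.symm, hbq.symm, ?_⟩⟩
        have h3 : witness ω x + witness ω y ∈ diagHyp ω (K.1, b.1 - a.1) :=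
          fin ha hb (.inl ⟨hap.symm, hbq.symm, rfl⟩)
        refine uniq ?_ (hK'.symm.trans h3)
        rw [← hbq, Pi.add_apply, hyx hb, zero_add]
        exact witness_ne_zero hω hy hb
    · rcases my with ⟨b, hb, hbp⟩ | hq
      · refine ⟨a, ha, b, hb, .inr ⟨hbp.symm, haq.symm, ?_⟩⟩
        have h3 : witness ω x + witness ω y ∈ diagHyp ω (K.1, a.1 - b.1) :=
          fin ha hb (.inr ⟨hbp.symm, haq.symm, rfl⟩)
        refine uniq ?_ (hK'.symm.trans h3)
        rw [← haq, Pi.add_apply, hxy ha, add_zero]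
        exact witness_ne_zero hω hx ha
      · exact absurd hq (Set.disjoint_left.1 hd ⟨a, ha, haq⟩)
  · rintro ⟨a, ha, b, hb, h⟩
    refine ⟨fun t ht => (mem_diagHyp_of_joins hω h).2
      (ht.2 a (List.mem_append_left _ ha) b (List.mem_append_right _ hb)), fun hle => ?_⟩
    have := (mem_diagHyp_of_joins hω h).1 (hle ⟨⟨wxC, wxx⟩, wxy⟩)
    rw [witness_leaf hω hx a ha, hyx hb, mul_zero] at this
    exact one_ne_zero this

omit hω in
theorem sum_indicator {α : Type*} {P : α → Prop} [DecidablePred P] (l : List α)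
    (h : l.Pairwise fun a b => ¬ (P a ∧ P b)) :
    (l.map fun a => if P a then (1 : ℂ) else 0).sum =
      open Classical in if ∃ a ∈ l, P a then 1 else 0 := by
  induction l with
  | nil => simp
  | cons a l ih =>
    rw [List.pairwise_cons] at h
    rw [List.map_cons, List.sum_cons, ih h.2]
    by_cases ha : P a
    · have : ¬ ∃ b ∈ l, P b := fun ⟨b, hb, hPb⟩ => h.1 b hb ⟨ha, hPb⟩
      simp [ha, this]
    · simp [ha]

-- A hyperplane has one pair of indices, and the leaves carry distinct indices, so it joins at most
-- one pair of leaves and the multiplicity is never above 1.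
open Classical in
omit hω in
theorem crossVec_inl {x y : FreeMagma (ZMod T × Fin m)} (hg : Distinct (x * y))
    (K : DiagIndex T m) : crossVec x y (.inl K) =
      if ∃ a ∈ leaves x, ∃ b ∈ leaves y, Joins a b K then 1 else 0 := by
  obtain ⟨hx, hy, hd⟩ := distinct_mul.1 hg
  have hne : ∀ {a b : ZMod T × Fin m}, a ∈ leaves x → b ∈ leaves y → a.2 ≠ b.2 := fun ha hb h =>
    Set.disjoint_left.1 hd (mem_indices ha) (h ▸ mem_indices hb)
  have h1 : ∀ a ∈ leaves x, ((leaves y).map fun b => edgeVec a b (.inl K)).sum =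
      if ∃ b ∈ leaves y, Joins a b K then 1 else 0 := by
    intro a ha
    refine sum_indicator _ ?_
    refine (List.pairwise_map.1 hy).imp_of_mem fun {b b'} hb hb' hbb' h => ?_
    have := hne ha hb
    have := hne ha hb'
    rcases joins_mem h.1 with ⟨h1, h2⟩ | ⟨h1, h2⟩ <;>
      rcases joins_mem h.2 with ⟨h3, h4⟩ | ⟨h3, h4⟩ <;> simp_all
  rw [crossVec, treePair, List.map_congr_left h1]
  refine sum_indicator _ ?_
  refine (List.pairwise_map.1 hx).imp_of_mem fun {a a'} ha ha' haa' h => ?_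
  obtain ⟨⟨b, hb, h⟩, b', hb', h'⟩ := h
  have := hne ha hb
  have := hne ha hb'
  have := hne ha' hb
  rcases joins_mem h with ⟨h1, h2⟩ | ⟨h1, h2⟩ <;>
    rcases joins_mem h' with ⟨h3, h4⟩ | ⟨h3, h4⟩ <;> simp_all

/-- The ambient C is arbitrary because the islands of y are formed inside C intersected with the
island of x. Vectors supported on the indices of y still lie there, the indices being disjoint, so
each join lowers the dimension by exactly one. -/
theorem adapted_islands {g : FreeMagma (ZMod T × Fin m)} (hg : Distinct g)
    {C : Submodule ℂ (Fin m → ℂ)} (hC : vecsOn (indices g) ⊆ C) :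
    Adapted ω C (islands ω g) (crossList g) ∧
      C ⊓ (islands ω g).foldr (· ⊓ ·) ⊤ = C ⊓ islandEdge ω g := by
  induction g generalizing C with
  | ih1 a => exact ⟨trivial, by rw [islandEdge_of]; rfl⟩
  | ih2 x y ihx ihy =>
    obtain ⟨hx, hy, hd⟩ := distinct_mul.1 hg
    have hC' := hC
    rw [indices_mul] at hC'
    obtain ⟨h1, h2⟩ := ihx hx ((vecsOn_mono Set.subset_union_left).trans hC')
    obtain ⟨h3, h4⟩ := ihy (C := C ⊓ islandEdge ω x) hy fun t ht =>
      ⟨hC' (vecsOn_mono Set.subset_union_right ht), mem_islandEdge_of_vecsOn hd ht⟩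
    have h5 : C ⊓ (islands ω x ++ islands ω y).foldr (· ⊓ ·) ⊤ =
        C ⊓ islandEdge ω x ⊓ islandEdge ω y := by
      rw [foldr_inf_append, h2, h4]
    have wxC : witness ω x ∈ C := hC' (vecsOn_mono Set.subset_union_left (witness_mem x))
    have wxx := witness_mem_islandEdge hω hx
    have wxy : witness ω x ∈ islandEdge ω y := mem_islandEdge_of_vecsOn hd.symm (witness_mem x)
    have hyx : ∀ {a : ZMod T × Fin m}, a ∈ leaves y → witness ω x a.2 = 0 := fun ha =>
      witness_mem x _ (Set.disjoint_right.1 hd (mem_indices ha))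
    have h6 : Adapted ω (C ⊓ islandEdge ω x ⊓ islandEdge ω y) [islandEdge ω (x * y)]
        [crossVec x y] := by
      classical
      refine ⟨⟨covBy_of_mem (w := witness ω x) inf_le_left ⟨⟨wxC, wxx⟩, wxy⟩ ?_ ?_, fun K => ?_⟩,
        trivial⟩
      · rintro ⟨-, h⟩
        obtain ⟨a, ha⟩ := List.exists_mem_of_ne_nil _ (leaves_ne_nil x)
        obtain ⟨b, hb⟩ := List.exists_mem_of_ne_nil _ (leaves_ne_nil y)
        have := h a (List.mem_append_left _ ha) b (List.mem_append_right _ hb)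
        rw [witness_leaf hω hx a ha, hyx hb, mul_zero] at this
        exact one_ne_zero this
      · rintro t ⟨⟨htC, htx⟩, hty⟩
        obtain ⟨z, hz⟩ := exists_value htx
        obtain ⟨w, hw⟩ := exists_value hty
        refine ⟨z - w, ⟨⟨sub_mem htC (Submodule.smul_mem _ _ wxC),
          sub_mem htx (Submodule.smul_mem _ _ wxx)⟩, sub_mem hty (Submodule.smul_mem _ _ wxy)⟩,
          mem_islandEdge_mul w (fun a ha => ?_) fun a ha => ?_⟩
        · rw [Pi.sub_apply, Pi.smul_apply, smul_eq_mul]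
          linear_combination hz a ha - (z - w) * witness_leaf hω hx a ha
        · rw [Pi.sub_apply, Pi.smul_apply, smul_eq_mul, hyx ha, mul_zero, sub_zero, hw a ha]
      · rw [crossVec_inl hg]
        exact if_congr (exists_joins_iff hω hg hC K).symm rfl rfl
    constructor
    · refine Adapted.append (Adapted.append h1 (h2 ▸ h3)) ?_
      rw [h5]; exact h6
    · change C ⊓ (islands ω x ++ islands ω y ++ [islandEdge ω (x * y)]).foldr _ _ = _
      rw [foldr_inf_append, h5]
      simp only [List.foldr_cons, List.foldr_nil, inf_top_eq]
      refine le_antisymm (inf_le_inf_right _ (inf_le_left.trans inf_le_left)) ?_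
      exact le_inf (le_inf (le_inf inf_le_left (inf_le_right.trans (islandEdge_mul_le_left x y)))
        (inf_le_right.trans (islandEdge_mul_le_right x y))) inf_le_right

/-- In the last step the common value of the joined island is set to zero. The zero space lies in
every hyperplane and the whole space in none, as p < q, so by telescoping the new hyperplanes are
those absent from the earlier list. -/
theorem adapted_flag {g : FreeMagma (ZMod T × Fin m)} (hg : Distinct g)
    (hall : ∀ p, p ∈ indices g) :
    Adapted ω ⊤ (islands ω g ++ [zeroEdge g])
      (crossList g ++ [allVec T m - (crossList g).sum]) := by
  classical
  obtain ⟨h1, h2⟩ := adapted_islands hω hg (C := ⊤) fun _ _ => trivial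
  refine h1.append ⟨⟨?_, fun K => ?_⟩, trivial⟩
  · rw [h2]
    have hw := witness_mem_islandEdge hω hg
    refine covBy_of_mem (w := witness ω g) inf_le_left ⟨trivial, hw⟩ ?_ ?_
    · rintro ⟨-, h⟩
      obtain ⟨a, ha⟩ := List.exists_mem_of_ne_nil _ (leaves_ne_nil g)
      exact witness_ne_zero hω hg ha (h a ha)
    · rintro t ⟨-, ht⟩
      obtain ⟨z, hz⟩ := exists_value ht
      refine ⟨z, ⟨trivial, sub_mem ht (Submodule.smul_mem _ _ hw)⟩, fun a ha => ?_⟩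
      refine mul_left_cancel₀ (pow_val_ne_zero hω a.1) ?_
      rw [Pi.sub_apply, Pi.smul_apply, smul_eq_mul]
      linear_combination hz a ha - z * witness_leaf hω hg a ha
  · have h3 : (⊤ : Submodule ℂ (Fin m → ℂ)) ⊓ (islands ω g).foldr (· ⊓ ·) ⊤ ⊓ zeroEdge g ≤
        diagHyp ω K := by
      rintro t ⟨-, ht⟩
      have ht0 : ∀ p, t p = 0 := fun p => by
        obtain ⟨a, ha, rfl⟩ := hall p
        exact ht a ha
      change t _ = _ * t _
      rw [ht0, ht0, mul_zero]
    have h4 : ¬ (⊤ : Submodule ℂ (Fin m → ℂ)) ≤ diagHyp ω K := by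
      intro h
      have h5 : (Pi.single K.1.1.1 1 : Fin m → ℂ) K.1.1.1 =
        ω ^ K.2.val * (Pi.single K.1.1.1 1 : Fin m → ℂ) K.1.1.2 := h trivial
      rw [Pi.single_eq_same, Pi.single_eq_of_ne K.1.2.ne', mul_zero] at h5
      exact one_ne_zero h5
    rw [Pi.sub_apply, h1.sum K, if_neg h4]
    by_cases h5 : (⊤ : Submodule ℂ (Fin m → ℂ)) ⊓ (islands ω g).foldr (· ⊓ ·) ⊤ ≤ diagHyp ω K
    · rw [if_pos h5, if_neg (fun h => h.2 h5)]; simp [allVec]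
    · rw [if_neg h5, if_pos ⟨h3, h5⟩]; simp [allVec]

end Flags

/-! ### The geometric form as a form on the exterior algebra -/

section Geometric

open ExteriorAlgebra

variable {T m : ℕ} [NeZero T] {ω : ℂ}

theorem iInf_lt_succ {M : Type*} [AddCommGroup M] [Module ℂ M] {n : ℕ} (H : Fin n → Submodule ℂ M)
    (i : Fin n) :
    (⨅ j : {j : Fin n // (j : ℕ) < (i : ℕ) + 1}, H j) = (⨅ j : {j : Fin n // (j : ℕ) < i}, H j) ⊓ H i := by
  refine le_antisymm (le_inf (le_iInf fun j => ?_) ?_) (le_iInf fun j => ?_)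
  · exact iInf_le_of_le ⟨j.1, j.2.trans (Nat.lt_succ_self _)⟩ le_rfl
  · exact iInf_le_of_le ⟨i, Nat.lt_succ_self _⟩ le_rfl
  · rcases Nat.lt_succ_iff_lt_or_eq.1 j.2 with h | h
    · exact inf_le_left.trans (iInf_le_of_le ⟨j.1, h⟩ le_rfl)
    · have : j.1 = i := Fin.ext h
      rw [this]; exact inf_le_right

/-- A flag consists of intersections of the given hyperplanes if and only if each hyperplane lies in
the support of the corresponding function. -/
theorem Adapted.flag_iff {Ss : List (Submodule ℂ (Fin m → ℂ))}
    {Ns : List (DiagIndex T m ⊕ Fin m → ℂ)} (h : Adapted ω ⊤ Ss Ns) (hn : Ns.length = m)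
    (K : Fin m → DiagIndex T m) :
    (∀ i : Fin (m + 1), (Ss.take i).foldr (· ⊓ ·) ⊤ =
      ⨅ j : {j : Fin m // (j : ℕ) < (i : ℕ)}, diagHyp ω (K j)) ↔
    ∀ i : Fin m, Ns[i] (.inl (K i)) = 1 := by
  classical
  have hget : ∀ i : Fin m,
      (Ss.take (i + 1)).foldr (· ⊓ ·) ⊤ ⋖ (Ss.take i).foldr (· ⊓ ·) ⊤ ∧
      ∀ K, (Ns[i]'(by rw [hn]; exact i.2)) (.inl K) =
        if (Ss.take (i + 1)).foldr (· ⊓ ·) ⊤ ≤ diagHyp ω K ∧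
          ¬ (Ss.take i).foldr (· ⊓ ·) ⊤ ≤ diagHyp ω K then 1 else 0 := by
    intro i
    have h1 := h.get i (by rw [hn]; exact i.2)
    rw [top_inf_eq, top_inf_eq] at h1
    refine ⟨h1.1, fun K => (h1.2 K).trans ?_⟩
    congr
  constructor
  · intro hL i
    obtain ⟨h1, h2⟩ := hget i
    have e1 : (Ss.take (i + 1)).foldr (· ⊓ ·) ⊤ = (Ss.take i).foldr (· ⊓ ·) ⊤ ⊓ diagHyp ω (K i) := by
      exact (hL i.succ).trans ((iInf_lt_succ (fun j => diagHyp ω (K j)) i).trans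
        (congrArg (· ⊓ diagHyp ω (K i)) (hL i.castSucc).symm))
    refine (h2 (K i)).trans (if_pos ⟨e1 ▸ inf_le_right, fun h3 => h1.ne ?_⟩)
    rw [e1, inf_eq_left]
    exact h3
  · rintro hN ⟨i, hi⟩
    change (Ss.take i).foldr (· ⊓ ·) ⊤ = ⨅ j : {j : Fin m // (j : ℕ) < i}, diagHyp ω (K j)
    induction i with
    | zero =>
      refine (eq_top_iff.2 ?_).symm
      exact le_iInf fun j => absurd j.2 (Nat.not_lt_zero _)
    | succ i ih =>
      have hi' : i < m := Nat.lt_of_succ_lt_succ hi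
      obtain ⟨h1, h2⟩ := hget ⟨i, hi'⟩
      have h3 := (h2 (K ⟨i, hi'⟩)).symm.trans (hN ⟨i, hi'⟩)
      have h4 := of_not_not fun hne => zero_ne_one ((if_neg hne).symm.trans h3)
      have h5 := iInf_lt_succ (fun j => diagHyp ω (K j)) ⟨i, hi'⟩
      refine Eq.trans ?_ h5.symm
      change _ = (⨅ j : {j : Fin m // (j : ℕ) < i}, diagHyp ω (K j)) ⊓ diagHyp ω (K ⟨i, hi'⟩)
      rw [← ih (hi'.trans (Nat.lt_succ_self m))]
      rcases h1.eq_or_eq (le_inf h1.le h4.1) inf_le_left with h6 | h6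
      · exact h6.symm
      · exact absurd (inf_eq_left.1 h6) h4.2

/-- The entries are 0 or 1, so the term of a permutation in the determinant is its sign if every
hyperplane is acquired at its step, which is the condition in the pairing, and 0 otherwise. -/
theorem pairing_commFlag (hω : IsPrimitiveRoot ω T) {g : FreeMagma (ZMod T × Fin m)}
    (hg : Distinct g) (hall : ∀ p, p ∈ indices g)
    (hn : (crossList g ++ [allVec T m - (crossList g).sum]).length = m)
    (H : Fin m → DiagIndex T m) :
    pairing (commFlag ω g) (diagHyp ω ∘ H) = (Matrix.of fun i j : Fin m =>
      (crossList g ++ [allVec T m - (crossList g).sum])[i] (.inl (H j))).det := by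
  classical
  have h := adapted_flag hω hg hall
  rw [← Matrix.det_transpose, Matrix.det_apply', pairing]
  refine sum_congr rfl fun s _ => ?_
  have h1 := h.flag_iff hn fun i => H (s i)
  simp only [Matrix.transpose_apply, Matrix.of_apply]
  by_cases h2 : ∀ i : Fin m, (crossList g ++ [allVec T m - (crossList g).sum])[i]
      (.inl (H (s i))) = 1
  · rw [prod_congr rfl fun i _ => h2 i, prod_const_one, mul_one]
    exact if_pos (h1.2 h2)
  · refine (if_neg fun h3 => h2 (h1.1 h3)).trans (Eq.symm ?_)
    push Not at h2
    obtain ⟨i, hi⟩ := h2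
    rw [prod_eq_zero (mem_univ i), mul_zero]
    have h3 := (h.get i (by rw [hn]; exact i.2)).2 (H (s i))
    refine h3.trans (if_neg fun h4 => hi (h3.trans (if_pos h4)))

theorem crossList_inr {g : FreeMagma (ZMod T × Fin m)} :
    ∀ w ∈ crossList g, ∀ p, w (.inr p) = 0 := by
  induction g with
  | ih1 a => simp [crossList]
  | ih2 x y hx hy =>
    intro w hw p
    rw [crossList_mul, List.mem_append, List.mem_append, List.mem_singleton] at hw
    rcases hw with (hw | hw) | rfl
    · exact hx w hw p
    · exact hy w hw p
    · exact crossVec_inr x y p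

theorem flagVecs_inr {g : FreeMagma (ZMod T × Fin m)} :
    ∀ w ∈ crossList g ++ [allVec T m - (crossList g).sum], ∀ p, w (.inr p) = 0 := by
  intro w hw p
  rw [List.mem_append, List.mem_singleton] at hw
  rcases hw with hw | rfl
  · exact crossList_inr w hw p
  · have h : ∀ l : List (DiagIndex T m ⊕ Fin m → ℂ), (∀ w ∈ l, ∀ p, w (.inr p) = 0) →
        l.sum (.inr p) = 0 := by
      intro l hl
      induction l with
      | nil => rfl
      | cons w l ih =>
        rw [List.sum_cons, Pi.add_apply, hl w List.mem_cons_self p,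
          ih fun w hw => hl w (List.mem_cons_of_mem _ hw), add_zero]
    rw [Pi.sub_apply, h _ crossList_inr]
    simp [allVec]

/-- The geometric form as a form on the exterior algebra. -/
theorem geomZero_eq_extForm (hω : IsPrimitiveRoot ω T) (a : DiagIndex T m → ℂ)
    {g g' : FreeMagma (ZMod T × Fin m)} (hg : (leaves g).length = m)
    (hg' : (leaves g').length = m) :
    geomZero ω a g g' = extForm (Sum.elim a 1) (ι ℂ (allVec T m) * ev g)
      (ι ℂ (allVec T m) * ev g') := by
  rw [allVec_mul_ev hg, allVec_mul_ev hg', map_smul, map_smul, LinearMap.smul_apply, geomZero]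
  by_cases h0 : flagSign g = 0
  · simp [h0]
  by_cases h0' : flagSign g' = 0
  · simp [h0']
  have hd := nodup_of_flagSign_ne_zero h0
  have hd' := nodup_of_flagSign_ne_zero h0'
  have hn : ∀ {g : FreeMagma (ZMod T × Fin m)}, (leaves g).length = m →
      (crossList g ++ [allVec T m - (crossList g).sum]).length = m := fun {g} hg => by
    rw [List.length_append, List.length_singleton, length_crossList, hg]
  have hall : ∀ {g : FreeMagma (ZMod T × Fin m)}, (∀ p, p ∈ (leaves g).map Prod.snd) →
      ∀ p, p ∈ indices g := fun h p => List.mem_map.1 (h p)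
  rw [extForm_wedge a (hn hg) (hn hg') flagVecs_inr flagVecs_inr, geomForm]
  simp only [pairing_commFlag hω hd.1 (hall hd.2) (hn hg),
    pairing_commFlag hω hd'.1 (hall hd'.2) (hn hg')]
  -- The factor m! of Cauchy-Binet over all tuples cancels the normalization of the geometric form.
  rw [sum_det_mul_det (fun (i : Fin m) (K : DiagIndex T m) =>
      ((crossList g ++ [allVec T m - (crossList g).sum])[i]'(by rw [hn hg]; exact i.2)) (.inl K))
    (fun (i : Fin m) (K : DiagIndex T m) =>
      ((crossList g' ++ [allVec T m - (crossList g').sum])[i]'(by rw [hn hg']; exact i.2)) (.inl K)) a,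
    mul_assoc, inv_mul_cancel_left₀ (Nat.cast_ne_zero.2 (Nat.factorial_ne_zero m)), smul_eq_mul,
    smul_eq_mul]
  ring

/-- A repeated index makes the product of the coordinate functions vanish. -/
theorem ev_eq_zero_of_not_distinct {g : FreeMagma (ZMod T × Fin m)} (hg : ¬ Distinct g) :
    ev g = 0 := by
  rw [ev_eq_wedge]
  have h : wedge (((leaves g).reverse.map Prod.snd).map (indexVec (T := T))) = 0 := by
    rw [wedge, List.map_map, List.map_reverse]
    have h1 : ¬ ((leaves g).map Prod.snd).reverse.Nodup := fun h => hg (List.nodup_reverse.1 h)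
    generalize ((leaves g).map Prod.snd).reverse = l at h1
    have h2 : ∀ l : List (Fin m), (l.map (ι ℂ ∘ indexVec (T := T))).prod =
        ιMulti ℂ l.length fun i => indexVec l[i] := by
      intro l
      rw [ιMulti_apply]
      congr 1
      apply List.ext_getElem <;> simp
    rw [h2]
    rw [List.nodup_iff_injective_get, Function.not_injective_iff] at h1
    obtain ⟨i, j, hij, hne⟩ := h1
    exact (ιMulti ℂ l.length).map_eq_zero_of_eq _ (congrArg (indexVec (T := T)) hij) hne
  rw [h, mul_zero, smul_zero]

/-- c(x, y) is symmetric, and each of the n - 1 joins interchanges two odd factors. -/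
theorem ev_mirror (g : FreeMagma (ZMod T × Fin m)) :
    ev (mirror g) = (-1 : ℂ) ^ ((leaves g).length + 1) • ev g := by
  induction g with
  | ih1 a => simp [mirror, leaves_of]
  | ih2 x y hx hy =>
    have h : crossVec (mirror y) (mirror x) = crossVec x y := by
      have hl : ∀ z : FreeMagma (ZMod T × Fin m), (leaves (mirror z)).Perm (leaves z) := by
        intro z
        induction z with
        | ih1 a => exact .refl _
        | ih2 x y hx hy =>
          exact (hy.append hx).trans List.perm_append_comm
      rw [crossVec_comm]
      ext j
      rw [crossVec, crossVec, treePair, treePair, ((hl x).map _).sum_eq]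
      congr 2
      ext a
      exact ((hl y).map _).sum_eq
    change ev (mirror y * mirror x) = _
    rw [ev_mul, h, hx, hy, smul_mul_smul_comm, ev_anticomm y x, ev_mul, mul_smul_comm, mul_neg,
      smul_neg, ← neg_smul, leaves_mul, List.length_append]
    congr 1
    ring

theorem length_leaves_mirror {α : Type*} (g : FreeMagma α) :
    (leaves (mirror g)).length = (leaves g).length := by
  induction g with
  | ih1 a => rfl
  | ih2 x y hx hy =>
    change (leaves (mirror y * mirror x)).length = _
    rw [leaves_mul, leaves_mul, List.length_append, List.length_append, hx, hy, add_comm]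

/-- The geometric form in terms of the cobracket. -/
theorem extForm_allVec_mul (a : DiagIndex T m → ℂ) (x y : Ext (DiagIndex T m ⊕ Fin m)) :
    extForm (Sum.elim a 1) (ι ℂ (allVec T m) * x) (ι ℂ (allVec T m) * y) =
      (∑ K, a K) * extForm (Sum.elim a 1) x y -
        extForm (Sum.elim a 1) (ctr (Sum.elim a 1) (allVec T m) x)
          (ctr (Sum.elim a 1) (allVec T m) y) := by
  rw [extForm_ι_mul, ctr_ι_mul, map_sub, map_smul, extForm_mul_ι, smul_eq_mul]
  congr 2
  rw [diagForm_apply, Fintype.sum_sum_type]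
  simp [allVec]

end Geometric

/-! ### Expansion of commutators into the generators with indices -/

section Expand

variable {R r T : ℕ} [NeZero T] (perm : Equiv.Perm (Fin R))

/-- The index of the generator attached to a leaf, if `p` has the index `col p`. -/
def leafRoot {m : ℕ} (col : Fin m → Fin R) (x : ZMod T × Fin m) : Fin R :=
  (perm ^ x.1.val) (col x.2)

variable (ι : Fin r → Fin R) (lam : Fin r → ℕ)

theorem sum_expand_of {M : Type*} [AddCommMonoid M] (a : Fin R)
    (f : FreeMagma (ZMod T × Fin (∑ i, lam i)) → M) :
    ∑ g ∈ expand perm ι T lam (.of a), f g =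
      ∑ x with leafRoot perm (fun p => ι (color lam p)) x = a, f (.of x) :=
  sum_image fun _ _ _ _ h => by cases h; rfl

theorem sum_expand_mul {M : Type*} [AddCommMonoid M] (u v : FreeMagma (Fin R))
    (f : FreeMagma (ZMod T × Fin (∑ i, lam i)) → M) :
    ∑ g ∈ expand perm ι T lam (u * v), f g =
      ∑ s ∈ expand perm ι T lam u, ∑ t ∈ expand perm ι T lam v, f (s * t) := by
  rw [← sum_product']
  refine sum_image ?_
  rintro ⟨x, y⟩ _ ⟨x', y'⟩ _ h
  cases h
  rfl

theorem map_leafRoot_of_mem_expand {u : FreeMagma (Fin R)}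
    {g : FreeMagma (ZMod T × Fin (∑ i, lam i))} (hg : g ∈ expand perm ι T lam u) :
    FreeMagma.map (leafRoot perm fun p => ι (color lam p)) g = u := by
  induction u generalizing g with
  | ih1 a =>
    obtain ⟨x, hx, rfl⟩ := mem_image.1 hg
    exact congrArg FreeMagma.of (mem_filter.1 hx).2
  | ih2 u v hu hv =>
    obtain ⟨s, hs, t, ht, rfl⟩ := mem_image₂.1 hg
    change FreeMagma.map _ (s * t) = _
    rw [map_mul, hu hs, hv ht]

theorem leaves_of_mem_expand {u : FreeMagma (Fin R)}
    {g : FreeMagma (ZMod T × Fin (∑ i, lam i))} (hg : g ∈ expand perm ι T lam u) :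
    (leaves g).map (leafRoot perm fun p => ι (color lam p)) = leaves u := by
  rw [← leaves_map, map_leafRoot_of_mem_expand perm ι lam hg]

/-- Expansion is compatible with brackets and keeps the generator attached to each leaf. The
coefficients depend only on these generators, so splitting and expanding commute. -/
theorem sum_expand_cobSum {V : Type*} [AddCommGroup V] [Module ℂ V] (b : Fin R → Fin R → ℂ)
    (u : FreeMagma (Fin R))
    (Φ : FreeMagma (ZMod T × Fin (∑ i, lam i)) → FreeMagma (ZMod T × Fin (∑ i, lam i)) → V) :
    ∑ g ∈ expand perm ι T lam u, cobSum (fun p q =>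
        b (leafRoot perm (fun p => ι (color lam p)) p) (leafRoot perm (fun p => ι (color lam p)) q))
        g Φ =
      cobSum b u fun s t => ∑ x ∈ expand perm ι T lam s, ∑ y ∈ expand perm ι T lam t, Φ x y := by
  induction u generalizing Φ with
  | ih1 a => rw [sum_expand_of]; exact sum_eq_zero fun x _ => rfl
  | ih2 u v hu hv =>
    have h1 : ∀ x ∈ expand perm ι T lam u, ∀ y ∈ expand perm ι T lam v, treePair (fun p q =>
        b (leafRoot perm (fun p => ι (color lam p)) p) (leafRoot perm (fun p => ι (color lam p)) q))
        x y = treePair b u v := fun x hx y hy => by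
      rw [← treePair_map, map_leafRoot_of_mem_expand perm ι lam hx,
        map_leafRoot_of_mem_expand perm ι lam hy]
    rw [sum_expand_mul, cobSum_mul]
    simp only [cobSum_mul, sum_add_distrib]
    congr 1
    · congr 1
      · rw [smul_sub, smul_sum, sum_comm (s := expand perm ι T lam v), smul_sum,
          ← sum_sub_distrib]
        refine sum_congr rfl fun x hx => ?_
        rw [smul_sum, smul_sum, ← sum_sub_distrib]
        refine sum_congr rfl fun y hy => ?_
        rw [h1 x hx y hy, smul_sub]
      · simp only [← cobSum_sum]
        rw [hu]
        refine cobSum_congr _ _ fun s t _ => ?_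
        simp only [sum_expand_mul, sum_add_distrib]
        congr 1
        refine sum_congr rfl fun x _ => sum_comm
    · rw [sum_comm]
      simp only [← cobSum_sum]
      rw [hv]
      refine cobSum_congr _ _ fun s t _ => ?_
      simp only [sum_expand_mul, sum_add_distrib]
      congr 1
      · rw [sum_comm (s := expand perm ι T lam u)]
        refine sum_congr rfl fun x _ => sum_comm
      · refine sum_congr rfl fun x _ => sum_comm

end Expand

/-! ### Cobracket pairings with a fixed shift -/

section Shift

variable {R T m : ℕ} (b : ZMod T × Fin m → ZMod T × Fin m → ℂ) (j : ZMod T)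

/-- The pairing of two bracketings in which the first one is shifted by `j`, with coefficients `b`. -/
def shiftForm : FreeMagma (ZMod T × Fin m) → FreeMagma (ZMod T × Fin m) → ℂ
  | .of a, g => open Classical in if g = .of (a.1 + j, a.2) then 1 else 0
  | .mul x y, g => cobSum b g fun s t => shiftForm x s * shiftForm y t

theorem shiftForm_mul (x y g : FreeMagma (ZMod T × Fin m)) :
    shiftForm b j (x * y) g = cobSum b g fun s t => shiftForm b j x s * shiftForm b j y t := rfl

theorem shiftForm_support {x g : FreeMagma (ZMod T × Fin m)} (h : shiftForm b j x g ≠ 0) :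
    ∀ q ∈ leaves g, ∃ a ∈ leaves x, q = (a.1 + j, a.2) := by
  induction x generalizing g with
  | ih1 a =>
    have hg : g = .of (a.1 + j, a.2) := of_not_not fun hne => h (if_neg hne)
    subst hg
    intro q hq
    exact ⟨a, List.mem_singleton_self a, List.mem_singleton.1 hq⟩
  | ih2 x y hx hy =>
    by_contra hq
    refine h (cobSum_eq_zero b g fun s t hst => ?_)
    by_contra hne
    refine hq fun q hq => ?_
    rcases List.mem_append.1 (hst.mem_iff.2 hq) with hq | hq
    · obtain ⟨a, ha, rfl⟩ := hx (left_ne_zero_of_mul hne) q hq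
      exact ⟨a, List.mem_append_left _ ha, rfl⟩
    · obtain ⟨a, ha, rfl⟩ := hy (right_ne_zero_of_mul hne) q hq
      exact ⟨a, List.mem_append_right _ ha, rfl⟩

theorem treePair_eq_of_nodup {α : Type*} {b : α → α → ℂ} {x y : FreeMagma α}
    (hx : (leaves x).Nodup) (hy : (leaves y).Nodup) {a₀ b₀ : α} (ha : a₀ ∈ leaves x)
    (hb : b₀ ∈ leaves y)
    (h : ∀ p ∈ leaves x, ∀ q ∈ leaves y, b p q ≠ 0 → p = a₀ ∧ q = b₀) :
    treePair b x y = b a₀ b₀ := by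
  classical
  rw [treePair, ← List.sum_toFinset _ hx, sum_eq_single a₀, ← List.sum_toFinset _ hy,
    sum_eq_single b₀]
  · intro q hq hne
    by_contra h0
    exact hne (h a₀ ha q (List.mem_toFinset.1 hq) h0).2
  · exact fun h0 => absurd (List.mem_toFinset.2 hb) h0
  · intro p hp hne
    refine List.sum_eq_zero fun z hz => ?_
    obtain ⟨q, hq, rfl⟩ := List.mem_map.1 hz
    by_contra h0
    exact hne (h p (List.mem_toFinset.1 hp) q hq h0).1
  · exact fun h0 => absurd (List.mem_toFinset.2 ha) h0

variable [NeZero T]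

theorem exists_joins {a b : ZMod T × Fin m} (h : a.2 ≠ b.2) : ∃ K, Joins a b K := by
  rcases lt_or_gt_of_ne h with h | h
  · exact ⟨⟨⟨(a.2, b.2), h⟩, b.1 - a.1⟩, .inl ⟨rfl, rfl, rfl⟩⟩
  · exact ⟨⟨⟨(b.2, a.2), h⟩, a.1 - b.1⟩, .inr ⟨rfl, rfl, rfl⟩⟩

theorem Joins.unique {a b : ZMod T × Fin m} {K K' : DiagIndex T m} (h : Joins a b K)
    (h' : Joins a b K') : K = K' := by
  obtain ⟨⟨⟨p, q⟩, hpq⟩, k⟩ := K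
  obtain ⟨⟨⟨p', q'⟩, hpq'⟩, k'⟩ := K'
  simp only [Joins] at h h' hpq hpq'
  rcases h with ⟨rfl, rfl, rfl⟩ | ⟨rfl, rfl, rfl⟩ <;>
  rcases h' with ⟨rfl, rfl, rfl⟩ | ⟨rfl, rfl, rfl⟩
  · rfl
  · exact absurd hpq hpq'.asymm
  · exact absurd hpq hpq'.asymm
  · rfl

theorem diagForm_edgeVec (c w : DiagIndex T m ⊕ Fin m → ℂ) {a b : ZMod T × Fin m}
    {K : DiagIndex T m} (h : Joins a b K) :
    diagForm c w (edgeVec a b) = c (.inl K) * w (.inl K) := by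
  rw [diagForm_apply, sum_eq_single (.inl K)]
  · simp [edgeVec, h]
  · intro j _ hj
    have : edgeVec a b j = 0 := by
      by_contra h0
      obtain ⟨K', rfl, hK'⟩ := edgeVec_ne_zero h0
      exact hj (congrArg _ (hK'.unique h))
    rw [this, mul_zero]
  · exact fun h0 => absurd (mem_univ _) h0

/-- The exponent of the hyperplane depends only on the difference of the two exponents at the
leaves. -/
theorem joins_shift {a b : ZMod T × Fin m} {K : DiagIndex T m} (hab : a.2 ≠ b.2) (h : Joins a b K)
    (i j : ZMod T) : Joins (a.1 + i, a.2) (b.1 + j, b.2) K ↔ i = j := by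
  constructor
  · rcases h with ⟨h1, h2, h3⟩ | ⟨h1, h2, h3⟩ <;> rintro (⟨h4, h5, h6⟩ | ⟨h4, h5, h6⟩)
    · rw [h3] at h6; linear_combination h6
    · exact absurd (h1.symm.trans h4) hab
    · exact absurd (h2.symm.trans h5) hab
    · rw [h3] at h6; linear_combination -h6
  · rintro rfl
    simpa [Joins] using h

end Shift

/-! ### Comparison with the invariant form -/

section ShiftForm

theorem sum_zmod_val {M : Type*} [AddCommMonoid M] {T : ℕ} [NeZero T] (f : ℕ → M) :
    ∑ j : ZMod T, f j.val = ∑ j ∈ range T, f j := by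
  refine sum_bij (fun j _ => j.val) (fun j _ => mem_range.2 (ZMod.val_lt j))
    (fun _ _ _ _ h => ZMod.val_injective T h) (fun n hn => ?_) fun _ _ => rfl
  exact ⟨n, mem_univ _, ZMod.val_cast_of_lt (mem_range.1 hn)⟩

variable {R : ℕ} {𝔥 : Type*} [AddCommGroup 𝔥] [Module ℂ 𝔥] [FiniteDimensional ℂ 𝔥]
  {D : CartanData R 𝔥} {L : Type*} [LieRing L] [LieAlgebra ℂ L] {C : D.Chevalley L}

namespace CartanData.Chevalley.DiagramSymmetry

variable {σ : C.DiagramSymmetry} {K : LinearMap.BilinForm ℂ L} (hK : C.IsForm K)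
  {T : ℕ} [NeZero T] (hT : σ.aut.toLinearEquiv ^ T = 1)
include hK

theorem cartan_perm_pow (n : ℕ) (i j : Fin R) :
    D.cartan ((σ.perm ^ n) i) ((σ.perm ^ n) j) = D.cartan i j := by
  induction n with
  | zero => rfl
  | succ n ih => rw [pow_succ', Equiv.Perm.mul_apply, Equiv.Perm.mul_apply, σ.cartan_perm hK, ih]

include hT

theorem perm_pow_val_add (k l : ZMod T) :
    σ.perm ^ (k + l).val = σ.perm ^ k.val * σ.perm ^ l.val := by
  rw [ZMod.val_add, ← pow_add]
  conv_rhs => rw [← Nat.mod_add_div (k.val + l.val) T, pow_add, pow_mul, σ.perm_pow_eq_one hK hT,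
    one_pow, mul_one]

theorem cartan_leafRoot {m : ℕ} (col : Fin m → Fin R) (a b : ZMod T × Fin m) :
    D.cartan (leafRoot σ.perm col a) (leafRoot σ.perm col b) =
      D.cartan (col a.2) ((σ.perm ^ (b.1 - a.1).val) (col b.2)) := by
  have h : σ.perm ^ b.1.val = σ.perm ^ a.1.val * σ.perm ^ (b.1 - a.1).val := by
    rw [← perm_pow_val_add hK hT, add_sub_cancel]
  rw [leafRoot, leafRoot, h, Equiv.Perm.mul_apply, cartan_perm_pow hK]

omit hK hT in
/-- The weights of the hyperplanes, for indices `p` with the generators `col p`, and of the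
coordinates. -/
def leafWeight (σ : C.DiagramSymmetry) (T : ℕ) {m : ℕ} (col : Fin m → Fin R) :
    DiagIndex T m ⊕ Fin m → ℂ :=
  Sum.elim (fun K => D.cartan (col K.1.1.1) ((σ.perm ^ K.2.val) (col K.1.1.2))) 1

variable {m : ℕ} (col : Fin m → Fin R)

theorem leafWeight_of_joins {a b : ZMod T × Fin m} {H : DiagIndex T m} (h : Joins a b H) :
    leafWeight σ T col (.inl H) =
      D.cartan (leafRoot σ.perm col a) (leafRoot σ.perm col b) := by
  change D.cartan (col H.1.1.1) ((σ.perm ^ H.2.val) (col H.1.1.2)) = _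
  rcases h with ⟨h1, h2, h3⟩ | ⟨h1, h2, h3⟩
  · rw [cartan_leafRoot hK hT, h1, h2, h3]
  · rw [D.cartan_symm (leafRoot _ _ _), cartan_leafRoot hK hT, h1, h2, h3]

/-- The coefficients of the cobracket on a pair of shifted leaves. -/
theorem diagForm_crossVec_shift {x y : FreeMagma (ZMod T × Fin m)} (hd : Distinct (x * y))
    {a b : ZMod T × Fin m} (ha : a ∈ leaves x) (hb : b ∈ leaves y) (i j : ZMod T) :
    diagForm (leafWeight σ T col) (crossVec x y) (edgeVec (a.1 + i, a.2) (b.1 + j, b.2)) =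
      if i = j then D.cartan (leafRoot σ.perm col (a.1 + i, a.2))
        (leafRoot σ.perm col (b.1 + j, b.2)) else 0 := by
  obtain ⟨hx, hy, hxy⟩ := distinct_mul.1 hd
  have hab : a.2 ≠ b.2 := fun h =>
    Set.disjoint_left.1 hxy (mem_indices ha) (h ▸ mem_indices hb)
  obtain ⟨H, hH⟩ := exists_joins hab
  have inj : ∀ {z : FreeMagma (ZMod T × Fin m)}, Distinct z → ∀ {p q}, p ∈ leaves z →
      q ∈ leaves z → p.2 = q.2 → p = q := fun hz _ _ hp hq h =>
    List.inj_on_of_nodup_map hz hp hq h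
  rw [diagForm_comm, diagForm_crossVec, treePair_eq_of_nodup hx.of_map hy.of_map ha hb,
    diagForm_edgeVec _ _ hH]
  · have h1 := joins_shift hab hH i j
    split_ifs with hij
    · rw [leafWeight_of_joins hK hT col (h1.2 hij), edgeVec, Sum.elim_inl, if_pos (h1.2 hij),
        mul_one]
    · rw [edgeVec, Sum.elim_inl, if_neg (mt h1.1 hij), mul_zero]
  · intro p hp q hq hne
    have hpq : p.2 ≠ q.2 := fun h =>
      Set.disjoint_left.1 hxy (mem_indices hp) (h ▸ mem_indices hq)
    obtain ⟨H', hH'⟩ := exists_joins hpq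
    rw [diagForm_edgeVec _ _ hH'] at hne
    obtain ⟨_, h1, h2⟩ := edgeVec_ne_zero (right_ne_zero_of_mul hne)
    cases h1
    have hswap : ∀ {c d}, c ∈ leaves x → d ∈ leaves y → c.2 ≠ d.2 := fun hc hd h =>
      Set.disjoint_left.1 hxy (mem_indices hc) (h ▸ mem_indices hd)
    rcases joins_mem hH' with ⟨h3, h4⟩ | ⟨h3, h4⟩ <;> rcases joins_mem h2 with ⟨h5, h6⟩ | ⟨h5, h6⟩
    · exact ⟨inj hx hp ha (h3.symm.trans h5), inj hy hq hb (h4.symm.trans h6)⟩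
    · exact (hswap hp hb (h3.symm.trans h5)).elim
    · exact (hswap ha hq (h5.symm.trans h3)).elim
    · exact ⟨inj hx hp ha (h4.symm.trans h6), inj hy hq hb (h3.symm.trans h5)⟩

/-- The form on bracketings is the sum of its shifted forms. -/
theorem extForm_ev_eq_sum {x : FreeMagma (ZMod T × Fin m)} (hx : Distinct x)
    (g : FreeMagma (ZMod T × Fin m)) :
    extForm (leafWeight σ T col) (ev x) (ev g) = ∑ j, shiftForm (fun p q =>
      D.cartan (leafRoot σ.perm col p) (leafRoot σ.perm col q)) j x g := by
  classical
  set b := fun p q => D.cartan (leafRoot σ.perm col p) (leafRoot σ.perm col q) with hb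
  induction x generalizing g with
  | ih1 a =>
    have h : ∀ j, shiftForm b j (.of a) g = if g = .of (a.1 + j, a.2) then 1 else 0 := fun j => by
      rw [shiftForm]
    simp only [h]
    induction g with
    | ih1 c =>
      rw [extForm_ev_of_of]
      split_ifs with hac
      · rw [sum_eq_single (c.1 - a.1), if_pos]
        · rfl
        · rw [add_sub_cancel, hac]
        · intro j _ hj
          refine if_neg fun h => hj ?_
          cases h
          simp
        · exact fun h => absurd (mem_univ _) h
      · refine (sum_eq_zero fun j _ => if_neg fun h => hac ?_).symm
        cases h
        rfl
    | ih2 s t _ _ =>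
      rw [extForm_ev_of_mul]
      refine (sum_eq_zero fun j _ => if_neg fun h => ?_).symm
      cases h
  | ih2 x y ihx ihy =>
    obtain ⟨hx1, hy1, hxy⟩ := distinct_mul.1 hx
    rw [extForm_ev_bracket _ hxy]
    simp only [ihx hx1, ihy hy1, shiftForm_mul, sum_mul_sum, cobSum_sum]
    refine sum_congr rfl fun i _ => ?_
    -- If x is shifted by i and y by j ≠ i, no hyperplane of c(x, y) joins the shifted leaves, so
    -- all coefficients vanish. For i = j they are the coefficients of the Cartan matrix.
    rw [sum_eq_single i]
    · refine cobSum_congr_of_coeff g fun s t _ p hp q hq hne => ?_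
      obtain ⟨a, ha, rfl⟩ := shiftForm_support b i (left_ne_zero_of_mul hne) p hp
      obtain ⟨c, hc, rfl⟩ := shiftForm_support b i (right_ne_zero_of_mul hne) q hq
      have h := diagForm_crossVec_shift hK hT col hx ha hc i i
      rw [if_pos rfl] at h
      refine ⟨h, ?_⟩
      rw [edgeVec_comm, h, hb]
      exact D.cartan_symm _ _
    · intro j _ hj
      refine cobSum_eq_zero_of_coeff g fun s t _ p hp q hq hpq => ?_
      by_contra hne
      obtain ⟨a, ha, rfl⟩ := shiftForm_support b i (left_ne_zero_of_mul hne) p hp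
      obtain ⟨c, hc, rfl⟩ := shiftForm_support b j (right_ne_zero_of_mul hne) q hq
      rw [edgeVec_comm (c.1 + j, c.2), or_self, diagForm_crossVec_shift hK hT col hx ha hc i j] at hpq
      exact hpq (if_neg hj.symm)
    · exact fun h => absurd (mem_univ _) h

variable {r : ℕ} (ι : Fin r → Fin R) (lam : Fin r → ℕ)

omit hT in
/-- The shifted forms compute the invariant form. -/
theorem sum_expand_shiftForm (j : ZMod T) (x : FreeMagma (ZMod T × Fin (∑ i, lam i)))
    (u : FreeMagma (Fin R)) :
    ∑ g ∈ expand σ.perm ι T lam u, shiftForm (fun p q =>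
      D.cartan (leafRoot σ.perm (fun p => ι (color lam p)) p)
        (leafRoot σ.perm (fun p => ι (color lam p)) q)) j x g =
      K (commutator C.E (FreeMagma.map
        (fun a => leafRoot σ.perm (fun p => ι (color lam p)) (a.1 + j, a.2)) x))
        (commutator C.F u) := by
  classical
  set b := fun p q => D.cartan (leafRoot σ.perm (fun p => ι (color lam p)) p)
        (leafRoot σ.perm (fun p => ι (color lam p)) q) with hb
  induction x generalizing u with
  | ih1 a =>
    have h : ∀ g, shiftForm b j (.of a) g = if g = .of (a.1 + j, a.2) then 1 else 0 := fun g => by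
      rw [shiftForm]
    simp only [h]
    induction u with
    | ih1 c =>
      rw [sum_expand_of]
      refine Eq.trans ?_ (hK.EF (leafRoot σ.perm (fun p => ι (color lam p)) (a.1 + j, a.2)) c).symm
      have h1 : ∀ x : ZMod T × Fin (∑ i, lam i), (FreeMagma.of x = .of (a.1 + j, a.2)) ↔
          x = (a.1 + j, a.2) := fun x => ⟨fun h => by cases h; rfl, fun h => congrArg _ h⟩
      simp only [h1]
      rw [sum_ite_eq']
      simp
    | ih2 u v _ _ =>
      rw [sum_expand_mul]
      have h2 := hK.commF_eq_zero (C.commE_mem_grade (.of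
        (leafRoot σ.perm (fun p => ι (color lam p)) (a.1 + j, a.2)))) (u := u * v) (by
          have := leaves_length_pos u
          have := leaves_length_pos v
          rw [leaves_mul, List.length_append]
          simp only [leaves_of, List.length_singleton]
          omega)
      refine Eq.trans ?_ h2.symm
      refine sum_eq_zero fun s _ => sum_eq_zero fun t _ => if_neg fun h => ?_
      cases h
  | ih2 x y hx hy =>
    simp only [shiftForm_mul]
    have hp : ∀ w, commutator C.E w ∈ C.pos := fun w => Submodule.subset_span ⟨w, rfl⟩
    rw [sum_expand_cobSum, map_mul, commutator_mul, hK.form_lie_commF u (hp _) (hp _)]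
    refine cobSum_congr _ _ fun s t _ => ?_
    rw [← sum_mul_sum, hx, hy]

/-- The form on bracketings computes the invariant form on projected commutators. -/
theorem sum_expand_extForm {x : FreeMagma (ZMod T × Fin (∑ i, lam i))} (hx : Distinct x)
    (u : FreeMagma (Fin R)) :
    ∑ g ∈ expand σ.perm ι T lam u,
      extForm (leafWeight σ T fun p => ι (color lam p)) (ev x) (ev g) =
      K (commutator C.E (FreeMagma.map (leafRoot σ.perm fun p => ι (color lam p)) x))
        (σ.bar T (commutator C.F u)) := by
  have hp : ∀ w, commutator C.E w ∈ C.pos := fun w => Submodule.subset_span ⟨w, rfl⟩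
  simp only [extForm_ev_eq_sum hK hT _ hx]
  rw [sum_comm, ← σ.form_bar hK hT (NeZero.ne T) (hp _), bar_apply, map_sum, LinearMap.sum_apply]
  simp only [sum_expand_shiftForm hK]
  -- A shift of all exponents by j acts on the attached generators as σ^j, so the sum over the
  -- shifts is the bar.
  have h : ∀ j : ZMod T, FreeMagma.map
      (fun a => leafRoot σ.perm (fun p => ι (color lam p)) (a.1 + j, a.2)) x =
      FreeMagma.map (σ.perm ^ j.val)
        (FreeMagma.map (leafRoot σ.perm fun p => ι (color lam p)) x) := by
    intro j
    clear hx
    induction x with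
    | ih1 a =>
      refine congrArg FreeMagma.of ?_
      change (σ.perm ^ (a.1 + j).val) _ = (σ.perm ^ j.val) ((σ.perm ^ a.1.val) _)
      rw [add_comm, perm_pow_val_add hK hT]
      rfl
    | ih2 x y hx hy => simp only [map_mul, hx, hy]
  simp only [h, ← pow_commE]
  exact sum_zmod_val fun j => K ((σ.aut.toLinearEquiv ^ j) (commutator C.E
    (FreeMagma.map (leafRoot σ.perm fun p => ι (color lam p)) x))) (commutator C.F u)

end CartanData.Chevalley.DiagramSymmetry
end ShiftForm

/-! ### Vanishing of the symmetrized geometric form -/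

section Vanishing

/-- Each contraction is half of a cobracket, while the antisymmetrized pairing of the products
contributes a factor 2; this leaves one 2 on the left. -/
theorem extForm_ctr_ctr {T m : ℕ} [NeZero T] (c : DiagIndex T m ⊕ Fin m → ℂ)
    {w : DiagIndex T m ⊕ Fin m → ℂ} (hw : ∀ p, w (.inr p) = 0)
    {h : FreeMagma (ZMod T × Fin m)} (hh : Distinct h) (g : FreeMagma (ZMod T × Fin m)) :
    2 * extForm c (ctr c w (ev h)) (ctr c w (ev g)) =
      cobSum (fun a b => diagForm c w (edgeVec a b)) h fun s t =>
        cobSum (fun a b => diagForm c w (edgeVec a b)) g fun s' t' =>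
          extForm c (ev s) (ev s') * extForm c (ev t) (ev t') := by
  have h1 : extForm c ((2 : ℂ) • ctr c w (ev h)) ((2 : ℂ) • ctr c w (ev g)) =
      cobSum (fun a b => diagForm c w (edgeVec a b)) h fun s t =>
        (2 : ℂ) • cobSum (fun a b => diagForm c w (edgeVec a b)) g fun s' t' =>
          extForm c (ev s) (ev s') * extForm c (ev t) (ev t') := by
    rw [ctr_ev c hw h, extForm_comm, map_cobSum]
    refine cobSum_congr _ _ fun s t hst => ?_
    have hd : Disjoint (indices s) (indices t) := by
      refine (distinct_mul.1 ?_ : Distinct s ∧ Distinct t ∧ _).2.2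
      exact (hst.map Prod.snd).nodup_iff.2 hh
    rw [extForm_comm, ctr_ev c hw g, map_cobSum]
    simp only [extForm_ev_mul_ev c hd, sub_eq_add_neg, cobSum_add]
    have h2 := cobSum_flip (fun a b => diagForm c w (edgeVec a b)) g fun s' t' =>
      extForm c (ev s) (ev s') * extForm c (ev t) (ev t')
    have h3 := cobSum_smul (fun a b => diagForm c w (edgeVec a b)) g (-1) fun s' t' =>
      extForm c (ev s) (ev t') * extForm c (ev t) (ev s')
    simp only [neg_one_smul] at h3
    rw [h3, h2, neg_neg, two_smul]
  rw [cobSum_smul, map_smul, map_smul, LinearMap.smul_apply, smul_eq_mul, smul_eq_mul,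
    smul_eq_mul] at h1
  exact mul_left_cancel₀ two_ne_zero h1

theorem sum_leaves_of_distinct {T m : ℕ} {g : FreeMagma (ZMod T × Fin m)} (hg : Distinct g)
    (hm : (leaves g).length = m) (f : Fin m → ℂ) :
    ((leaves g).map fun a => f a.2).sum = ∑ p, f p := by
  classical
  have h : ((leaves g).map Prod.snd).toFinset = univ := by
    rw [← card_eq_iff_eq_univ, List.toFinset_card_of_nodup hg, List.length_map, hm, Fintype.card_fin]
  rw [← h, List.sum_toFinset _ hg, List.map_map]
  rfl

/-- Every unordered pair of different indices is counted twice in the full double sum, once its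
diagonal is removed. -/
theorem two_mul_sum_diagIndex {T m : ℕ} [NeZero T] (a : DiagIndex T m → ℂ) (f : Fin m → Fin m → ℂ)
    (hf : ∀ p q, f p q = f q p) (ha : ∀ x, ∑ k, a (x, k) = f x.1.1 x.1.2) :
    2 * ∑ H, a H = ∑ p, ∑ q, f p q - ∑ p, f p p := by
  have h1 : ∑ H, a H = ∑ p, ∑ q, if p < q then f p q else 0 := by
    rw [Fintype.sum_prod_type]
    simp only [ha]
    rw [← Fintype.sum_prod_type' fun p q => if p < q then f p q else 0, ← sum_filter,
      sum_subtype (p := fun x : Fin m × Fin m => x.1 < x.2) _ (by simp)]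
  have h2 : ∑ p, ∑ q, f p q = ∑ p, ∑ q, (if p < q then f p q else 0) +
      ∑ p, ∑ q, (if q < p then f p q else 0) + ∑ p, f p p := by
    rw [← sum_add_distrib, ← sum_add_distrib]
    refine sum_congr rfl fun p _ => ?_
    have h3 : f p p = ∑ q, if q = p then f p q else 0 := by simp
    rw [h3, ← sum_add_distrib, ← sum_add_distrib]
    refine sum_congr rfl fun q _ => ?_
    rcases lt_trichotomy p q with h | h | h
    · simp [h, h.not_gt, h.ne']
    · simp [h]
    · simp [h, h.not_gt, h.ne]
  have h3 : ∑ p, ∑ q, (if q < p then f p q else 0) = ∑ p, ∑ q, if p < q then f p q else 0 := by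
    rw [sum_comm]
    exact sum_congr rfl fun p _ => sum_congr rfl fun q _ => by rw [hf]
  rw [h2, h3, h1]
  ring

variable {R : ℕ} {𝔥 : Type*} [AddCommGroup 𝔥] [Module ℂ 𝔥] [FiniteDimensional ℂ 𝔥]
  {D : CartanData R 𝔥} {L : Type*} [LieRing L] [LieAlgebra ℂ L] {C : D.Chevalley L}

namespace CartanData.Chevalley.DiagramSymmetry

variable {σ : C.DiagramSymmetry} {K : LinearMap.BilinForm ℂ L} (hK : C.IsForm K)
  {T : ℕ} [NeZero T] (hT : σ.aut.toLinearEquiv ^ T = 1)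
include hK hT

/-- Replace k by -k and use the invariance of the Cartan matrix under the permutation. -/
theorem orbitCartan_comm (a b : Fin R) : orbitCartan σ T a b = orbitCartan σ T b a := by
  rw [orbitCartan, orbitCartan, ← sum_zmod_val fun j => D.cartan a ((σ.perm ^ j) b),
    ← sum_zmod_val fun j => D.cartan b ((σ.perm ^ j) a)]
  refine Fintype.sum_equiv (Equiv.neg _) _ _ fun k => ?_
  rw [← cartan_perm_pow hK (-k).val, ← Equiv.Perm.mul_apply, ← perm_pow_val_add hK hT,
    neg_add_cancel, ZMod.val_zero, pow_zero, D.cartan_symm]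
  rfl

theorem orbitCartan_perm_pow (n : ℕ) (a b : Fin R) :
    orbitCartan σ T ((σ.perm ^ n) a) b = orbitCartan σ T a b := by
  induction n with
  | zero => rfl
  | succ n ih => rw [pow_succ', Equiv.Perm.mul_apply, orbitCartan_perm hK hT (NeZero.ne T), ih]

theorem orbitCartan_perm_pow_right (n : ℕ) (a b : Fin R) :
    orbitCartan σ T a ((σ.perm ^ n) b) = orbitCartan σ T a b := by
  rw [orbitCartan_comm hK hT, orbitCartan_perm_pow hK hT, orbitCartan_comm hK hT]

variable {B : Type} [Fintype B] (δ : σ.DualFamily K B) {ω : ℂ} (hω : IsPrimitiveRoot ω T)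
  {r : ℕ} (ι : Fin r → Fin R) (lam : Fin r → ℕ)

/-- The coefficients of the cobracket on leaves with different indices. -/
theorem diagForm_allVec {m : ℕ} (col : Fin m → Fin R) {a b : ZMod T × Fin m} (h : a.2 ≠ b.2) :
    diagForm (leafWeight σ T col) (allVec T m) (edgeVec a b) =
      D.cartan (leafRoot σ.perm col a) (leafRoot σ.perm col b) := by
  obtain ⟨H, hH⟩ := exists_joins h
  rw [diagForm_edgeVec _ _ hH, leafWeight_of_joins hK hT col hH]
  exact mul_one _

/-- The non-zero terms have factors with disjoint indices. On those the coefficients of the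
contraction by all hyperplanes are the entries of the Cartan matrix, and both cobrackets descend
from the expansions to v and u. -/
theorem sum_expand_extForm_ctr {h : FreeMagma (ZMod T × Fin (∑ i, lam i))} (hh : Distinct h)
    (u : FreeMagma (Fin R)) :
    2 * ∑ g ∈ expand σ.perm ι T lam u, extForm (leafWeight σ T fun p => ι (color lam p))
      (ctr (leafWeight σ T fun p => ι (color lam p)) (allVec T _) (ev h))
      (ctr (leafWeight σ T fun p => ι (color lam p)) (allVec T _) (ev g)) =
    cobSum D.cartan (FreeMagma.map (leafRoot σ.perm fun p => ι (color lam p)) h) fun v₁ v₂ =>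
      cobSum D.cartan u fun u₁ u₂ =>
        K (commutator C.E v₁) (σ.bar T (commutator C.F u₁)) *
          K (commutator C.E v₂) (σ.bar T (commutator C.F u₂)) := by
  have hst : ∀ {s t : FreeMagma (ZMod T × Fin (∑ i, lam i))},
      (leaves s ++ leaves t).Perm (leaves h) → Distinct (s * t) := fun hst =>
    (hst.map Prod.snd).nodup_iff.2 hh
  have hne : ∀ {X Y : Set (Fin (∑ i, lam i))} {p q}, Disjoint X Y → p ∈ X → q ∈ Y → p ≠ q :=
    fun hd hp hq he => Set.disjoint_left.1 hd hp (he ▸ hq)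
  rw [mul_sum]
  simp only [extForm_ctr_ctr (leafWeight σ T fun p => ι (color lam p)) (w := allVec T _)
    (fun _ => rfl) hh]
  rw [← cobSum_sum, cobSum_map]
  refine (cobSum_congr_of_coeff h fun s t h1 p hp q hq _ => ?_).trans
    (cobSum_congr _ h fun s t h1 => ?_)
  · have h2 := hne (distinct_mul.1 (hst h1)).2.2 (mem_indices hp) (mem_indices hq)
    exact ⟨diagForm_allVec hK hT _ h2, diagForm_allVec hK hT _ h2.symm⟩
  · obtain ⟨hs, ht, hd⟩ := distinct_mul.1 (hst h1)
    simp only [← sum_expand_extForm hK hT ι lam hs, ← sum_expand_extForm hK hT ι lam ht,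
      sum_mul_sum]
    rw [← sum_expand_cobSum σ.perm ι lam D.cartan u fun s' t' =>
      extForm (leafWeight σ T fun p => ι (color lam p)) (ev s) (ev s') *
        extForm (leafWeight σ T fun p => ι (color lam p)) (ev t) (ev t')]
    refine sum_congr rfl fun g _ => cobSum_congr_of_coeff g fun s' t' _ p hp q hq h0 => ?_
    have h2 : p.2 ≠ q.2 := hne hd
      (indices_eq_of_extForm_ne_zero _ (left_ne_zero_of_mul h0) ▸ mem_indices hp)
      (indices_eq_of_extForm_ne_zero _ (right_ne_zero_of_mul h0) ▸ mem_indices hq)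
    exact ⟨diagForm_allVec hK hT _ h2, diagForm_allVec hK hT _ h2.symm⟩

include δ hω in
/-- The geometric form vanishes on symmetrized commutators. -/
theorem sum_geomZero_eq_zero {v u : FreeMagma (Fin R)} (hv : (leaves v).length = ∑ i, lam i)
    (hu : (leaves u).length = ∑ i, lam i) {h : FreeMagma (ZMod T × Fin (∑ i, lam i))}
    (hh : h ∈ expand σ.perm ι T lam v) :
    ∑ g ∈ expand σ.perm ι T lam u, geomZero ω (fun H => D.cartan (ι (color lam H.1.1.1))
      ((σ.perm ^ H.2.val) (ι (color lam H.1.1.2)))) (mirror h) g = 0 := by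
  set a : DiagIndex T (∑ i, lam i) → ℂ := fun H => D.cartan (ι (color lam H.1.1.1))
      ((σ.perm ^ H.2.val) (ι (color lam H.1.1.2))) with ha
  set col : Fin (∑ i, lam i) → Fin R := fun p => ι (color lam p) with hcol
  have hlen : ∀ {w : FreeMagma (Fin R)} {g : FreeMagma (ZMod T × Fin (∑ i, lam i))},
      g ∈ expand σ.perm ι T lam w → (leaves g).length = (leaves w).length := fun hg => by
    rw [← leaves_of_mem_expand σ.perm ι lam hg, List.length_map]
  have hlh : (leaves h).length = ∑ i, lam i := (hlen hh).trans hv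
  have hlm : (leaves (mirror h)).length = ∑ i, lam i := (length_leaves_mirror h).trans hlh
  -- The mirrored commutator only contributes a sign, the same for all g.
  have key : ∀ g ∈ expand σ.perm ι T lam u, geomZero ω a (mirror h) g =
      (-1 : ℂ) ^ ((leaves h).length + 1) * ((∑ H, a H) * extForm (leafWeight σ T col) (ev h) (ev g) -
        extForm (leafWeight σ T col) (ctr (leafWeight σ T col) (allVec T _) (ev h))
          (ctr (leafWeight σ T col) (allVec T _) (ev g))) := fun g hg => by
    rw [geomZero_eq_extForm hω a hlm ((hlen hg).trans hu), ev_mirror, mul_smul_comm, map_smul,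
      LinearMap.smul_apply, extForm_allVec_mul, smul_eq_mul]
    rfl
  by_cases hd : Distinct h
  swap
  · refine sum_eq_zero fun g hg => ?_
    rw [key g hg, ev_eq_zero_of_not_distinct hd]
    simp
  -- One expansion with distinct indices shows that the leaves of u correspond to 1, …, m up to σ,
  -- so sums of σ-invariant functions over leaves become sums over the indices.
  by_cases hg0 : ∃ g ∈ expand σ.perm ι T lam u, Distinct g
  swap
  · refine sum_eq_zero fun g hg => ?_
    rw [key g hg, ev_eq_zero_of_not_distinct fun hg1 => hg0 ⟨g, hg, hg1⟩]
    simp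
  obtain ⟨g₀, hg₀, hd₀⟩ := hg0
  have hsum : ∀ {w : FreeMagma (Fin R)} {g : FreeMagma (ZMod T × Fin (∑ i, lam i))},
      g ∈ expand σ.perm ι T lam w → Distinct g → (leaves w).length = ∑ i, lam i →
      ∀ f : Fin R → ℂ, (∀ n b, f ((σ.perm ^ n) b) = f b) →
        ((leaves w).map f).sum = ∑ p, f (col p) := fun {w g} hg hgd hw f hf => by
    rw [← leaves_of_mem_expand σ.perm ι lam hg, List.map_map,
      ← sum_leaves_of_distinct hgd ((hlen hg).trans hw)]
    exact congrArg List.sum (List.map_congr_left fun b _ => hf _ _)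
  -- Twice the total weight of the hyperplanes is exactly the scalar by which the double cobracket
  -- acts.
  have hY : 2 * ∑ H, a H = treePair (orbitCartan σ T) u v -
      ((leaves u).map fun c => orbitCartan σ T c c).sum := by
    rw [two_mul_sum_diagIndex a (fun p q => orbitCartan σ T (col p) (col q))
      (fun p q => orbitCartan_comm hK hT _ _) fun x => sum_zmod_val fun j =>
        D.cartan (col x.1.1) ((σ.perm ^ j) (col x.1.2)), treePair,
      hsum hg₀ hd₀ hu (fun c => orbitCartan σ T c c) fun n b => by
        rw [orbitCartan_perm_pow hK hT, orbitCartan_perm_pow_right hK hT],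
      hsum hg₀ hd₀ hu (fun p => ((leaves v).map fun q => orbitCartan σ T p q).sum) fun n b => by
        simp only [orbitCartan_perm_pow hK hT]]
    congr 1
    exact sum_congr rfl fun p _ => (hsum hh hd hv _ fun n b =>
      orbitCartan_perm_pow_right hK hT n _ b).symm
  have h1 := sum_expand_extForm hK hT ι lam hd u
  have h2 := sum_expand_extForm_ctr hK hT ι lam hd u
  rw [map_leafRoot_of_mem_expand σ.perm ι lam hh] at h1 h2
  rw [cobSum_cobSum hK δ hT (NeZero.ne T) v u (hv.trans hu.symm), ← hY, ← h1, mul_assoc] at h2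
  rw [sum_congr rfl key, ← mul_sum, sum_sub_distrib, ← mul_sum, mul_left_cancel₀ two_ne_zero h2,
    sub_self, mul_zero]

end CartanData.Chevalley.DiagramSymmetry
end Vanishing

/-! ### Conclusion for Ω -/

section Cocycle

variable {R r : ℕ} {𝔥 : Type*} [AddCommGroup 𝔥] [Module ℂ 𝔥] [FiniteDimensional ℂ 𝔥]
  {D : CartanData R 𝔥}

namespace CartanData

theorem mem_neg_of_mem_nMinus {x : D.LieAlg} (hx : x ∈ D.nMinus) : x ∈ D.chevalley.neg := by
  induction hx using LieSubalgebra.lieSpan_induction with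
  | mem x hx =>
    obtain ⟨i, rfl⟩ := hx
    exact Submodule.subset_span ⟨.of i, rfl⟩
  | zero => exact zero_mem _
  | add _ _ _ _ h1 h2 => exact add_mem h1 h2
  | smul c _ _ h => exact Submodule.smul_mem _ c h
  | lie _ _ _ _ h1 h2 => exact D.chevalley.lie_neg_mem h1 h2

theorem mem_pos_of_mem_nPlus {x : D.LieAlg} (hx : x ∈ D.nPlus) : x ∈ D.chevalley.pos := by
  induction hx using LieSubalgebra.lieSpan_induction with
  | mem x hx =>
    obtain ⟨i, rfl⟩ := hx
    exact Submodule.subset_span ⟨.of i, rfl⟩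
  | zero => exact zero_mem _
  | add _ _ _ _ h1 h2 => exact add_mem h1 h2
  | smul c _ _ h => exact Submodule.smul_mem _ c h
  | lie _ _ _ _ h1 h2 => exact Chevalley.lie_pos_mem h1 h2

theorem commutator_mem {α L : Type*} [LieRing L] [LieAlgebra ℂ L] {f : α → L}
    {S : LieSubalgebra ℂ L} (h : ∀ a, f a ∈ S) (u : FreeMagma α) : commutator f u ∈ S := by
  induction u with
  | ih1 a => exact h a
  | ih2 x y hx hy => exact S.lie_mem hx hy

theorem mem_nMinus_of_mem_neg {x : D.LieAlg} (hx : x ∈ D.chevalley.neg) : x ∈ D.nMinus := by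
  have h : D.chevalley.neg ≤ D.nMinus.toSubmodule := Submodule.span_le.2 (by
    rintro _ ⟨u, rfl⟩
    exact commutator_mem (fun i => LieSubalgebra.subset_lieSpan (Set.mem_range_self i)) u)
  exact h hx

theorem mem_nPlus_of_mem_pos {x : D.LieAlg} (hx : x ∈ D.chevalley.pos) : x ∈ D.nPlus := by
  have h : D.chevalley.pos ≤ D.nPlus.toSubmodule := Submodule.span_le.2 (by
    rintro _ ⟨u, rfl⟩
    exact commutator_mem (fun i => LieSubalgebra.subset_lieSpan (Set.mem_range_self i)) u)
  exact h hx

theorem isStandardForm_of_isForm {K : LinearMap.BilinForm ℂ D.LieAlg} (hK : D.chevalley.IsForm K) :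
    D.IsStandardForm K := by
  have hneg : ∀ x ∈ D.chevalley.neg, ∀ n : ℤ, n ≤ 0 → ∀ y ∈ D.chevalley.grade n, K y x = 0 := by
    intro x hx n hn y hy
    induction hx using Submodule.span_induction with
    | mem x hx =>
      obtain ⟨u, rfl⟩ := hx
      have := leaves_length_pos u
      exact hK.commF_eq_zero hy (by omega)
    | zero => exact map_zero _
    | add _ _ _ _ h1 h2 => rw [map_add, h1, h2, add_zero]
    | smul c _ _ h => rw [map_smul, h, smul_zero]
  have hpos : ∀ x ∈ D.chevalley.pos, ∀ n : ℤ, 0 ≤ n → ∀ y ∈ D.chevalley.grade n, K y x = 0 := by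
    intro x hx n hn y hy
    induction hx using Submodule.span_induction with
    | mem x hx =>
      obtain ⟨u, rfl⟩ := hx
      have := leaves_length_pos u
      exact hK.orth hy (D.chevalley.commE_mem_grade u) (by omega)
    | zero => exact map_zero _
    | add _ _ _ _ h1 h2 => rw [map_add, h1, h2, add_zero]
    | smul c _ _ h => rw [map_smul, h, smul_zero]
  have hH : ∀ X, D.genH X ∈ D.chevalley.grade 0 := fun X => D.chevalley.H_mem_grade X
  refine ⟨hK.cartan, fun x hx y hy => ?_, fun x hx y hy => ?_, fun X y hy => ?_, fun X y hy => ?_,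
    fun i j => ?_, hK.inv⟩
  · have hy' := mem_neg_of_mem_nMinus hy
    refine (Submodule.span_le.2 ?_ : D.chevalley.neg ≤ LinearMap.ker (K.flip y))
      (mem_neg_of_mem_nMinus hx)
    rintro _ ⟨u, rfl⟩
    exact hneg y hy' _ (by omega) _ (D.chevalley.commF_mem_grade u)
  · have hy' := mem_pos_of_mem_nPlus hy
    refine (Submodule.span_le.2 ?_ : D.chevalley.pos ≤ LinearMap.ker (K.flip y))
      (mem_pos_of_mem_nPlus hx)
    rintro _ ⟨u, rfl⟩
    exact hpos y hy' _ (by omega) _ (D.chevalley.commE_mem_grade u)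
  · have h := hneg y (mem_neg_of_mem_nMinus hy) 0 le_rfl _ (hH X)
    exact ⟨h, (hK.symm _ _).trans h⟩
  · have h := hpos y (mem_pos_of_mem_nPlus hy) 0 le_rfl _ (hH X)
    exact ⟨h, (hK.symm _ _).trans h⟩
  · refine ⟨(hK.symm _ _).trans ((hK.EF j i).trans ?_), hK.EF i j⟩
    simp only [eq_comm]

namespace DiagramAut

variable (σ : D.DiagramAut)

/-- A diagram automorphism, with its action on the Cartan subalgebra. -/
def symmetry : D.chevalley.DiagramSymmetry where
  aut := σ.aut
  perm := σ.perm
  map_E := σ.map_E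
  map_F := σ.map_F
  map_H := σ.map_H
  map_cartan := Chevalley.map_cartan_of D.chevalley_hasVerma D.chevalley_swap_hasVerma
    σ.map_E σ.map_F

theorem pow_order : σ.symmetry.aut.toLinearEquiv ^ σ.order = 1 :=
  pow_orderOf_eq_one σ.aut.toLinearEquiv

theorem coe_bar (x : D.LieAlg) : (σ.bar x : D.LieAlg) = σ.symmetry.bar σ.order x :=
  (σ.symmetry.bar_apply σ.order x).symm

/-- If the fixed-point subalgebra of the quotient is finite-dimensional, then there are dual
families. -/
theorem exists_dualFamily [FiniteDimensional ℂ σ.fixedQuot] {K : LinearMap.BilinForm ℂ D.LieAlg}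
    (hK : D.chevalley.IsForm K) : ∃ n : ℕ, Nonempty (σ.symmetry.DualFamily K (Fin n)) := by
  let P : Submodule ℂ D.LieAlg := D.chevalley.pos ⊓ σ.fixed.toSubmodule
  let N : Submodule ℂ D.LieAlg := D.chevalley.neg ⊓ σ.fixed.toSubmodule
  -- Pairing with fixed elements of 𝔫 factors through the image of the fixed part of 𝔫_+ in 𝔤̃^σ,
  -- and this bounds the rank of the pairing.
  let π : P →ₗ[ℂ] σ.fixedQuot :=
    { toFun := fun x => ⟨LieSubmodule.Quotient.mk (x : D.LieAlg), x, rfl, by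
        have h : σ.aut (x : D.LieAlg) = x := x.2.2
        rw [h, sub_self]
        exact zero_mem _⟩
      map_add' := fun x y => rfl
      map_smul' := fun c x => rfl }
  obtain ⟨n, e, f, h⟩ := exists_dual_family (K.domRestrict₁₂ P N) π fun x hx => by
    have h1 : (x : D.LieAlg) ∈ D.formKer :=
      (LieSubmodule.Quotient.mk_eq_zero' (N := D.formKer)).1 (congrArg Subtype.val hx)
    ext y
    exact h1 K (isStandardForm_of_isForm hK) y
  exact ⟨n, ⟨{
    e := fun b => e b
    f := fun b => f b
    e_mem := fun b => (e b).2.1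
    f_mem := fun b => (f b).2.1
    e_fixed := fun b => (e b).2.2
    f_fixed := fun b => (f b).2.2
    dual := fun x hx hfx y hy hfy => h ⟨x, hx, hfx⟩ ⟨y, hy, hfy⟩ }⟩⟩

end DiagramAut
end CartanData

theorem sum_weight {perm : Equiv.Perm (Fin R)} {ι : Fin r → Fin R}
    (hι : ∀ a : Fin R, ∃! i : Fin r, perm.SameCycle (ι i) a) (u : FreeMagma (Fin R)) :
    ∑ i, weight perm ι u i = (leaves u).length := by
  classical
  simp only [weight]
  generalize leaves u = l
  induction l with
  | nil => simp
  | cons a l ih =>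
    obtain ⟨i, hi, hi'⟩ := hι a
    simp only [List.countP_cons, sum_add_distrib, List.length_cons]
    refine congrArg₂ (· + ·) ih ?_
    · rw [sum_eq_single i]
      · simp [hi]
      · intro j _ hj
        simp [mt (hi' j) hj]
      · exact fun h => absurd (mem_univ _) h

variable (σ : D.DiagramAut) {ω : ℂ} (hω : IsPrimitiveRoot ω σ.order) (ι : Fin r → Fin R)
  (hι : ∀ a : Fin R, ∃! i : Fin r, σ.perm.SameCycle (ι i) a)

include hω hι in
theorem omegaValue_eq_zero [FiniteDimensional ℂ σ.fixedQuot] (v u : FreeMagma (Fin R)) :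
    omegaValue σ ω ι v u = 0 := by
  obtain ⟨K, hK⟩ := CartanData.Chevalley.exists_isForm D.chevalley_hasVerma.H_injective
  obtain ⟨n, ⟨δ⟩⟩ := σ.exists_dualFamily hK
  dsimp only [omegaValue]
  split_ifs with hw
  · have hu := sum_weight hι u
    have hv := sum_weight hι v
    rw [hw] at hv
    rw [sum_eq_zero, mul_zero]
    intro h hh
    exact CartanData.Chevalley.DiagramSymmetry.sum_geomZero_eq_zero hK (σ := σ.symmetry)
      σ.pow_order δ hω ι (weight σ.perm ι u) hv.symm hu.symm hh
  · rfl

theorem IsOmega.plus_minus_bar {Ω : LinearMap.BilinForm ℂ σ.fixed} (hΩ : IsOmega σ ω ι Ω)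
    (h0 : ∀ v u, omegaValue σ ω ι v u = 0) {x y : D.LieAlg} (hx : x ∈ D.chevalley.pos)
    (hy : y ∈ D.chevalley.neg) : Ω (σ.bar x) (σ.bar y) = 0 := by
  have hadd : ∀ x y, σ.bar (x + y) = σ.bar x + σ.bar y := fun x y => Subtype.ext (by
    rw [σ.coe_bar, map_add, ← σ.coe_bar, ← σ.coe_bar]; rfl)
  have hsmul : ∀ (c : ℂ) x, σ.bar (c • x) = c • σ.bar x := fun c x => Subtype.ext (by
    rw [σ.coe_bar, map_smul, ← σ.coe_bar]; rfl)
  have hzero : σ.bar 0 = 0 := Subtype.ext (by simp [σ.coe_bar])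
  induction hx, hy using Submodule.span_induction₂ with
  | mem_mem x y hx hy =>
    obtain ⟨v, rfl⟩ := hx
    obtain ⟨u, rfl⟩ := hy
    exact (hΩ.plus_minus v u).trans (h0 v u)
  | zero_left => rw [hzero, map_zero, LinearMap.zero_apply]
  | zero_right => rw [hzero, map_zero]
  | add_left _ _ _ _ _ _ h1 h2 => rw [hadd, map_add, LinearMap.add_apply, h1, h2, add_zero]
  | add_right _ _ _ _ _ _ h1 h2 => rw [hadd, map_add, h1, h2, add_zero]
  | smul_left c _ _ _ _ h => rw [hsmul, map_smul, LinearMap.smul_apply, h, smul_zero]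
  | smul_right c _ _ _ _ h => rw [hsmul, map_smul, h, smul_zero]

/-- A fixed element x satisfies x̄ = T x, so the values on projected commutators determine Ω between
𝔫_+^σ and 𝔫^σ. Projections to heights commute with σ, hence 𝔤^σ is the sum of its three parts, and
all other pairs vanish by definition. -/
theorem IsOmega.eq_zero {Ω : LinearMap.BilinForm ℂ σ.fixed} (hΩ : IsOmega σ ω ι Ω)
    (h0 : ∀ v u, omegaValue σ ω ι v u = 0) : Ω = 0 := by
  have hbar : ∀ x : σ.fixed, σ.bar x = (σ.order : ℂ) • x := fun x => Subtype.ext (by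
    rw [σ.coe_bar, σ.symmetry.bar_of_fixed x.2]; rfl)
  have hpm : ∀ x y : σ.fixed, (x : D.LieAlg) ∈ D.chevalley.pos → (y : D.LieAlg) ∈ D.chevalley.neg →
      Ω x y = 0 := by
    intro x y hx hy
    have h := hΩ.plus_minus_bar σ ι h0 hx hy
    have hT : (σ.order : ℂ) ≠ 0 := Nat.cast_ne_zero.2 (NeZero.ne σ.order)
    rw [hbar, hbar, map_smul, map_smul, LinearMap.smul_apply] at h
    exact (smul_eq_zero_iff_right hT).1 ((smul_eq_zero_iff_right hT).1 h)
  have hmp : ∀ x y : σ.fixed, (x : D.LieAlg) ∈ D.chevalley.neg → (y : D.LieAlg) ∈ D.chevalley.pos →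
      Ω x y = 0 := fun x y hx hy => by rw [hΩ.skew, hpm y x hy hx, neg_zero]
  have hdec : ∀ x : σ.fixed, ∃ a b c : σ.fixed, x = a + b + c ∧ (a : D.LieAlg) ∈ D.chevalley.neg ∧
      (∃ X, (b : D.LieAlg) = D.genH X) ∧ (c : D.LieAlg) ∈ D.chevalley.pos := by
    intro x
    have hf : ∀ s, σ.aut (D.chevalley.proj s x) = D.chevalley.proj s x := fun s =>
      (σ.symmetry.aut_proj s x).trans (congrArg _ x.2)
    obtain ⟨X, hX⟩ := CartanData.Chevalley.proj_zero_mem (C := D.chevalley) (x : D.LieAlg)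
    exact ⟨⟨_, hf _⟩, ⟨_, hf _⟩, ⟨_, hf _⟩,
      Subtype.ext (CartanData.Chevalley.proj_add_proj (C := D.chevalley) (x : D.LieAlg)).symm,
      CartanData.Chevalley.proj_neg_mem _, ⟨X, hX.symm⟩, CartanData.Chevalley.proj_pos_mem _⟩
  ext x y
  obtain ⟨a, b, c, rfl, ha, hb, hc⟩ := hdec x
  obtain ⟨a', b', c', rfl, ha', hb', hc'⟩ := hdec y
  have hr : ∀ z, Ω z b' = 0 := fun z => by rw [hΩ.skew, hΩ.cartan_zero b' z hb', neg_zero]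
  simp only [map_add, LinearMap.add_apply, hr, hΩ.cartan_zero b _ hb, hpm c a' hc ha',
    hmp a c' ha hc', hΩ.minus_minus a a' (CartanData.mem_nMinus_of_mem_neg ha)
      (CartanData.mem_nMinus_of_mem_neg ha'),
    hΩ.plus_plus c c' (CartanData.mem_nPlus_of_mem_pos hc) (CartanData.mem_nPlus_of_mem_pos hc'),
    LinearMap.zero_apply, add_zero]

theorem isOmega_zero (h0 : ∀ v u, omegaValue σ ω ι v u = 0) :
    IsOmega σ ω ι (0 : LinearMap.BilinForm ℂ σ.fixed) where
  skew _ _ := neg_zero.symm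
  cartan_zero _ _ _ := rfl
  minus_minus _ _ _ _ := rfl
  plus_plus _ _ _ _ := rfl
  plus_minus v u := (h0 v u).symm

end Cocycle

end Cyclo

end

theorem mainTheorem8 {R r : ℕ} {𝔥 : Type*} [AddCommGroup 𝔥] [Module ℂ 𝔥] [FiniteDimensional ℂ 𝔥]
    (D : Cyclo.CartanData R 𝔥) (σ : D.DiagramAut)
    (ω : ℂ) (hω : IsPrimitiveRoot ω σ.order)
    (ι : Fin r → Fin R) (hι : ∀ a : Fin R, ∃! i : Fin r, σ.perm.SameCycle (ι i) a)
    (hfin : FiniteDimensional ℂ σ.fixedQuot)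
    (hss : LieAlgebra.IsSemisimple ℂ σ.fixedQuot) :
    (∃! Ω : LinearMap.BilinForm ℂ σ.fixed, Cyclo.IsOmega σ ω ι Ω) ∧
      ∀ Ω : LinearMap.BilinForm ℂ σ.fixed, Cyclo.IsOmega σ ω ι Ω → Ω = 0 := by
  have h0 := Cyclo.omegaValue_eq_zero σ hω ι hι
  have h : ∀ Ω : LinearMap.BilinForm ℂ σ.fixed, Cyclo.IsOmega σ ω ι Ω → Ω = 0 :=
    fun Ω hΩ => hΩ.eq_zero σ ι h0
  -- Existence holds because the prescribed values on pairs of commutators are zero, so they are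
  -- consistent with the zero form.
  exact ⟨⟨0, Cyclo.isOmega_zero σ ι h0, h⟩, h⟩
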